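/- **Setting.** Let $M$ be a connected smooth manifold of dimension $n\ge 2$ with tangent bundle $\pi:TM\to M$, and let $A\subseteq TM$ be open with $\pi(A)=M$. A chart $(U,(x^i))$ induces coordinates $(x^i,y^i)$ on $TU$; write $\partial_i=\partial/\partial x^i$ and $\dot\partial_i=\partial/\partial y^i$. An $A$-anisotropic tensor field of type $(r,s)$ assigns smoothly to each $v\in A$ a tensor $T_v$ of type $(r,s)$ on $T_{\pi(v)}M$. These form the space $\mathcal T^r_s(M_A)$; put $\mathcal T(M_A)=\bigoplus_{r,s}\mathcal T^r_s(M_A)$, $\mathcal F(A)=\mathcal T^0_0(M_A)$, $\mathfrak X(M_A)=\mathcal T^1_0(M_A)$ and $\Omega_s(M_A)\subseteq\mathcal T^0_s(M_A)$ for the alternating ones. A tensor is isotropic if $T_v$ depends only on $\pi(v)$; thus $\mathfrak X(M)\subseteq\mathfrak X(M_A)$. Let $\mathbb C_v=v$ and $(\dot\partial_XT)_v=\lim_{t\to0}\frac1t(T_{v+tX_v}-T_v)$, i.e. $\dot\partial_X T=X^j\dot\partial_jT$ on components. A tensor derivation is a type-preserving $\mathbb R$-linear map of $\mathcal T(M_A)$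 that satisfies the Leibniz rule for $\otimes$ and commutes with all contractions. A nonlinear connection is a smooth subbundle $HA\subseteq TA$ with $TA=HA\oplus\ker d\pi|_A$; its coefficients $N^i_j$ are defined by requiring that $\delta_j=\partial_j-N^i_j\dot\partial_i$ be the horizontal lift of the coordinate field $\partial_j$. Put $Z^H(f)=Z^k\delta_kf$ for $f\in\mathcal F(A)$ and $Z\in\mathfrak X(M_A)$. For a smooth vector field $V$ on an open $U\subseteq M$ with values in $A$, put $D_XV=X^j(\partial_jV^i+N^i_j(V))\partial_i$, and write $T_V$ for the composition of an anisotropic tensor with $V$. An $A$-anisotropic connection is a map $\nabla:\mathfrak X(M)\times\mathfrak X(M)\to\mathfrak X(M_A)$, additive in both arguments, with $\nabla_{fX}Y=f\nabla_XY$ and $\nabla_X(fY)=f\nabla_XY+X(f)Y$ for smooth $f:M\to\mathbb R$. Its Christoffel symbols are given by $\nabla_{\partial_j}\partial_k=\Gamma^i_{jk}\partial_i$, its underlying nonlinear connection has coefficients $N^i_j=\Gamma^i_{jk}y^k$, and with the corresponding $\delta_j$ it acts on $\mathfrak X(M_A)$ by $\nabla_ZX=Z^j(\delta_jX^i+\Gamma^i_{jk}X^k)\partial_i$.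 Its torsion is the anisotropic $(1,2)$-tensor with $\mathrm{Tor}(Z,X)=\nabla_ZX-\nabla_XZ-[Z,X]$ for isotropic $Z,X$. **Theorem.** Fix a nonlinear connection $HA$ and $Z\in\mathfrak X(M_A)$. For $X\in\mathfrak X(M_A)$ the formula $$\mathfrak l^H_ZX=(Z^j\delta_jX^i-X^j\delta_jZ^i)\,\partial_i$$ gives a well-defined element of $\mathfrak X(M_A)$, independent of the chart, and the following hold. (A) Let $\nabla$ be any $A$-anisotropic connection with underlying nonlinear connection $HA$. Its torsion exists and is unique, and $\mathrm{Tor}(Z,X)=\nabla_ZX-\nabla_XZ-\mathfrak l^H_ZX$ for all $X\in\mathfrak X(M_A)$. (B) There is exactly one tensor derivation $\mathfrak l^H_Z$ of $\mathcal T(M_A)$ that extends $X\mapsto\mathfrak l^H_ZX$. For $T\in\mathcal T^r_s(M_A)$, $\theta^\mu\in\Omega_1(M_A)$ and $X_\nu\in\mathfrak X(M_A)$ (in particular for isotropic ones), $$(\mathfrak l^H_ZT)(\theta^1,\dots,\theta^r,X_1,\dots,X_s)=Z^H\big(T(\theta^1,\dots,X_s)\big)-\sum_{\mu=1}^rT(\dots,\mathfrak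 l^H_Z\theta^\mu,\dots)-\sum_{\nu=1}^sT(\dots,\mathfrak l^H_ZX_\nu,\dots),$$ and in every chart $$(\mathfrak l^H_ZT)^{i_1\dots i_r}_{j_1\dots j_s}=Z^k\delta_kT^{i_1\dots i_r}_{j_1\dots j_s}-\sum_{\mu=1}^r(\delta_kZ^{i_\mu})\,T^{i_1\dots k\dots i_r}_{j_1\dots j_s}+\sum_{\nu=1}^s(\delta_{j_\nu}Z^k)\,T^{i_1\dots i_r}_{j_1\dots k\dots j_s},$$ where $k$ replaces $i_\mu$, respectively $j_\nu$. (C) $\mathfrak L^H_Z:=\mathfrak l^H_Z-\dot\partial_{\mathfrak l^H_Z\mathbb C}$ is a tensor derivation of $\mathcal T(M_A)$. If $Z\in\mathfrak X(M)$, then $\mathfrak L^H_Z$ is the Lie derivative $\mathfrak L_Z$, that is, the one and only tensor derivation with $\mathfrak L_ZX=[Z,X]$ for $X\in\mathfrak X(M)$ and $\mathfrak L_Zf=Z^k\partial_kf+y^k(\partial_kZ^i)\dot\partial_if$ for $f\in\mathcal F(A)$. (D) For every open $U\subseteq M$, every smooth vector field $V$ on $U$ with values in $A$, and every $\omega\in\Omega_n(M_A)$,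 one has on $U$ $$(\mathfrak l^H_Z\omega)_V=\mathfrak L_{Z_V}(\omega_V)-(\dot\partial_{D_ZV}\,\omega)_V-\mathrm{trace}(\dot\partial_{DV}Z)\,\omega_V,$$ where $\mathfrak L_{Z_V}$ is the classical Lie derivative on $U$, $D_ZV=D_{Z_V}V$, and $\dot\partial_{DV}Z$ is the field of endomorphisms $w\mapsto(\dot\partial_{D_wV}Z)_V$. -/

import Mathlib

open scoped Manifold ContDiff Topology

namespace Aniso

noncomputable section

/-! ### Charts, coordinate frames, observers -/

section Basics

variable {n : ℕ} {M : Type*} [TopologicalSpace M] [ChartedSpace (EuclideanSpace ℝ (Fin n)) M]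

/-- A smooth coordinate chart `(U, (x¹, …, xⁿ))` of `M`; its domain `U` is `e.1.source`. -/
abbrev Chart (n : ℕ) (M : Type*) [TopologicalSpace M]
    [ChartedSpace (EuclideanSpace ℝ (Fin n)) M] : Type _ :=
  {e : OpenPartialHomeomorph M (EuclideanSpace ℝ (Fin n)) //
    e ∈ IsManifold.maximalAtlas (𝓡 n) ∞ M}

/-- The preferred chart at a point. -/
def prefChart [IsManifold (𝓡 n) ∞ M] (p : M) : Chart n M :=
  ⟨chartAt (EuclideanSpace ℝ (Fin n)) p, IsManifold.chart_mem_maximalAtlas p⟩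

/-- The coordinate vector `∂ᵢ` at `p ∈ U`. -/
def frame (e : Chart n M) (i : Fin n) (p : M) : TangentSpace (𝓡 n) p :=
  (mfderiv (𝓡 n) (𝓡 n) e.1.symm (e.1 p) :
    EuclideanSpace ℝ (Fin n) →L[ℝ] EuclideanSpace ℝ (Fin n)) (EuclideanSpace.single i 1)

/-- The coordinate covector `dxⁱ` at `p ∈ U`. -/
def coframe (e : Chart n M) (i : Fin n) (p : M) : Module.Dual ℝ (TangentSpace (𝓡 n) p) :=
  ((EuclideanSpace.proj i : EuclideanSpace ℝ (Fin n) →L[ℝ] ℝ).comp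
    (mfderiv (𝓡 n) (𝓡 n) e.1 p :
      TangentSpace (𝓡 n) p →L[ℝ] EuclideanSpace ℝ (Fin n))).toLinearMap

theorem mdifferentiable_chart (e : Chart n M) : e.1.MDifferentiable (𝓡 n) (𝓡 n) :=
  ⟨fun _ hx => (mdifferentiableAt_of_mem_maximalAtlas
      (IsManifold.maximalAtlas_subset_of_le (by simp) e.2) hx).mdifferentiableWithinAt,
    fun _ hx => (mdifferentiableAt_symm_of_mem_maximalAtlas
      (IsManifold.maximalAtlas_subset_of_le (by simp) e.2) hx).mdifferentiableWithinAt⟩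

theorem sum_coframe_frame (e : Chart n M) {p : M} (hp : p ∈ e.1.source)
    (w : TangentSpace (𝓡 n) p) : ∑ i, coframe e i p w • frame e i p = w := by
  have h := (mdifferentiable_chart e).symm_comp_deriv hp
  have h2 := congrArg (fun L : TangentSpace (𝓡 n) p →L[ℝ] TangentSpace (𝓡 n) p => L w) h
  refine Eq.trans ?_ h2
  let D : EuclideanSpace ℝ (Fin n) →L[ℝ] EuclideanSpace ℝ (Fin n) :=
    mfderiv (𝓡 n) (𝓡 n) e.1.symm (e.1 p)
  let y : EuclideanSpace ℝ (Fin n) :=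
    (mfderiv (𝓡 n) (𝓡 n) e.1 p : TangentSpace (𝓡 n) p →L[ℝ] EuclideanSpace ℝ (Fin n)) w
  change ∑ i, y i • D (EuclideanSpace.single i 1) = D y
  conv_rhs => rw [← (EuclideanSpace.basisFun (Fin n) ℝ).sum_repr y]
  simp

/-- The induced coordinates `(x, y)` on `TU ⊆ TM`. -/
def tcoord (e : Chart n M) (v : TangentBundle (𝓡 n) M) :
    EuclideanSpace ℝ (Fin n) × EuclideanSpace ℝ (Fin n) :=
  (e.1 v.proj, (mfderiv (𝓡 n) (𝓡 n) e.1 v.proj :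
    TangentSpace (𝓡 n) v.proj →L[ℝ] EuclideanSpace ℝ (Fin n)) v.2)

/-- The inverse of `tcoord e`: the tangent vector `yⁱ ∂ᵢ` at the point with coordinates `x`. -/
def tpoint (e : Chart n M) (z : EuclideanSpace ℝ (Fin n) × EuclideanSpace ℝ (Fin n)) :
    TangentBundle (𝓡 n) M :=
  ⟨e.1.symm z.1, (mfderiv (𝓡 n) (𝓡 n) e.1.symm z.1 :
    EuclideanSpace ℝ (Fin n) →L[ℝ] TangentSpace (𝓡 n) (e.1.symm z.1)) z.2⟩

/-- The derivative at `p` of a real function on `M` in the direction `w ∈ T_pM`. -/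
def dirDeriv (f : M → ℝ) (p : M) (w : TangentSpace (𝓡 n) p) : ℝ :=
  (mfderiv (𝓡 n) 𝓘(ℝ, ℝ) f p : TangentSpace (𝓡 n) p →L[ℝ] ℝ) w

/-- Smooth (isotropic) vector fields on an open subset of `M`. -/
def SmoothVFOn (X : ∀ p : M, TangentSpace (𝓡 n) p) [IsManifold (𝓡 n) ∞ M] (U : Set M) : Prop :=
  ContMDiffOn (𝓡 n) (𝓡 n).tangent ∞ (fun p => (⟨p, X p⟩ : TangentBundle (𝓡 n) M)) U

/-- A real function on `A`, extended by `0` to `TM`. As `A` is open, derivatives of the extension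
at points of `A` are derivatives of the given function. -/
def ext0 {A : Set (TangentBundle (𝓡 n) M)} (f : A → ℝ) : TangentBundle (𝓡 n) M → ℝ :=
  Function.extend Subtype.val f 0

theorem ext0_apply {A : Set (TangentBundle (𝓡 n) M)} (f : A → ℝ) {v : TangentBundle (𝓡 n) M} (hv : v ∈ A) :
    ext0 f v = f ⟨v, hv⟩ :=
  Subtype.val_injective.extend_apply f 0 ⟨v, hv⟩

/-- The coordinate derivative `∂f/∂xⁱ` of a function on `A`, in the chart induced on `TU`. -/
def pdx {A : Set (TangentBundle (𝓡 n) M)} (e : Chart n M) (i : Fin n) (f : A → ℝ) (v : A) : ℝ :=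
  fderiv ℝ (fun z => ext0 f (tpoint e z)) (tcoord e v.1) (EuclideanSpace.single i 1, 0)

/-- The coordinate derivative `∂f/∂yⁱ` of a function on `A`, in the chart induced on `TU`. -/
def pdy {A : Set (TangentBundle (𝓡 n) M)} (e : Chart n M) (i : Fin n) (f : A → ℝ) (v : A) : ℝ :=
  fderiv ℝ (fun z => ext0 f (tpoint e z)) (tcoord e v.1) (0, EuclideanSpace.single i 1)

/-- Smoothness, on the part of `A` over the domain of a chart, of a function on `A`. -/
def SmoothOver [IsManifold (𝓡 n) ∞ M] {A : Set (TangentBundle (𝓡 n) M)} (e : Chart n M)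
    (f : A → ℝ) : Prop :=
  ContMDiffOn (𝓡 n).tangent 𝓘(ℝ, ℝ) ∞ (ext0 f) {v | v ∈ A ∧ v.proj ∈ e.1.source}

end Basics

/-! ### Anisotropic vector fields and tensors -/

section Tensors

variable {n : ℕ} {M : Type*} [TopologicalSpace M] [ChartedSpace (EuclideanSpace ℝ (Fin n)) M]
  [IsManifold (𝓡 n) ∞ M] {A : Set (TangentBundle (𝓡 n) M)}

/-- Smoothness of an `A`-anisotropic vector field `X` (`X_v ∈ T_{π(v)}M` for `v ∈ A`). -/
def SmoothAVF (X : ∀ v : A, TangentSpace (𝓡 n) v.1.proj) : Prop :=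
  ∀ (e : Chart n M) (i : Fin n), SmoothOver e (fun v : A => coframe e i v.1.proj (X v))

/-- The canonical (Liouville) anisotropic vector field `ℂ_v = v`. -/
def liouville (v : A) : TangentSpace (𝓡 n) v.1.proj := v.1.2

/-- Multilinearity of a function of `r` covectors and `s` vectors at a point. -/
def IsMultilin {r s : ℕ} {p : M}
    (t : (Fin r → Module.Dual ℝ (TangentSpace (𝓡 n) p)) → (Fin s → TangentSpace (𝓡 n) p) → ℝ) :
    Prop :=
  (∀ x, ∃ m : MultilinearMap ℝ (fun _ : Fin r => Module.Dual ℝ (TangentSpace (𝓡 n) p)) ℝ,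
    ∀ θ, t θ x = m θ) ∧
  (∀ θ, ∃ m : MultilinearMap ℝ (fun _ : Fin s => TangentSpace (𝓡 n) p) ℝ, ∀ x, t θ x = m x)

/-- Families `T_v : (T*_{π(v)}M)^r × (T_{π(v)}M)^s → ℝ`, `v ∈ A`. -/
abbrev PreTensor (A : Set (TangentBundle (𝓡 n) M)) (r s : ℕ) : Type _ :=
  ∀ v : A, (Fin r → Module.Dual ℝ (TangentSpace (𝓡 n) v.1.proj)) →
    (Fin s → TangentSpace (𝓡 n) v.1.proj) → ℝ

/-- The component `T^{I₁…I_r}_{J₁…J_s} = T(dx^{I₁}, …, dx^{I_r}, ∂_{J₁}, …, ∂_{J_s})`. -/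
def comp {r s : ℕ} (T : PreTensor A r s) (e : Chart n M) (I : Fin r → Fin n) (J : Fin s → Fin n)
    (v : A) : ℝ :=
  T v (fun a => coframe e (I a) v.1.proj) (fun b => frame e (J b) v.1.proj)

theorem SmoothOver.congr' {e : Chart n M} {f : A → ℝ} {F : TangentBundle (𝓡 n) M → ℝ}
    (hF : ContMDiffOn (𝓡 n).tangent 𝓘(ℝ, ℝ) ∞ F {v | v ∈ A ∧ v.proj ∈ e.1.source})
    (h : ∀ v : A, v.1.proj ∈ e.1.source → f v = F v.1) : SmoothOver e f :=
  hF.congr fun v hv => (ext0_apply f hv.1).trans (h ⟨v, hv.1⟩ hv.2)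

theorem SmoothOver.zero (e : Chart n M) : SmoothOver e (fun _ : A => (0 : ℝ)) :=
  SmoothOver.congr' contMDiffOn_const fun _ _ => rfl

theorem SmoothOver.add {e : Chart n M} {f g : A → ℝ} (hf : SmoothOver e f)
    (hg : SmoothOver e g) : SmoothOver e (fun v => f v + g v) :=
  SmoothOver.congr' (ContMDiffOn.add hf hg) fun v _ => by
    simp only [Pi.add_apply]
    rw [ext0_apply f v.2, ext0_apply g v.2]

theorem SmoothOver.mul {e : Chart n M} {f g : A → ℝ} (hf : SmoothOver e f)
    (hg : SmoothOver e g) : SmoothOver e (fun v => f v * g v) :=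
  SmoothOver.congr' (ContMDiffOn.mul hf hg) fun v _ => by
    simp only [Pi.mul_apply]
    rw [ext0_apply f v.2, ext0_apply g v.2]

theorem SmoothOver.sum {e : Chart n M} {ι : Type*} (S : Finset ι) {f : ι → A → ℝ}
    (hf : ∀ k, SmoothOver e (f k)) : SmoothOver e (fun v => ∑ k ∈ S, f k v) := by
  classical
  induction S using Finset.induction_on with
  | empty => simpa using SmoothOver.zero e
  | insert a S ha ih => simpa [Finset.sum_insert ha] using (hf a).add ih

theorem SmoothOver.congr {e : Chart n M} {f g : A → ℝ} (hf : SmoothOver e f)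
    (h : ∀ v : A, v.1.proj ∈ e.1.source → g v = f v) : SmoothOver e g :=
  SmoothOver.congr' hf fun v hv => (h v hv).trans (ext0_apply f v.2).symm

/-- The real vector space `𝒯^r_s(M_A)` of smooth `A`-anisotropic tensor fields:
`r`-contravariant, `s`-covariant, multilinear at each `v ∈ A`, with smooth components. -/
def Tensor (A : Set (TangentBundle (𝓡 n) M)) (r s : ℕ) : Submodule ℝ (PreTensor A r s) where
  carrier := {T | (∀ v, IsMultilin (T v)) ∧
    ∀ (e : Chart n M) (I : Fin r → Fin n) (J : Fin s → Fin n), SmoothOver e (comp T e I J)}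
  zero_mem' := ⟨fun _ => ⟨fun _ => ⟨0, fun _ => rfl⟩, fun _ => ⟨0, fun _ => rfl⟩⟩,
    fun e _ _ => SmoothOver.zero e⟩
  add_mem' := by
    rintro T S ⟨hT, hT'⟩ ⟨hS, hS'⟩
    refine ⟨fun v => ⟨fun x => ?_, fun θ => ?_⟩, fun e I J => (hT' e I J).add (hS' e I J)⟩
    · obtain ⟨m, hm⟩ := (hT v).1 x
      obtain ⟨m', hm'⟩ := (hS v).1 x
      exact ⟨m + m', fun θ => congrArg₂ (· + ·) (hm θ) (hm' θ)⟩
    · obtain ⟨m, hm⟩ := (hT v).2 θ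
      obtain ⟨m', hm'⟩ := (hS v).2 θ
      exact ⟨m + m', fun x => congrArg₂ (· + ·) (hm x) (hm' x)⟩
  smul_mem' := by
    rintro c T ⟨hT, hT'⟩
    refine ⟨fun v => ⟨fun x => ?_, fun θ => ?_⟩, fun e I J => ?_⟩
    · obtain ⟨m, hm⟩ := (hT v).1 x
      exact ⟨c • m, fun θ => congrArg (c * ·) (hm θ)⟩
    · obtain ⟨m, hm⟩ := (hT v).2 θ
      exact ⟨c • m, fun x => congrArg (c * ·) (hm x)⟩
    · exact SmoothOver.mul (SmoothOver.congr' contMDiffOn_const fun _ _ => rfl) (hT' e I J)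

/-- The tensor of type `(1, 0)` given by a smooth anisotropic vector field: `X(θ) = θ(X)`. -/
def vecTensor (X : ∀ v : A, TangentSpace (𝓡 n) v.1.proj) (hX : SmoothAVF X) : Tensor A 1 0 :=
  ⟨fun v θ _ => θ 0 (X v), fun v => ⟨fun _ => ⟨
      { toFun := fun θ => θ 0 (X v)
        map_update_add' := by
          intro _ θ i a b
          have hi : i = 0 := Subsingleton.elim _ _
          subst hi
          simp
        map_update_smul' := by
          intro _ θ i c a
          have hi : i = 0 := Subsingleton.elim _ _
          subst hi
          simp }, fun _ => rfl⟩,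
      fun θ => ⟨MultilinearMap.constOfIsEmpty ℝ _ (θ 0 (X v)), fun _ => rfl⟩⟩,
    fun e I _ => hX e (I 0)⟩

theorem vec_one_eq_update {V : Type*} [Zero V] (w : V) :
    (![w] : Fin 1 → V) = Function.update (fun _ => 0) 0 w := by
  funext i
  have hi : i = 0 := Subsingleton.elim _ _
  subst hi
  simp

/-- The covector at `v` given by a tensor of type `(0, 1)`. -/
def covec (θ : Tensor A 0 1) (v : A) : Module.Dual ℝ (TangentSpace (𝓡 n) v.1.proj) where
  toFun w := θ.1 v ![] ![w]
  map_add' a b := by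
    obtain ⟨m, hm⟩ := (θ.2.1 v).2 ![]
    simp only [hm, vec_one_eq_update]
    exact m.map_update_add _ 0 a b
  map_smul' c a := by
    obtain ⟨m, hm⟩ := (θ.2.1 v).2 ![]
    simp only [hm, vec_one_eq_update]
    exact m.map_update_smul _ 0 c a

theorem exists_mul_multilin {V : Type*} [AddCommGroup V] [Module ℝ V] {r r' : ℕ}
    (m : MultilinearMap ℝ (fun _ : Fin r => V) ℝ) (m' : MultilinearMap ℝ (fun _ : Fin r' => V) ℝ) :
    ∃ q : MultilinearMap ℝ (fun _ : Fin (r + r') => V) ℝ, ∀ x,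
      m (fun a => x (Fin.castAdd r' a)) * m' (fun a => x (Fin.natAdd r a)) = q x :=
  ⟨((LinearMap.mul' ℝ ℝ).compMultilinearMap (m.domCoprod m')).domDomCongr finSumFinEquiv,
    fun x => by simp⟩

/-- The tensor product `T ⊗ S`. -/
def tprod {r s r' s' : ℕ} (T : Tensor A r s) (S : Tensor A r' s') : Tensor A (r + r') (s + s') :=
  ⟨fun v θ x =>
    T.1 v (fun a => θ (Fin.castAdd r' a)) (fun b => x (Fin.castAdd s' b)) *
      S.1 v (fun a => θ (Fin.natAdd r a)) (fun b => x (Fin.natAdd s b)), by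
    refine ⟨fun v => ⟨fun x => ?_, fun θ => ?_⟩, fun e I J => ?_⟩
    · obtain ⟨m, hm⟩ := (T.2.1 v).1 (fun b => x (Fin.castAdd s' b))
      obtain ⟨m', hm'⟩ := (S.2.1 v).1 (fun b => x (Fin.natAdd s b))
      simp only [hm, hm']
      exact exists_mul_multilin m m'
    · obtain ⟨m, hm⟩ := (T.2.1 v).2 (fun a => θ (Fin.castAdd r' a))
      obtain ⟨m', hm'⟩ := (S.2.1 v).2 (fun a => θ (Fin.natAdd r a))
      simp only [hm, hm']
      exact exists_mul_multilin m m'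
    · exact (T.2.2 e (fun a => I (Fin.castAdd r' a)) (fun b => J (Fin.castAdd s' b))).mul
        (S.2.2 e (fun a => I (Fin.natAdd r a)) (fun b => J (Fin.natAdd s b)))⟩

/-- A basis of `T_pM`, used to write traces; these do not depend on the basis. -/
def tbasis (p : M) : Module.Basis (Fin n) ℝ (TangentSpace (𝓡 n) p) :=
  (EuclideanSpace.basisFun (Fin n) ℝ).toBasis

theorem trace_eq {V : Type*} [AddCommGroup V] [Module ℝ V] {ι : Type*} [Fintype ι] {κ : Type*}
    [Fintype κ] (B : Module.Dual ℝ V → V → ℝ)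
    (h₁ : ∀ w, ∃ L : Module.Dual ℝ V →ₗ[ℝ] ℝ, ∀ α, B α w = L α)
    (h₂ : ∀ α, ∃ L : V →ₗ[ℝ] ℝ, ∀ w, B α w = L w) (b : Module.Basis ι ℝ V)
    (E : κ → V) (ε : κ → Module.Dual ℝ V) (hE : ∀ w, ∑ k, ε k w • E k = w) :
    ∑ i, B (b.coord i) (b i) = ∑ k, B (ε k) (E k) := by
  have h3 : ∀ i, B (b.coord i) (b i) = ∑ k, ε k (b i) * B (b.coord i) (E k) := by
    intro i
    obtain ⟨L, hL⟩ := h₂ (b.coord i)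
    rw [hL]
    conv_lhs => rw [← hE (b i)]
    simp [hL]
  have h4 : ∀ k, B (ε k) (E k) = ∑ i, ε k (b i) * B (b.coord i) (E k) := by
    intro k
    obtain ⟨L, hL⟩ := h₁ (E k)
    have : ε k = ∑ i, ε k (b i) • b.coord i := by
      refine b.ext fun j => ?_
      classical
      simp
    simp only [hL]
    conv_lhs => rw [this]
    rw [map_sum]
    exact Finset.sum_congr rfl fun i _ => by rw [map_smul, smul_eq_mul]
  simp only [h3, h4]
  exact Finset.sum_comm

theorem exists_insertNth_multilin {V : Type*} [AddCommGroup V] [Module ℝ V] {r : ℕ}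
    (m : MultilinearMap ℝ (fun _ : Fin (r + 1) => V) ℝ) (a : Fin (r + 1)) (w : V) :
    ∃ q : MultilinearMap ℝ (fun _ : Fin r => V) ℝ, ∀ x : Fin r → V,
      m (Fin.insertNth (α := fun _ => V) a w x) = q x :=
  ⟨m.curryMid a w, fun _ => rfl⟩

theorem exists_insertNth_lin {V : Type*} [AddCommGroup V] [Module ℝ V] {r : ℕ}
    (m : MultilinearMap ℝ (fun _ : Fin (r + 1) => V) ℝ) (a : Fin (r + 1)) (x : Fin r → V) :
    ∃ L : V →ₗ[ℝ] ℝ, ∀ w, m (Fin.insertNth (α := fun _ => V) a w x) = L w :=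
  ⟨{ toFun := fun w => m.curryMid a w x
     map_add' := by simp
     map_smul' := by simp }, fun _ => rfl⟩

theorem insertNth_comp {V W : Type*} {r : ℕ} (g : V → W) (a : Fin (r + 1)) (k : V)
    (I : Fin r → V) : Fin.insertNth (α := fun _ => W) a (g k) (fun i => g (I i)) =
      fun i => g (Fin.insertNth (α := fun _ => V) a k I i) := by
  funext i
  refine Fin.succAboveCases a ?_ (fun j => ?_) i <;> simp

/-- The contraction of the `a`-th contravariant slot with the `c`-th covariant slot. -/
def contract {r s : ℕ} (a : Fin (r + 1)) (c : Fin (s + 1)) (T : Tensor A (r + 1) (s + 1)) :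
    Tensor A r s :=
  ⟨fun v θ x => ∑ k, T.1 v
      (Fin.insertNth (α := fun _ => Module.Dual ℝ (TangentSpace (𝓡 n) v.1.proj)) a
        ((tbasis v.1.proj).coord k) θ)
      (Fin.insertNth (α := fun _ => TangentSpace (𝓡 n) v.1.proj) c (tbasis v.1.proj k) x), by
    refine ⟨fun v => ⟨fun x => ?_, fun θ => ?_⟩, fun e I J => ?_⟩
    · have h : ∀ k : Fin n, ∃ q : MultilinearMap ℝ
          (fun _ : Fin r => Module.Dual ℝ (TangentSpace (𝓡 n) v.1.proj)) ℝ, ∀ θ, T.1 v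
          (Fin.insertNth (α := fun _ => Module.Dual ℝ (TangentSpace (𝓡 n) v.1.proj)) a
            ((tbasis v.1.proj).coord k) θ)
          (Fin.insertNth (α := fun _ => TangentSpace (𝓡 n) v.1.proj) c
            (tbasis v.1.proj k) x) = q θ := by
        intro k
        obtain ⟨m, hm⟩ := (T.2.1 v).1 (Fin.insertNth (α := fun _ => TangentSpace (𝓡 n) v.1.proj) c
            (tbasis v.1.proj k) x)
        simp only [hm]
        exact exists_insertNth_multilin m a _
      choose q hq using h
      exact ⟨∑ k, q k, fun θ => by simp [hq]⟩
    · have h : ∀ k : Fin n, ∃ q : MultilinearMap ℝ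
          (fun _ : Fin s => TangentSpace (𝓡 n) v.1.proj) ℝ, ∀ x, T.1 v
          (Fin.insertNth (α := fun _ => Module.Dual ℝ (TangentSpace (𝓡 n) v.1.proj)) a
            ((tbasis v.1.proj).coord k) θ)
          (Fin.insertNth (α := fun _ => TangentSpace (𝓡 n) v.1.proj) c
            (tbasis v.1.proj k) x) = q x := by
        intro k
        obtain ⟨m, hm⟩ := (T.2.1 v).2
          (Fin.insertNth (α := fun _ => Module.Dual ℝ (TangentSpace (𝓡 n) v.1.proj)) a
            ((tbasis v.1.proj).coord k) θ)
        simp only [hm]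
        exact exists_insertNth_multilin m c _
      choose q hq using h
      exact ⟨∑ k, q k, fun x => by simp [hq]⟩
    · refine SmoothOver.congr (SmoothOver.sum Finset.univ fun k : Fin n =>
        T.2.2 e (Fin.insertNth (α := fun _ => Fin n) a k I)
          (Fin.insertNth (α := fun _ => Fin n) c k J)) fun v hv => ?_
      refine (trace_eq (fun α w => T.1 v
        (Fin.insertNth (α := fun _ => Module.Dual ℝ (TangentSpace (𝓡 n) v.1.proj)) a α
          (fun i => coframe e (I i) v.1.proj))
        (Fin.insertNth (α := fun _ => TangentSpace (𝓡 n) v.1.proj) c w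
          (fun j => frame e (J j) v.1.proj))) (fun w => ?_) (fun α => ?_) (tbasis v.1.proj)
          (fun k => frame e k v.1.proj) (fun k => coframe e k v.1.proj)
          (sum_coframe_frame e hv)).trans ?_
      · obtain ⟨m, hm⟩ := (T.2.1 v).1
          (Fin.insertNth (α := fun _ => TangentSpace (𝓡 n) v.1.proj) c w
            (fun j => frame e (J j) v.1.proj))
        simp only [hm]
        exact exists_insertNth_lin m a _
      · obtain ⟨m, hm⟩ := (T.2.1 v).2
          (Fin.insertNth (α := fun _ => Module.Dual ℝ (TangentSpace (𝓡 n) v.1.proj)) a α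
            (fun i => coframe e (I i) v.1.proj))
        simp only [hm]
        exact exists_insertNth_lin m c _
      · refine Finset.sum_congr rfl fun k _ => ?_
        exact congrArg₂ (T.1 v) (insertNth_comp (fun i => coframe e i v.1.proj) a k I)
          (insertNth_comp (fun i => frame e i v.1.proj) c k J)⟩

/-- A type-preserving family of `ℝ`-linear maps `𝒯^r_s(M_A) → 𝒯^r_s(M_A)`, that is, a
type-preserving `ℝ`-linear map of `𝒯(M_A) = ⨁ 𝒯^r_s(M_A)`. -/
abbrev TensorOp (A : Set (TangentBundle (𝓡 n) M)) : Type _ :=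
  ∀ r s : ℕ, Tensor A r s →ₗ[ℝ] Tensor A r s

/-- Anisotropic tensor derivations: Leibniz rule for tensor products, and commutation with all
contractions. -/
structure IsTensorDerivation (D : TensorOp A) : Prop where
  leibniz : ∀ (r s r' s' : ℕ) (T : Tensor A r s) (S : Tensor A r' s'),
    D (r + r') (s + s') (tprod T S) = tprod (D r s T) S + tprod T (D r' s' S)
  contraction : ∀ (r s : ℕ) (a : Fin (r + 1)) (c : Fin (s + 1)) (T : Tensor A (r + 1) (s + 1)),
    D r s (contract a c T) = contract a c (D (r + 1) (s + 1) T)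

/-- The vertical derivative `(∂̇_X T)_v = lim_{t → 0} (T_{v + t X_v} - T_v) / t`, with the direction
`x = X_v` given. (For `t` near `0`, `v + t x ∈ A` because `A` is open.) -/
def vertDeriv {r s : ℕ} (T : PreTensor A r s) (v : A) (x : TangentSpace (𝓡 n) v.1.proj)
    (θ : Fin r → Module.Dual ℝ (TangentSpace (𝓡 n) v.1.proj))
    (w : Fin s → TangentSpace (𝓡 n) v.1.proj) : ℝ :=
  open scoped Classical in
  deriv (fun t : ℝ =>
    if h : (⟨v.1.proj, v.1.2 + t • x⟩ : TangentBundle (𝓡 n) M) ∈ A then T ⟨_, h⟩ θ w else 0) 0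

/-- The vertical derivative `∂̇_x Z` of an anisotropic vector field, at `v`, as a vector. -/
def vertDerivVec (Z : ∀ v : A, TangentSpace (𝓡 n) v.1.proj) (v : A)
    (x : TangentSpace (𝓡 n) v.1.proj) : TangentSpace (𝓡 n) v.1.proj :=
  ∑ k, vertDeriv (r := 1) (s := 0) (fun u θ _ => θ 0 (Z u)) v x
    ![(tbasis v.1.proj).coord k] ![] • tbasis v.1.proj k

end Tensors

/-! ### Connections -/

section Connections

variable {n : ℕ} {M : Type*} [TopologicalSpace M] [ChartedSpace (EuclideanSpace ℝ (Fin n)) M]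
  [IsManifold (𝓡 n) ∞ M] {A : Set (TangentBundle (𝓡 n) M)}

/-- The differential at `v ∈ TM` of the projection `π : TM → M`. -/
def dproj (v : TangentBundle (𝓡 n) M) :
    TangentSpace (𝓡 n).tangent v →L[ℝ] TangentSpace (𝓡 n) v.proj :=
  mfderiv (𝓡 n).tangent (𝓡 n) (Bundle.TotalSpace.proj : TangentBundle (𝓡 n) M → M) v

/-- The horizontal lift with respect to a complement `H` of the vertical space `ker dπ_v`:
the vector of `H` that projects to `w`. -/
def hlift (v : TangentBundle (𝓡 n) M) (H : Submodule ℝ (TangentSpace (𝓡 n).tangent v))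
    (w : TangentSpace (𝓡 n) v.proj) : TangentSpace (𝓡 n).tangent v :=
  Classical.epsilon fun u => u ∈ H ∧ dproj v u = w

/-- The nonlinear coefficients `Nⁱⱼ` at `v` of a horizontal space: the horizontal lift of `∂ⱼ` is
`δⱼ = ∂/∂xʲ - Nⁱⱼ ∂/∂yⁱ`. -/
def nlCoeff (e : Chart n M) (v : TangentBundle (𝓡 n) M)
    (H : Submodule ℝ (TangentSpace (𝓡 n).tangent v)) (i j : Fin n) : ℝ :=
  -((mfderiv (𝓡 n).tangent
      𝓘(ℝ, EuclideanSpace ℝ (Fin n) × EuclideanSpace ℝ (Fin n)) (tcoord e) v :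
      TangentSpace (𝓡 n).tangent v →L[ℝ] EuclideanSpace ℝ (Fin n) × EuclideanSpace ℝ (Fin n))
    (hlift v H (frame e j v.proj))).2 i

/-- A nonlinear connection on `A → M`: a smooth subbundle `HA ⊆ TA` with `TA = HA ⊕ VA`, where
`VA = ker dπ`. (As `A` is open in `TM`, `T_vA = T_v(TM)`.) -/
structure NonlinearConnection (A : Set (TangentBundle (𝓡 n) M)) where
  H : ∀ v : A, Submodule ℝ (TangentSpace (𝓡 n).tangent v.1)
  isCompl : ∀ v : A, IsCompl (H v) (dproj v.1).ker
  smooth : ∀ (e : Chart n M) (i j : Fin n), SmoothOver e (fun v : A => nlCoeff e v.1 (H v) i j)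

/-- The coefficients `Nⁱⱼ` of a nonlinear connection in a chart. -/
def NonlinearConnection.N (HA : NonlinearConnection A) (e : Chart n M) (i j : Fin n) (v : A) : ℝ :=
  nlCoeff e v.1 (HA.H v) i j

/-- `δⱼ f = ∂f/∂xʲ - Nⁱⱼ ∂f/∂yⁱ` for a function `f` on `A`. -/
def NonlinearConnection.delta (HA : NonlinearConnection A) (e : Chart n M) (j : Fin n) (f : A → ℝ)
    (v : A) : ℝ :=
  pdx e j f v - ∑ i, HA.N e i j v * pdy e i f v

/-- `Z^H(f) = Zᵏ δₖ f`, computed in the chart `e`. -/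
def NonlinearConnection.horDeriv (HA : NonlinearConnection A) (e : Chart n M)
    (Z : ∀ v : A, TangentSpace (𝓡 n) v.1.proj) (f : A → ℝ) (v : A) : ℝ :=
  ∑ k, coframe e k v.1.proj (Z v) * HA.delta e k f v

/-- `(Zʲ δⱼXⁱ - Xʲ δⱼZⁱ) ∂ᵢ`, computed in the chart `e`. -/
def NonlinearConnection.lieIn (HA : NonlinearConnection A) (e : Chart n M)
    (Z X : ∀ v : A, TangentSpace (𝓡 n) v.1.proj) (v : A) : TangentSpace (𝓡 n) v.1.proj :=
  ∑ i, (∑ j, (coframe e j v.1.proj (Z v) *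
          HA.delta e j (fun u => coframe e i u.1.proj (X u)) v -
        coframe e j v.1.proj (X v) *
          HA.delta e j (fun u => coframe e i u.1.proj (Z u)) v)) • frame e i v.1.proj

/-- The anisotropic Lie bracket `𝔩^H_Z X` of two anisotropic vector fields, computed at `v` in the
preferred chart at `π(v)`. -/
def NonlinearConnection.lie (HA : NonlinearConnection A)
    (Z X : ∀ v : A, TangentSpace (𝓡 n) v.1.proj) (v : A) : TangentSpace (𝓡 n) v.1.proj :=
  HA.lieIn (prefChart v.1.proj) Z X v

/-- The nonlinear covariant derivative `D_w V = wʲ (∂ⱼVⁱ + Nⁱⱼ(V)) ∂ᵢ` at `p`, for `w ∈ T_pM`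
and an observer field `V`, computed in the chart `e`. -/
def NonlinearConnection.D (HA : NonlinearConnection A) (e : Chart n M)
    (V : ∀ p : M, TangentSpace (𝓡 n) p) (p : M)
    (hp : (⟨p, V p⟩ : TangentBundle (𝓡 n) M) ∈ A) (w : TangentSpace (𝓡 n) p) :
    TangentSpace (𝓡 n) p :=
  ∑ i, (∑ j, coframe e j p w *
    (fderiv ℝ (fun x => coframe e i (e.1.symm x) (V (e.1.symm x))) (e.1 p)
        (EuclideanSpace.single j 1) +
      HA.N e i j ⟨⟨p, V p⟩, hp⟩)) • frame e i p

/-- An `A`-anisotropic connection `∇ : 𝔛(M) × 𝔛(M) → 𝔛(M_A)`, with the Koszul properties. -/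
structure AnisoConnection (A : Set (TangentBundle (𝓡 n) M)) where
  nabla : (∀ p : M, TangentSpace (𝓡 n) p) → (∀ p : M, TangentSpace (𝓡 n) p) →
    ∀ v : A, TangentSpace (𝓡 n) v.1.proj
  smooth : ∀ X Y, SmoothVFOn X Set.univ → SmoothVFOn Y Set.univ → SmoothAVF (nabla X Y)
  add_left : ∀ X X' Y, SmoothVFOn X Set.univ → SmoothVFOn X' Set.univ → SmoothVFOn Y Set.univ →
    ∀ v, nabla (fun p => X p + X' p) Y v = nabla X Y v + nabla X' Y v
  smul_left : ∀ (f : M → ℝ) X Y, ContMDiff (𝓡 n) 𝓘(ℝ, ℝ) ∞ f →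
    SmoothVFOn X Set.univ → SmoothVFOn Y Set.univ →
    ∀ v, nabla (fun p => f p • X p) Y v = f v.1.proj • nabla X Y v
  add_right : ∀ X Y Y', SmoothVFOn X Set.univ → SmoothVFOn Y Set.univ → SmoothVFOn Y' Set.univ →
    ∀ v, nabla X (fun p => Y p + Y' p) v = nabla X Y v + nabla X Y' v
  leibniz : ∀ (f : M → ℝ) X Y, ContMDiff (𝓡 n) 𝓘(ℝ, ℝ) ∞ f →
    SmoothVFOn X Set.univ → SmoothVFOn Y Set.univ →
    ∀ v, nabla X (fun p => f p • Y p) v = f v.1.proj • nabla X Y v +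
      dirDeriv f v.1.proj (X v.1.proj) • Y v.1.proj

/-- A global smooth vector field on `M` that agrees with `∂ᵢ` near `p`. -/
def frameExt (e : Chart n M) (i : Fin n) (p : M) : ∀ q : M, TangentSpace (𝓡 n) q :=
  Classical.epsilon fun X => SmoothVFOn X Set.univ ∧ ∀ᶠ q in 𝓝 p, X q = frame e i q

theorem smoothVFOn_frame (e : Chart n M) (i : Fin n) : SmoothVFOn (frame e i) e.1.source := by
  have h1 : ContMDiffOn (𝓡 n) (𝓡 n).tangent ∞
      (fun x => (⟨x, EuclideanSpace.single i 1⟩ :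
        TangentBundle (𝓡 n) (EuclideanSpace ℝ (Fin n)))) Set.univ :=
    contMDiffOn_vectorSpace_iff_contDiffOn.2 contDiffOn_const
  have h2 := (contMDiffOn_symm_of_mem_maximalAtlas e.2).contMDiffOn_tangentMapWithin (m := ∞)
    (by simp) e.1.open_target.uniqueMDiffOn
  have h3 : ContMDiffOn (𝓡 n) (𝓡 n) ∞ e.1 e.1.source := contMDiffOn_of_mem_maximalAtlas e.2
  have h4 := h2.comp (h1.comp h3 fun _ _ => trivial) fun q hq => e.1.map_source hq
  refine h4.congr fun q hq => ?_
  simp only [Function.comp, tangentMapWithin]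
  rw [mfderivWithin_of_isOpen e.1.open_target (e.1.map_source hq)]
  have key : ∀ (q' : M) (w : EuclideanSpace ℝ (Fin n)), q' = q →
      (⟨q, w⟩ : TangentBundle (𝓡 n) M) = ⟨q', w⟩ := by
    rintro _ _ rfl
    rfl
  exact key _ _ (e.1.left_inv hq)

/-- `frameExt` has the property by which it is chosen. -/
theorem frameExt_spec [T2Space M] (e : Chart n M) (i : Fin n) {p : M} (hp : p ∈ e.1.source) :
    SmoothVFOn (frameExt e i p) Set.univ ∧ ∀ᶠ q in 𝓝 p, frameExt e i p q = frame e i q := by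
  refine Classical.epsilon_spec
    (p := fun X : ∀ q : M, TangentSpace (𝓡 n) q =>
      SmoothVFOn X Set.univ ∧ ∀ᶠ q in 𝓝 p, X q = frame e i q) ?_
  obtain ⟨f, -, hf⟩ := (SmoothBumpFunction.nhds_basis_tsupport (I := 𝓡 n) p).mem_iff.1
    (e.1.open_source.mem_nhds hp)
  refine ⟨fun q => f q • frame e i q, ?_, ?_⟩
  · exact (ContMDiffOn.smul_section_of_tsupport (f.contMDiff.contMDiffOn) e.1.open_source hf
      (smoothVFOn_frame e i)).contMDiffOn
  · filter_upwards [f.eventuallyEq_one] with q hq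
    rw [hq]
    simp

/-- The Christoffel symbols `Γⁱⱼₖ`, defined by `∇_{∂ⱼ} ∂ₖ = Γⁱⱼₖ ∂ᵢ` (as `∇` is local, `∂ⱼ` and `∂ₖ`
may be replaced by global fields that agree with them near the point). -/
def AnisoConnection.christoffel (C : AnisoConnection A) (e : Chart n M) (i j k : Fin n) (v : A) :
    ℝ :=
  coframe e i v.1.proj (C.nabla (frameExt e j v.1.proj) (frameExt e k v.1.proj) v)

/-- `HA` is the underlying nonlinear connection of `∇`: `Nⁱⱼ = Γⁱⱼₖ yᵏ`. -/
def AnisoConnection.IsUnderlying (C : AnisoConnection A) (HA : NonlinearConnection A) : Prop :=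
  ∀ (e : Chart n M) (v : A), v.1.proj ∈ e.1.source → ∀ i j,
    HA.N e i j v = ∑ k, C.christoffel e i j k v * coframe e k v.1.proj v.1.2

/-- The covariant derivative `∇_Z X = Zʲ (δⱼXⁱ + Γⁱⱼₖ Xᵏ) ∂ᵢ` of anisotropic vector fields, computed
in the chart `e`, where `HA` is the underlying nonlinear connection of `∇`. -/
def AnisoConnection.cov (C : AnisoConnection A) (HA : NonlinearConnection A) (e : Chart n M)
    (Z X : ∀ v : A, TangentSpace (𝓡 n) v.1.proj) (v : A) : TangentSpace (𝓡 n) v.1.proj :=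
  ∑ i, (∑ j, coframe e j v.1.proj (Z v) *
    (HA.delta e j (fun u => coframe e i u.1.proj (X u)) v +
      ∑ k, C.christoffel e i j k v * coframe e k v.1.proj (X v))) • frame e i v.1.proj

/-- `Tor` is the torsion of `∇`: the anisotropic `(1, 2)`-tensor with
`Tor(Z, X) = ∇_Z X - ∇_X Z - [Z, X]` for isotropic `Z`, `X`. -/
def AnisoConnection.IsTorsion (C : AnisoConnection A) (Tor : Tensor A 1 2) : Prop :=
  ∀ Z X : ∀ p : M, TangentSpace (𝓡 n) p, SmoothVFOn Z Set.univ → SmoothVFOn X Set.univ →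
    ∀ (v : A) (θ : Fin 1 → Module.Dual ℝ (TangentSpace (𝓡 n) v.1.proj)),
      Tor.1 v θ ![Z v.1.proj, X v.1.proj] =
        θ 0 (C.nabla Z X v - C.nabla X Z v - VectorField.mlieBracket (𝓡 n) Z X v.1.proj)

end Connections

/-! ### Lie derivatives -/

section LieDerivatives

variable {n : ℕ} {M : Type*} [TopologicalSpace M] [ChartedSpace (EuclideanSpace ℝ (Fin n)) M]
  [IsManifold (𝓡 n) ∞ M] {A : Set (TangentBundle (𝓡 n) M)}

/-- The complete lift `Z^c(f) = Zᵏ ∂f/∂xᵏ + yᵏ ∂Zⁱ/∂xᵏ ∂f/∂yⁱ`, computed in the chart `e`. -/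
def completeLift (e : Chart n M) (Z : ∀ p : M, TangentSpace (𝓡 n) p) (f : A → ℝ) (v : A) : ℝ :=
  ∑ k, coframe e k v.1.proj (Z v.1.proj) * pdx e k f v +
    ∑ k, ∑ i, coframe e k v.1.proj v.1.2 *
      fderiv ℝ (fun x => coframe e i (e.1.symm x) (Z (e.1.symm x))) (e.1 v.1.proj)
        (EuclideanSpace.single k 1) * pdy e i f v

/-- `L` is the Lie derivative of anisotropic tensors along the isotropic field `Z`: a tensor
derivation with `L X = [Z, X]` on isotropic vector fields and `L f = Z^c(f)` on functions. -/
structure IsLieDerivative (Z : ∀ p : M, TangentSpace (𝓡 n) p) (L : TensorOp A) : Prop where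
  derivation : IsTensorDerivation L
  vector : ∀ (X₀ : ∀ p : M, TangentSpace (𝓡 n) p) (_ : SmoothVFOn X₀ Set.univ)
    (hX : SmoothAVF (fun v : A => X₀ v.1.proj)) (v : A)
    (θ : Fin 1 → Module.Dual ℝ (TangentSpace (𝓡 n) v.1.proj))
    (x : Fin 0 → TangentSpace (𝓡 n) v.1.proj),
    (L 1 0 (vecTensor (fun v : A => X₀ v.1.proj) hX)).1 v θ x =
      θ 0 (VectorField.mlieBracket (𝓡 n) Z X₀ v.1.proj)
  function : ∀ (f : Tensor A 0 0) (e : Chart n M) (v : A), v.1.proj ∈ e.1.source →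
    (L 0 0 f).1 v ![] ![] = completeLift e Z (fun u => f.1 u ![] ![]) v

/-- The composition `T_V` of a covariant anisotropic tensor with an observer field `V`; the value
is irrelevant at points `p` with `V_p ∉ A`. -/
def compose {s : ℕ} (S : Tensor A 0 s) (V : ∀ p : M, TangentSpace (𝓡 n) p) (p : M)
    (x : Fin s → TangentSpace (𝓡 n) p) : ℝ :=
  open scoped Classical in
  if h : (⟨p, V p⟩ : TangentBundle (𝓡 n) M) ∈ A then S.1 ⟨_, h⟩ ![] x else 0

/-- The composition `Z_V` of an anisotropic vector field with an observer field `V`. -/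
def composeVec (Z : ∀ v : A, TangentSpace (𝓡 n) v.1.proj) (V : ∀ p : M, TangentSpace (𝓡 n) p)
    (p : M) : TangentSpace (𝓡 n) p :=
  open scoped Classical in
  if h : (⟨p, V p⟩ : TangentBundle (𝓡 n) M) ∈ A then Z ⟨_, h⟩ else 0

/-- The classical Lie derivative of a covariant tensor field `τ`, evaluated on vector fields:
`(𝔏_W τ)(Y₁, …, Y_s) = W(τ(Y₁, …, Y_s)) - ∑ᵢ τ(Y₁, …, [W, Yᵢ], …, Y_s)`. -/
def lieDerivForm {s : ℕ} (W : ∀ p : M, TangentSpace (𝓡 n) p)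
    (τ : ∀ p : M, (Fin s → TangentSpace (𝓡 n) p) → ℝ) (Y : Fin s → ∀ p : M, TangentSpace (𝓡 n) p)
    (p : M) : ℝ :=
  dirDeriv (fun q => τ q (fun i => Y i q)) p (W p) -
    ∑ i, τ p (Function.update (fun j => Y j p) i (VectorField.mlieBracket (𝓡 n) W (Y i) p))

/-- Anisotropic `s`-forms: alternating covariant tensors. -/
def IsForm {s : ℕ} (S : Tensor A 0 s) : Prop :=
  ∀ (v : A) (x : Fin s → TangentSpace (𝓡 n) v.1.proj) (i j : Fin s), i ≠ j → x i = x j →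
    S.1 v ![] x = 0

end LieDerivatives

end

end Aniso

namespace Aniso

noncomputable section

/-! ### Coordinate frames, coframes and the charts they induce on the tangent bundle. -/

section ChartCalculus

variable {n : ℕ} {M : Type*} [TopologicalSpace M] [ChartedSpace (EuclideanSpace ℝ (Fin n)) M]

/-! A derivation of the anisotropic tensor algebra is governed by two pieces of data: the vector
field `W` on `A` by which it acts on functions, and its effect on coordinate frames. In a chart it
reads `D X = W(Xⁱ) ∂ᵢ - B X` for an endomorphism field `B`, and the product rule extends it to all
tensors. The local recipes agree on overlaps when the difference of the two `B`'s, applied to `∂ⱼ`,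
is the `W`-derivative of the Jacobian; this is `DerivationData.compat`, and
`DerivationData.opAt_chart` draws the conclusion. Leibniz rule and contractions are then checked on
components. Both operators of the theorem are instances: `𝔩^H_Z` has `W` the horizontal lift of `Z`
and `Bⁱⱼ = δⱼZⁱ` (`lieData`), while `∂̇_Y` has `W` the vertical lift of `Y` and `B = 0`
(`vertData`). For `𝔩^H_Z`, compatibility is the symmetry of the second derivatives of transition
maps (`derVec_frame_lift`). The chart independence of the bracket itself is read off from that of
the operator.

Uniqueness: the difference of two derivations that agree on vector fields kills every `fX`, hence
every function `f` (`eq_zero_on_functions`). A derivation that kills functions and isotropic vector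
fields kills everything, by induction on the type: fill one slot at a time by contracting with a
field that it annihilates (`eq_zero`).

(A) In coordinates the derivative terms of `∇_Z X - ∇_X Z` are exactly those of the bracket, whether
the Lie bracket of isotropic fields or `𝔩^H`. What remains in both cases is the antisymmetrised
Christoffel symbol, contracted with `Z` and `X`.

(C) Isotropic fields have no vertical derivative and `δⱼ` acts on their components as `∂ⱼ`, so
`𝔩^H_Z` gives the Lie bracket on them. On functions, the `N`-terms of `Z^H` cancel those of
`∂̇_{𝔩^H_Z ℂ}`, and the complete lift of `Z` remains.

(D) The differential of an observer field splits as `dV(w) = w^H + (D_w V)^vertical`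
(`dirDeriv_along`). Hence `[Z_V, Y] = (𝔩^H_Z Y)_V - ∂̇_{D_Y V} Z`, and comparing the two formulas
for the derivative of `S(Y₁, …, Y_s)` gives `compose_op` for covariant tensors of every degree. For
an `n`-form the sum of the correction terms is a trace (`sum_map_update`). -/

theorem coframe_frame (e : Chart n M) {p : M} (hp : p ∈ e.1.source) (i j : Fin n) :
    coframe e i p (frame e j p) = if i = j then 1 else 0 := by
  have h := ((mdifferentiable_chart e).mfderiv hp).apply_symm_apply
    (EuclideanSpace.single j 1 : EuclideanSpace ℝ (Fin n))
  have h2 := congrArg (fun w : EuclideanSpace ℝ (Fin n) => w i) h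
  refine Eq.trans h2 ?_
  simp

theorem ext_coframe (e : Chart n M) {p : M} (hp : p ∈ e.1.source) {w w' : TangentSpace (𝓡 n) p}
    (h : ∀ i, coframe e i p w = coframe e i p w') : w = w' := by
  rw [← sum_coframe_frame e hp w, ← sum_coframe_frame e hp w']
  simp only [h]

theorem coframe_sum_frame (e : Chart n M) {p : M} (hp : p ∈ e.1.source) (c : Fin n → ℝ)
    (i : Fin n) : coframe e i p (∑ j, c j • frame e j p) = c i := by
  simp [coframe_frame e hp]

theorem sum_dual_coframe (e : Chart n M) {p : M} (hp : p ∈ e.1.source)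
    (θ : Module.Dual ℝ (TangentSpace (𝓡 n) p)) :
    ∑ i, θ (frame e i p) • coframe e i p = θ := by
  refine LinearMap.ext fun w => ?_
  conv_rhs => rw [← sum_coframe_frame e hp w]
  simp [mul_comm]

theorem apply_eq_sum (e : Chart n M) {p : M} (hp : p ∈ e.1.source)
    (θ : Module.Dual ℝ (TangentSpace (𝓡 n) p)) (w : TangentSpace (𝓡 n) p) :
    θ w = ∑ k, θ (frame e k p) * coframe e k p w := by
  conv_lhs => rw [← sum_coframe_frame e hp w]
  simp [mul_comm]

theorem tpoint_tcoord (e : Chart n M) {v : TangentBundle (𝓡 n) M} (hv : v.proj ∈ e.1.source) :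
    tpoint e (tcoord e v) = v := by
  have h := ((mdifferentiable_chart e).mfderiv hv).symm_apply_apply v.2
  -- All tangent spaces are definitionally `EuclideanSpace ℝ (Fin n)`, so vectors at two base points
  -- can be compared before the base points are identified.
  have key : ∀ (q' : M) (w w' : EuclideanSpace ℝ (Fin n)), q' = v.proj → w = w' →
      (⟨q', w⟩ : TangentBundle (𝓡 n) M) = ⟨v.proj, w'⟩ := by
    rintro _ _ _ rfl rfl
    rfl
  exact key _ _ _ (e.1.left_inv hv) h

theorem tcoord_tpoint (e : Chart n M)
    {z : EuclideanSpace ℝ (Fin n) × EuclideanSpace ℝ (Fin n)} (hz : z.1 ∈ e.1.target) :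
    tcoord e (tpoint e z) = z := by
  have h := congrArg (fun L : EuclideanSpace ℝ (Fin n) →L[ℝ] EuclideanSpace ℝ (Fin n) => L z.2)
    ((mdifferentiable_chart e).comp_symm_deriv hz)
  exact Prod.ext (e.1.right_inv hz) h

variable [IsManifold (𝓡 n) ∞ M]

theorem isOpen_over (e : Chart n M) : IsOpen {v : TangentBundle (𝓡 n) M | v.proj ∈ e.1.source} :=
  e.1.open_source.preimage (FiberBundle.continuous_proj (EuclideanSpace ℝ (Fin n)) _)

theorem contMDiffOn_tcoord (e : Chart n M) :
    ContMDiffOn (𝓡 n).tangent 𝓘(ℝ, EuclideanSpace ℝ (Fin n) × EuclideanSpace ℝ (Fin n)) ∞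
      (tcoord e) {v | v.proj ∈ e.1.source} := by
  have h1 : ContMDiffOn (𝓡 n) (𝓡 n) ∞ e.1 e.1.source := contMDiffOn_of_mem_maximalAtlas e.2
  have h2 := h1.contMDiffOn_tangentMapWithin (m := ∞) (by simp) e.1.open_source.uniqueMDiffOn
  have h3 := (contMDiff_snd_tangentBundle_modelSpace (n := ∞) (EuclideanSpace ℝ (Fin n))
    (𝓡 n)).comp_contMDiffOn h2
  have h4 : ContMDiffOn (𝓡 n).tangent (𝓡 n) ∞
      (fun v : TangentBundle (𝓡 n) M => e.1 v.proj) {v | v.proj ∈ e.1.source} :=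
    h1.comp (Bundle.contMDiffOn_proj _) fun _ hv => hv
  refine (h4.prodMk_space h3).congr fun v hv => ?_
  refine Prod.ext rfl ?_
  simp only [Function.comp, tangentMapWithin]
  rw [mfderivWithin_of_isOpen e.1.open_source hv]
  rfl

theorem contMDiffOn_tpoint (e : Chart n M) :
    ContMDiffOn 𝓘(ℝ, EuclideanSpace ℝ (Fin n) × EuclideanSpace ℝ (Fin n)) (𝓡 n).tangent ∞
      (tpoint e) {z | z.1 ∈ e.1.target} := by
  have h1 := contMDiffOn_symm_of_mem_maximalAtlas e.2
  have h2 := h1.contMDiffOn_tangentMapWithin (m := ∞) (by simp) e.1.open_target.uniqueMDiffOn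
  have h3 : ContMDiff 𝓘(ℝ, EuclideanSpace ℝ (Fin n) × EuclideanSpace ℝ (Fin n)) (𝓡 n).tangent ∞
      (fun z : EuclideanSpace ℝ (Fin n) × EuclideanSpace ℝ (Fin n) =>
        (⟨z.1, z.2⟩ : TangentBundle (𝓡 n) (EuclideanSpace ℝ (Fin n)))) := by
    intro z
    refine Bundle.contMDiffAt_totalSpace.2 ⟨contDiff_fst.contMDiff.contMDiffAt, ?_⟩
    refine (contDiff_snd.contMDiff.contMDiffAt (x := z)).congr_of_eventuallyEq
      (Filter.Eventually.of_forall fun y => ?_)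
    simp
  refine (h2.comp h3.contMDiffOn fun z hz => hz).congr fun z hz => ?_
  simp only [Function.comp, tangentMapWithin]
  rw [mfderivWithin_of_isOpen e.1.open_target hz]
  rfl

theorem mdifferentiableAt_tcoord (e : Chart n M) {v : TangentBundle (𝓡 n) M}
    (hv : v.proj ∈ e.1.source) :
    MDifferentiableAt (𝓡 n).tangent 𝓘(ℝ, EuclideanSpace ℝ (Fin n) × EuclideanSpace ℝ (Fin n))
      (tcoord e) v :=
  ((contMDiffOn_tcoord e).contMDiffAt ((isOpen_over e).mem_nhds hv)).mdifferentiableAt (by simp)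

theorem mdifferentiableAt_tpoint (e : Chart n M)
    {z : EuclideanSpace ℝ (Fin n) × EuclideanSpace ℝ (Fin n)} (hz : z.1 ∈ e.1.target) :
    MDifferentiableAt 𝓘(ℝ, EuclideanSpace ℝ (Fin n) × EuclideanSpace ℝ (Fin n)) (𝓡 n).tangent
      (tpoint e) z :=
  ((contMDiffOn_tpoint e).contMDiffAt
    ((e.1.open_target.preimage continuous_fst).mem_nhds hz)).mdifferentiableAt (by simp)

/-- The coordinates of a tangent vector to `TM` in the chart induced by `e`. -/
def dcoord (e : Chart n M) (v : TangentBundle (𝓡 n) M) :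
    TangentSpace (𝓡 n).tangent v →L[ℝ] EuclideanSpace ℝ (Fin n) × EuclideanSpace ℝ (Fin n) :=
  mfderiv (𝓡 n).tangent 𝓘(ℝ, EuclideanSpace ℝ (Fin n) × EuclideanSpace ℝ (Fin n)) (tcoord e) v

/-- The first half of `tcoord e` is `e.1 ∘ π`; the chain rule applied to the two factorisations
gives the identity. -/
theorem dcoord_fst (e : Chart n M) {v : TangentBundle (𝓡 n) M} (hv : v.proj ∈ e.1.source)
    (W : TangentSpace (𝓡 n).tangent v) (i : Fin n) :
    (dcoord e v W).1 i = coframe e i v.proj (dproj v W) := by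
  have h1 : MDifferentiableAt (𝓡 n).tangent (𝓡 n)
      (Bundle.TotalSpace.proj : TangentBundle (𝓡 n) M → M) v :=
    (Bundle.contMDiffAt_proj (n := 1) _).mdifferentiableAt (by simp)
  have h2 := mfderiv_comp v ((mdifferentiable_chart e).mdifferentiableAt hv) h1
  have h3 := mfderiv_comp v
    ((contDiff_fst (𝕜 := ℝ) (E := EuclideanSpace ℝ (Fin n)) (F := EuclideanSpace ℝ (Fin n))
      (n := 1)).contMDiff.contMDiffAt.mdifferentiableAt (by simp))
    (mdifferentiableAt_tcoord e hv)
  have h4 : (dcoord e v W).1 = (mfderiv (𝓡 n) (𝓡 n) e.1 v.proj :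
      TangentSpace (𝓡 n) v.proj →L[ℝ] EuclideanSpace ℝ (Fin n)) (dproj v W) := by
    have h5 := congrArg (fun L : TangentSpace (𝓡 n).tangent v →L[ℝ] EuclideanSpace ℝ (Fin n) =>
      L W) (h3.symm.trans h2)
    refine Eq.trans ?_ h5
    rw [mfderiv_eq_fderiv, fderiv_fst]
    rfl
  rw [h4]
  rfl

end ChartCalculus

end

end Aniso

namespace Aniso

noncomputable section

/-! ### Differential calculus of functions on `A`. -/

section ScalarCalculus

variable {n : ℕ} {M : Type*} [TopologicalSpace M] [ChartedSpace (EuclideanSpace ℝ (Fin n)) M]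
  [IsManifold (𝓡 n) ∞ M] {A : Set (TangentBundle (𝓡 n) M)}

/-- Differentiability at `v` of a function on `A`. -/
def DAt (f : A → ℝ) (v : A) : Prop :=
  MDifferentiableAt (𝓡 n).tangent 𝓘(ℝ, ℝ) (ext0 f) v.1

/-- The differential at `v` of a function on `A`. -/
def der (f : A → ℝ) (v : A) : TangentSpace (𝓡 n).tangent v.1 →L[ℝ] ℝ :=
  mfderiv (𝓡 n).tangent 𝓘(ℝ, ℝ) (ext0 f) v.1

theorem ext0_of_notMem (f : A → ℝ) {v : TangentBundle (𝓡 n) M} (hv : v ∉ A) : ext0 f v = 0 :=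
  Function.extend_apply' f (0 : TangentBundle (𝓡 n) M → ℝ) v fun ⟨a, ha⟩ => hv (ha ▸ a.2)

theorem ext0_add (f g : A → ℝ) : ext0 (fun u => f u + g u) = ext0 f + ext0 g := by
  funext v
  by_cases hv : v ∈ A
  · simp only [Pi.add_apply, ext0_apply _ hv]
  · simp only [Pi.add_apply, ext0_of_notMem _ hv, add_zero]

theorem ext0_mul (f g : A → ℝ) : ext0 (fun u => f u * g u) = ext0 f * ext0 g := by
  funext v
  by_cases hv : v ∈ A
  · simp only [Pi.mul_apply, ext0_apply _ hv]
  · simp only [Pi.mul_apply, ext0_of_notMem _ hv, mul_zero]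

/-- Openness of `A` turns neighbourhoods in the subtype into neighbourhoods in `TM`, so derivatives
of the extension by zero depend only on the germ of the function on `A`. -/
theorem ext0_eventuallyEq_of {f : A → ℝ} {F : TangentBundle (𝓡 n) M → ℝ} (hA : IsOpen A) {v : A}
    (h : ∀ᶠ u in 𝓝 v, f u = F u.1) : ext0 f =ᶠ[𝓝 v.1] F := by
  rw [Filter.EventuallyEq, ← hA.isOpenEmbedding_subtypeVal.map_nhds_eq v]
  exact Filter.eventually_map.2 (h.mono fun u hu => (ext0_apply f u.2).trans hu)

theorem ext0_eventuallyEq (hA : IsOpen A) {f g : A → ℝ} {v : A} (h : ∀ᶠ u in 𝓝 v, f u = g u) :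
    ext0 f =ᶠ[𝓝 v.1] ext0 g :=
  ext0_eventuallyEq_of hA (h.mono fun u hu => hu.trans (ext0_apply g u.2).symm)

theorem eventually_over (e : Chart n M) {v : A} (hv : v.1.proj ∈ e.1.source) :
    ∀ᶠ u : A in 𝓝 v, u.1.proj ∈ e.1.source :=
  continuous_subtype_val.continuousAt.eventually ((isOpen_over e).mem_nhds hv)

theorem DAt.congr (hA : IsOpen A) {f g : A → ℝ} {v : A} (hf : DAt f v)
    (h : ∀ᶠ u in 𝓝 v, g u = f u) : DAt g v :=
  MDifferentiableAt.congr_of_eventuallyEq hf (ext0_eventuallyEq hA h)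

theorem der_congr (hA : IsOpen A) {f g : A → ℝ} {v : A} (h : ∀ᶠ u in 𝓝 v, g u = f u) :
    der g v = der f v :=
  (ext0_eventuallyEq hA h).mfderiv_eq

theorem DAt.of_over (hA : IsOpen A) (e : Chart n M) {f g : A → ℝ} {v : A}
    (hv : v.1.proj ∈ e.1.source) (hf : DAt f v)
    (h : ∀ u : A, u.1.proj ∈ e.1.source → g u = f u) : DAt g v :=
  hf.congr hA ((eventually_over e hv).mono h)

theorem der_of_over (hA : IsOpen A) (e : Chart n M) {f g : A → ℝ} {v : A}
    (hv : v.1.proj ∈ e.1.source) (h : ∀ u : A, u.1.proj ∈ e.1.source → g u = f u) :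
    der g v = der f v :=
  der_congr hA ((eventually_over e hv).mono h)

theorem DAt.const (hA : IsOpen A) (c : ℝ) (v : A) : DAt (fun _ : A => c) v :=
  (mdifferentiableAt_const (c := c)).congr_of_eventuallyEq
    (ext0_eventuallyEq_of hA (F := fun _ => c) (Filter.Eventually.of_forall fun _ => rfl))

theorem der_const (hA : IsOpen A) (c : ℝ) (v : A) : der (fun _ : A => c) v = 0 :=
  ((ext0_eventuallyEq_of hA (F := fun _ => c)
    (Filter.Eventually.of_forall fun _ => rfl)).mfderiv_eq).trans mfderiv_const

theorem DAt.add {f g : A → ℝ} {v : A} (hf : DAt f v) (hg : DAt g v) :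
    DAt (fun u => f u + g u) v := by
  rw [DAt, ext0_add]
  exact MDifferentiableAt.add hf hg

theorem der_add {f g : A → ℝ} {v : A} (hf : DAt f v) (hg : DAt g v)
    (W : TangentSpace (𝓡 n).tangent v.1) :
    der (fun u => f u + g u) v W = der f v W + der g v W := by
  rw [der, ext0_add, mfderiv_add hf hg]
  rfl

theorem DAt.mul {f g : A → ℝ} {v : A} (hf : DAt f v) (hg : DAt g v) :
    DAt (fun u => f u * g u) v := by
  rw [DAt, ext0_mul]
  exact MDifferentiableAt.mul hf hg

theorem der_mul {f g : A → ℝ} {v : A} (hf : DAt f v) (hg : DAt g v)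
    (W : TangentSpace (𝓡 n).tangent v.1) :
    der (fun u => f u * g u) v W = f v * der g v W + der f v W * g v := by
  have h := (hf.hasMFDerivAt.mul hg.hasMFDerivAt).mfderiv
  rw [der, ext0_mul, h, ← ext0_apply f v.2, ← ext0_apply g v.2, mul_comm (der f v W)]
  rfl

theorem DAt.sum (hA : IsOpen A) {ι : Type*} (S : Finset ι) {f : ι → A → ℝ} {v : A}
    (hf : ∀ k, DAt (f k) v) : DAt (fun u => ∑ k ∈ S, f k u) v := by
  classical
  induction S using Finset.induction_on with
  | empty => simpa using DAt.const hA 0 v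
  | insert a S ha ih => simpa [Finset.sum_insert ha] using (hf a).add ih

theorem der_sum (hA : IsOpen A) {ι : Type*} (S : Finset ι) {f : ι → A → ℝ} {v : A}
    (hf : ∀ k, DAt (f k) v) (W : TangentSpace (𝓡 n).tangent v.1) :
    der (fun u => ∑ k ∈ S, f k u) v W = ∑ k ∈ S, der (f k) v W := by
  classical
  induction S using Finset.induction_on with
  | empty => simp [der_const hA]
  | insert a S ha ih =>
    simp only [Finset.sum_insert ha]
    rw [der_add (hf a) (DAt.sum hA S hf), ih]

theorem DAt.prod (hA : IsOpen A) {ι : Type*} (S : Finset ι) {f : ι → A → ℝ} {v : A}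
    (hf : ∀ k, DAt (f k) v) : DAt (fun u => ∏ k ∈ S, f k u) v := by
  classical
  induction S using Finset.induction_on with
  | empty => simpa using DAt.const hA 1 v
  | insert a S ha ih => simpa [Finset.prod_insert ha] using (hf a).mul ih

theorem der_prod_finset (hA : IsOpen A) {ι : Type*} [DecidableEq ι] (S : Finset ι)
    {f : ι → A → ℝ} {v : A} (hf : ∀ k, DAt (f k) v) (W : TangentSpace (𝓡 n).tangent v.1) :
    der (fun u => ∏ k ∈ S, f k u) v W =
      ∑ a ∈ S, ∏ k ∈ S, Function.update (fun k => f k v) a (der (f a) v W) k := by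
  induction S using Finset.induction_on with
  | empty => simp [der_const hA]
  | insert a S ha ih =>
    simp only [Finset.prod_insert ha, Finset.sum_insert ha]
    rw [der_mul (hf a) (DAt.prod hA S hf), ih, add_comm, Finset.mul_sum]
    congr 1
    · rw [Function.update_self]
      congr 1
      refine Finset.prod_congr rfl fun k hk => ?_
      rw [Function.update_of_ne (ne_of_mem_of_not_mem hk ha)]
    · refine Finset.sum_congr rfl fun k hk => ?_
      rw [Function.update_of_ne (ne_of_mem_of_not_mem hk ha).symm]

theorem der_prod (hA : IsOpen A) {ι : Type*} [Fintype ι] [DecidableEq ι]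
    {f : ι → A → ℝ} {v : A} (hf : ∀ k, DAt (f k) v) (W : TangentSpace (𝓡 n).tangent v.1) :
    der (fun u => ∏ k, f k u) v W =
      ∑ a, ∏ k, Function.update (fun k => f k v) a (der (f a) v W) k :=
  der_prod_finset hA Finset.univ hf W

theorem isOpen_inter_over (hA : IsOpen A) (e : Chart n M) :
    IsOpen {v : TangentBundle (𝓡 n) M | v ∈ A ∧ v.proj ∈ e.1.source} :=
  hA.inter (isOpen_over e)

theorem SmoothOver.contMDiffAt (hA : IsOpen A) {e : Chart n M} {f : A → ℝ} (hf : SmoothOver e f)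
    {v : A} (hv : v.1.proj ∈ e.1.source) :
    ContMDiffAt (𝓡 n).tangent 𝓘(ℝ, ℝ) ∞ (ext0 f) v.1 :=
  ContMDiffOn.contMDiffAt hf ((isOpen_inter_over hA e).mem_nhds ⟨v.2, hv⟩)

theorem SmoothOver.dAt (hA : IsOpen A) {e : Chart n M} {f : A → ℝ} (hf : SmoothOver e f)
    {v : A} (hv : v.1.proj ∈ e.1.source) : DAt f v :=
  (hf.contMDiffAt hA hv).mdifferentiableAt (by simp)

theorem smoothOver_of_contMDiffAt {e : Chart n M} {f : A → ℝ}
    (h : ∀ v : A, v.1.proj ∈ e.1.source → ContMDiffAt (𝓡 n).tangent 𝓘(ℝ, ℝ) ∞ (ext0 f) v.1) :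
    SmoothOver e f :=
  fun v hv => (h ⟨v, hv.1⟩ hv.2).contMDiffWithinAt

theorem SmoothOver.const (e : Chart n M) (c : ℝ) : SmoothOver e (fun _ : A => c) :=
  SmoothOver.congr' contMDiffOn_const fun _ _ => rfl

theorem SmoothOver.neg {e : Chart n M} {f : A → ℝ} (hf : SmoothOver e f) :
    SmoothOver e (fun v => -f v) :=
  ((SmoothOver.const e (-1)).mul hf).congr fun v _ => by ring

theorem SmoothOver.sub {e : Chart n M} {f g : A → ℝ} (hf : SmoothOver e f)
    (hg : SmoothOver e g) : SmoothOver e (fun v => f v - g v) :=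
  (hf.add hg.neg).congr fun v _ => by ring

/-- A function on `A` in the coordinates of a chart. -/
def inChart (e : Chart n M) (f : A → ℝ)
    (z : EuclideanSpace ℝ (Fin n) × EuclideanSpace ℝ (Fin n)) : ℝ := ext0 f (tpoint e z)

theorem tcoord_mem (e : Chart n M) {v : TangentBundle (𝓡 n) M} (hv : v.proj ∈ e.1.source) :
    (tcoord e v).1 ∈ e.1.target := e.1.map_source hv

theorem DAt.differentiableAt_inChart {e : Chart n M} {f : A → ℝ} {v : A} (hf : DAt f v)
    (hv : v.1.proj ∈ e.1.source) : DifferentiableAt ℝ (inChart e f) (tcoord e v.1) := by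
  have h := mdifferentiableAt_tpoint e (tcoord_mem e hv)
  have h2 : MDifferentiableAt (𝓡 n).tangent 𝓘(ℝ, ℝ) (ext0 f) (tpoint e (tcoord e v.1)) := by
    rw [tpoint_tcoord e hv]
    exact hf
  exact (h2.comp (tcoord e v.1) h).differentiableAt

theorem der_eq_fderiv {e : Chart n M} {f : A → ℝ} {v : A} (hf : DAt f v)
    (hv : v.1.proj ∈ e.1.source) (W : TangentSpace (𝓡 n).tangent v.1) :
    der f v W = fderiv ℝ (inChart e f) (tcoord e v.1) (dcoord e v.1 W) := by
  have h1 : ext0 f =ᶠ[𝓝 v.1] inChart e f ∘ tcoord e := by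
    filter_upwards [(isOpen_over e).mem_nhds hv] with u hu
    simp only [Function.comp, inChart]
    rw [tpoint_tcoord e hu]
  have h2 := mfderiv_comp v.1 (hf.differentiableAt_inChart hv).mdifferentiableAt
    (mdifferentiableAt_tcoord e hv)
  rw [der, h1.mfderiv_eq, h2, mfderiv_eq_fderiv]
  rfl

theorem fderiv_inChart_eq_sum (e : Chart n M) (f : A → ℝ) (v : A)
    (z : EuclideanSpace ℝ (Fin n) × EuclideanSpace ℝ (Fin n)) :
    fderiv ℝ (inChart e f) (tcoord e v.1) z =
      ∑ i, z.1 i * pdx e i f v + ∑ i, z.2 i * pdy e i f v := by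
  have hz : z = ∑ i, z.1 i • ((EuclideanSpace.single i 1, 0) :
        EuclideanSpace ℝ (Fin n) × EuclideanSpace ℝ (Fin n)) +
      ∑ i, z.2 i • ((0, EuclideanSpace.single i 1) :
        EuclideanSpace ℝ (Fin n) × EuclideanSpace ℝ (Fin n)) := by
    refine Prod.ext ?_ ?_
    · simpa [Prod.fst_sum] using ((EuclideanSpace.basisFun (Fin n) ℝ).sum_repr z.1).symm
    · simpa [Prod.snd_sum] using ((EuclideanSpace.basisFun (Fin n) ℝ).sum_repr z.2).symm
  conv_lhs => rw [hz]
  simp only [map_add, map_sum, map_smul, smul_eq_mul]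
  rfl

theorem der_eq_sum {e : Chart n M} {f : A → ℝ} {v : A} (hf : DAt f v)
    (hv : v.1.proj ∈ e.1.source) (W : TangentSpace (𝓡 n).tangent v.1) :
    der f v W = ∑ i, (dcoord e v.1 W).1 i * pdx e i f v +
      ∑ i, (dcoord e v.1 W).2 i * pdy e i f v :=
  (der_eq_fderiv hf hv W).trans (fderiv_inChart_eq_sum e f v _)

theorem isOpen_inChart_domain (hA : IsOpen A) (e : Chart n M) :
    IsOpen {z : EuclideanSpace ℝ (Fin n) × EuclideanSpace ℝ (Fin n) |
      z.1 ∈ e.1.target ∧ tpoint e z ∈ A} :=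
  (contMDiffOn_tpoint e).continuousOn.isOpen_inter_preimage
    (e.1.open_target.preimage continuous_fst) hA

theorem SmoothOver.contDiffOn_inChart {e : Chart n M} {f : A → ℝ} (hf : SmoothOver e f) :
    ContDiffOn ℝ ∞ (inChart e f) {z | z.1 ∈ e.1.target ∧ tpoint e z ∈ A} := by
  rw [← contMDiffOn_iff_contDiffOn]
  exact ContMDiffOn.comp hf ((contMDiffOn_tpoint e).mono fun z hz => hz.1)
    fun z hz => ⟨hz.2, e.1.map_target hz.1⟩

theorem SmoothOver.fderiv_inChart (hA : IsOpen A) {e : Chart n M} {f : A → ℝ}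
    (hf : SmoothOver e f) (w : EuclideanSpace ℝ (Fin n) × EuclideanSpace ℝ (Fin n)) :
    SmoothOver e (fun v : A => fderiv ℝ (inChart e f) (tcoord e v.1) w) := by
  have h1 := hf.contDiffOn_inChart.fderiv_of_isOpen (m := ∞) (isOpen_inChart_domain hA e)
    (by simp)
  have h2 := (h1.clm_apply (contDiffOn_const (c := w))).contMDiffOn
  refine SmoothOver.congr' (h2.comp ((contMDiffOn_tcoord e).mono fun v hv => hv.2)
    fun v hv => ?_) fun v _ => rfl
  exact ⟨tcoord_mem e hv.2, by rw [tpoint_tcoord e hv.2]; exact hv.1⟩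

theorem SmoothOver.pdx (hA : IsOpen A) {e : Chart n M} {f : A → ℝ} (hf : SmoothOver e f)
    (i : Fin n) : SmoothOver e (Aniso.pdx e i f) :=
  hf.fderiv_inChart hA _

theorem SmoothOver.pdy (hA : IsOpen A) {e : Chart n M} {f : A → ℝ} (hf : SmoothOver e f)
    (i : Fin n) : SmoothOver e (Aniso.pdy e i f) :=
  hf.fderiv_inChart hA _

/-! Functions pulled back from the base. -/

theorem mdifferentiableAt_proj (v : TangentBundle (𝓡 n) M) :
    MDifferentiableAt (𝓡 n).tangent (𝓡 n)
      (Bundle.TotalSpace.proj : TangentBundle (𝓡 n) M → M) v :=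
  (Bundle.contMDiffAt_proj (n := 1) _).mdifferentiableAt (by simp)

theorem DAt.base (hA : IsOpen A) {g : M → ℝ} {v : A}
    (hg : MDifferentiableAt (𝓡 n) 𝓘(ℝ, ℝ) g v.1.proj) : DAt (fun u : A => g u.1.proj) v :=
  (hg.comp v.1 (mdifferentiableAt_proj v.1)).congr_of_eventuallyEq
    (ext0_eventuallyEq_of hA (Filter.Eventually.of_forall fun _ => rfl))

/-- A function pulled back from `M` sees only the projection of the vector. Consequently vertical
lifts annihilate it, and a horizontal lift acts on it as the vector that is lifted. -/
theorem der_base (hA : IsOpen A) {g : M → ℝ} {v : A}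
    (hg : MDifferentiableAt (𝓡 n) 𝓘(ℝ, ℝ) g v.1.proj) (W : TangentSpace (𝓡 n).tangent v.1) :
    der (fun u : A => g u.1.proj) v W = dirDeriv g v.1.proj (dproj v.1 W) := by
  have h := (ext0_eventuallyEq_of hA (f := fun u : A => g u.1.proj) (v := v)
    (F := g ∘ Bundle.TotalSpace.proj) (Filter.Eventually.of_forall fun _ => rfl)).mfderiv_eq
    (I := (𝓡 n).tangent) (I' := 𝓘(ℝ, ℝ))
  rw [der, h, mfderiv_comp v.1 hg (mdifferentiableAt_proj v.1)]
  rfl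

theorem SmoothOver.base {e : Chart n M} {g : M → ℝ}
    (hg : ContMDiffOn (𝓡 n) 𝓘(ℝ, ℝ) ∞ g e.1.source) :
    SmoothOver e (fun u : A => g u.1.proj) :=
  SmoothOver.congr' (hg.comp ((Bundle.contMDiff_proj _).contMDiffOn (s := {v | v ∈ A ∧ v.proj ∈ e.1.source})) fun _ hv => hv.2)
    fun _ _ => rfl

end ScalarCalculus

end

end Aniso

namespace Aniso

noncomputable section

/-! ### Multilinear functions at a point and their components. -/

section Multilinear

variable {n : ℕ} {M : Type*} [TopologicalSpace M] [ChartedSpace (EuclideanSpace ℝ (Fin n)) M]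
  {r s : ℕ} {p : M}
  {t t' : (Fin r → Module.Dual ℝ (TangentSpace (𝓡 n) p)) → (Fin s → TangentSpace (𝓡 n) p) → ℝ}

theorem IsMultilin.add (h : IsMultilin t) (h' : IsMultilin t') :
    IsMultilin (fun θ x => t θ x + t' θ x) := by
  refine ⟨fun x => ?_, fun θ => ?_⟩
  · obtain ⟨m, hm⟩ := h.1 x
    obtain ⟨m', hm'⟩ := h'.1 x
    exact ⟨m + m', fun θ => congrArg₂ (· + ·) (hm θ) (hm' θ)⟩
  · obtain ⟨m, hm⟩ := h.2 θ
    obtain ⟨m', hm'⟩ := h'.2 θ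
    exact ⟨m + m', fun x => congrArg₂ (· + ·) (hm x) (hm' x)⟩

theorem IsMultilin.sub (h : IsMultilin t) (h' : IsMultilin t') :
    IsMultilin (fun θ x => t θ x - t' θ x) := by
  refine ⟨fun x => ?_, fun θ => ?_⟩
  · obtain ⟨m, hm⟩ := h.1 x
    obtain ⟨m', hm'⟩ := h'.1 x
    exact ⟨m - m', fun θ => congrArg₂ (· - ·) (hm θ) (hm' θ)⟩
  · obtain ⟨m, hm⟩ := h.2 θ
    obtain ⟨m', hm'⟩ := h'.2 θ
    exact ⟨m - m', fun x => congrArg₂ (· - ·) (hm x) (hm' x)⟩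

theorem isMultilin_zero :
    IsMultilin (fun (_ : Fin r → Module.Dual ℝ (TangentSpace (𝓡 n) p))
      (_ : Fin s → TangentSpace (𝓡 n) p) => (0 : ℝ)) :=
  ⟨fun _ => ⟨0, fun _ => rfl⟩, fun _ => ⟨0, fun _ => rfl⟩⟩

theorem isMultilin_sum {ι : Type*} (S : Finset ι)
    {f : ι → (Fin r → Module.Dual ℝ (TangentSpace (𝓡 n) p)) →
      (Fin s → TangentSpace (𝓡 n) p) → ℝ} (h : ∀ i, IsMultilin (f i)) :
    IsMultilin (fun θ x => ∑ i ∈ S, f i θ x) := by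
  classical
  induction S using Finset.induction_on with
  | empty => simpa using isMultilin_zero
  | insert a S ha ih => simpa [Finset.sum_insert ha] using (h a).add ih

theorem isMultilin_prod (c : ℝ) (E : Fin r → TangentSpace (𝓡 n) p)
    (ε : Fin s → Module.Dual ℝ (TangentSpace (𝓡 n) p)) :
    IsMultilin (fun θ x => c * (∏ a, θ a (E a)) * ∏ b, ε b (x b)) := by
  refine ⟨fun x => ⟨(c * ∏ b, ε b (x b)) • (MultilinearMap.mkPiAlgebra ℝ (Fin r) ℝ).compLinearMap
      (fun a => Module.Dual.eval ℝ (TangentSpace (𝓡 n) p) (E a)), fun θ => ?_⟩,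
    fun θ => ⟨(c * ∏ a, θ a (E a)) • (MultilinearMap.mkPiAlgebra ℝ (Fin s) ℝ).compLinearMap ε,
      fun x => ?_⟩⟩
  · simp
    ring
  · simp

theorem IsMultilin.map_update_covector_sum (h : IsMultilin t)
    (θ : Fin r → Module.Dual ℝ (TangentSpace (𝓡 n) p)) (x : Fin s → TangentSpace (𝓡 n) p)
    (a : Fin r) {ι : Type*} (S : Finset ι) (c : ι → ℝ)
    (α : ι → Module.Dual ℝ (TangentSpace (𝓡 n) p)) :
    t (Function.update θ a (∑ k ∈ S, c k • α k)) x =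
      ∑ k ∈ S, c k * t (Function.update θ a (α k)) x := by
  obtain ⟨m, hm⟩ := h.1 x
  simp only [hm]
  rw [m.map_update_sum]
  exact Finset.sum_congr rfl fun k _ => m.map_update_smul _ _ _ _

theorem IsMultilin.map_update_vector_sum (h : IsMultilin t)
    (θ : Fin r → Module.Dual ℝ (TangentSpace (𝓡 n) p)) (x : Fin s → TangentSpace (𝓡 n) p)
    (b : Fin s) {ι : Type*} (S : Finset ι) (c : ι → ℝ) (w : ι → TangentSpace (𝓡 n) p) :
    t θ (Function.update x b (∑ k ∈ S, c k • w k)) =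
      ∑ k ∈ S, c k * t θ (Function.update x b (w k)) := by
  obtain ⟨m, hm⟩ := h.2 θ
  simp only [hm]
  rw [m.map_update_sum]
  exact Finset.sum_congr rfl fun k _ => m.map_update_smul _ _ _ _

theorem IsMultilin.map_update_covector_add (h : IsMultilin t)
    (θ : Fin r → Module.Dual ℝ (TangentSpace (𝓡 n) p)) (x : Fin s → TangentSpace (𝓡 n) p)
    (a : Fin r) (α β : Module.Dual ℝ (TangentSpace (𝓡 n) p)) :
    t (Function.update θ a (α + β)) x =
      t (Function.update θ a α) x + t (Function.update θ a β) x := by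
  obtain ⟨m, hm⟩ := h.1 x
  simp only [hm]
  exact m.map_update_add _ _ _ _

theorem IsMultilin.map_update_vector_sub (h : IsMultilin t)
    (θ : Fin r → Module.Dual ℝ (TangentSpace (𝓡 n) p)) (x : Fin s → TangentSpace (𝓡 n) p)
    (b : Fin s) (w w' : TangentSpace (𝓡 n) p) :
    t θ (Function.update x b (w - w')) =
      t θ (Function.update x b w) - t θ (Function.update x b w') := by
  obtain ⟨m, hm⟩ := h.2 θ
  simp only [hm]
  exact m.map_update_sub _ _ _ _

theorem IsMultilin.comp_covector (h : IsMultilin t)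
    (B : TangentSpace (𝓡 n) p →ₗ[ℝ] TangentSpace (𝓡 n) p) (a : Fin r) :
    IsMultilin (fun θ x => t (Function.update θ a ((θ a).comp B)) x) := by
  refine ⟨fun x => ?_, fun θ => h.2 _⟩
  obtain ⟨m, hm⟩ := h.1 x
  refine ⟨m.compLinearMap (Function.update (fun _ => LinearMap.id) a B.dualMap), fun θ => ?_⟩
  refine (hm _).trans ?_
  rw [MultilinearMap.compLinearMap_apply]
  congr 1
  funext a'
  by_cases ha : a' = a
  · subst ha
    simp only [Function.update_self]
    rfl
  · simp [Function.update_of_ne ha]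

theorem IsMultilin.comp_vector (h : IsMultilin t)
    (B : TangentSpace (𝓡 n) p →ₗ[ℝ] TangentSpace (𝓡 n) p) (b : Fin s) :
    IsMultilin (fun θ x => t θ (Function.update x b (B (x b)))) := by
  refine ⟨fun x => h.1 _, fun θ => ?_⟩
  obtain ⟨m, hm⟩ := h.2 θ
  refine ⟨m.compLinearMap (Function.update (fun _ => LinearMap.id) b B), fun x => ?_⟩
  refine (hm _).trans ?_
  rw [MultilinearMap.compLinearMap_apply]
  congr 1
  funext b'
  by_cases hb : b' = b
  · subst hb
    simp
  · simp [Function.update_of_ne hb]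

theorem IsMultilin.expand (h : IsMultilin t) (e : Chart n M) (hp : p ∈ e.1.source)
    (θ : Fin r → Module.Dual ℝ (TangentSpace (𝓡 n) p)) (x : Fin s → TangentSpace (𝓡 n) p) :
    t θ x = ∑ I : Fin r → Fin n, ∑ J : Fin s → Fin n,
      t (fun a => coframe e (I a) p) (fun b => frame e (J b) p) *
        (∏ a, θ a (frame e (I a) p)) * ∏ b, coframe e (J b) p (x b) := by
  have h1 : t θ x = ∑ I : Fin r → Fin n,
      (∏ a, θ a (frame e (I a) p)) * t (fun a => coframe e (I a) p) x := by
    obtain ⟨m, hm⟩ := h.1 x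
    simp only [hm]
    conv_lhs => rw [show θ = fun a => ∑ i, θ a (frame e i p) • coframe e i p from
      funext fun a => (sum_dual_coframe e hp (θ a)).symm]
    rw [m.map_sum]
    exact Finset.sum_congr rfl fun I _ => m.map_smul_univ _ _
  rw [h1]
  refine Finset.sum_congr rfl fun I _ => ?_
  obtain ⟨m, hm⟩ := h.2 (fun a => coframe e (I a) p)
  simp only [hm]
  conv_lhs => rw [show x = fun b => ∑ j, coframe e j p (x b) • frame e j p from
    funext fun b => (sum_coframe_frame e hp (x b)).symm]
  rw [m.map_sum, Finset.mul_sum]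
  refine Finset.sum_congr rfl fun J _ => ?_
  rw [m.map_smul_univ, smul_eq_mul]
  ring

theorem IsMultilin.ext_comp (h : IsMultilin t) (h' : IsMultilin t') (e : Chart n M)
    (hp : p ∈ e.1.source)
    (heq : ∀ (I : Fin r → Fin n) (J : Fin s → Fin n),
      t (fun a => coframe e (I a) p) (fun b => frame e (J b) p) =
        t' (fun a => coframe e (I a) p) (fun b => frame e (J b) p)) : t = t' := by
  funext θ x
  rw [h.expand e hp, h'.expand e hp]
  simp only [heq]

/-- The multilinear function with given components. -/
def ofComp (e : Chart n M) (p : M) (c : (Fin r → Fin n) → (Fin s → Fin n) → ℝ)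
    (θ : Fin r → Module.Dual ℝ (TangentSpace (𝓡 n) p)) (x : Fin s → TangentSpace (𝓡 n) p) : ℝ :=
  ∑ I : Fin r → Fin n, ∑ J : Fin s → Fin n,
    c I J * (∏ a, θ a (frame e (I a) p)) * ∏ b, coframe e (J b) p (x b)

theorem isMultilin_ofComp (e : Chart n M) (p : M)
    (c : (Fin r → Fin n) → (Fin s → Fin n) → ℝ) : IsMultilin (ofComp e p c) :=
  isMultilin_sum _ fun _ => isMultilin_sum _ fun _ => isMultilin_prod _ _ _

theorem ofComp_frame (e : Chart n M) (hp : p ∈ e.1.source)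
    (c : (Fin r → Fin n) → (Fin s → Fin n) → ℝ) (I : Fin r → Fin n) (J : Fin s → Fin n) :
    ofComp e p c (fun a => coframe e (I a) p) (fun b => frame e (J b) p) = c I J := by
  have h1 : ∀ I' : Fin r → Fin n,
      ∏ a, coframe e (I a) p (frame e (I' a) p) = if I = I' then 1 else 0 := fun I' => by
    simp only [coframe_frame e hp, Finset.prod_boole, funext_iff, Finset.mem_univ, true_imp_iff]
  have h2 : ∀ J' : Fin s → Fin n,
      ∏ b, coframe e (J' b) p (frame e (J b) p) = if J' = J then 1 else 0 := fun J' => by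
    simp only [coframe_frame e hp, Finset.prod_boole, funext_iff, Finset.mem_univ, true_imp_iff]
  simp only [ofComp, h1, h2]
  simp

end Multilinear

/-! ### The product rule for a tensor evaluated on fields. -/

section FieldCalculus

variable {n : ℕ} {M : Type*} [TopologicalSpace M] [ChartedSpace (EuclideanSpace ℝ (Fin n)) M]
  [IsManifold (𝓡 n) ∞ M] {A : Set (TangentBundle (𝓡 n) M)} {r s : ℕ}

/-- The derivative of a vector field along `A`, componentwise in a chart. -/
def derVec (e : Chart n M) (X : ∀ u : A, TangentSpace (𝓡 n) u.1.proj) (v : A)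
    (W : TangentSpace (𝓡 n).tangent v.1) : TangentSpace (𝓡 n) v.1.proj :=
  ∑ i, der (fun u : A => coframe e i u.1.proj (X u)) v W • frame e i v.1.proj

/-- The derivative of a covector field along `A`, componentwise in a chart. -/
def derCov (e : Chart n M) (θ : ∀ u : A, Module.Dual ℝ (TangentSpace (𝓡 n) u.1.proj)) (v : A)
    (W : TangentSpace (𝓡 n).tangent v.1) : Module.Dual ℝ (TangentSpace (𝓡 n) v.1.proj) :=
  ∑ i, der (fun u : A => θ u (frame e i u.1.proj)) v W • coframe e i v.1.proj

/-- The derivative of a tensor field, componentwise in a chart. -/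
def derTensor (e : Chart n M) (T : PreTensor A r s) (v : A)
    (W : TangentSpace (𝓡 n).tangent v.1) :
    (Fin r → Module.Dual ℝ (TangentSpace (𝓡 n) v.1.proj)) →
      (Fin s → TangentSpace (𝓡 n) v.1.proj) → ℝ :=
  ofComp e v.1.proj fun I J => der (comp T e I J) v W

theorem comp_eq_sum {T : PreTensor A r s} (hT : ∀ v, IsMultilin (T v)) (e : Chart n M) {u : A}
    (hu : u.1.proj ∈ e.1.source)
    (θ : Fin r → Module.Dual ℝ (TangentSpace (𝓡 n) u.1.proj))
    (x : Fin s → TangentSpace (𝓡 n) u.1.proj) :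
    T u θ x = ∑ I : Fin r → Fin n, ∑ J : Fin s → Fin n,
      comp T e I J u * (∏ a, θ a (frame e (I a) u.1.proj)) *
        ∏ b, coframe e (J b) u.1.proj (x b) :=
  (hT u).expand e hu θ x

variable {T : PreTensor A r s} {e : Chart n M} {v : A}
  {θ : ∀ u : A, Fin r → Module.Dual ℝ (TangentSpace (𝓡 n) u.1.proj)}
  {X : ∀ u : A, Fin s → TangentSpace (𝓡 n) u.1.proj}

theorem DAt.apply_fields (hA : IsOpen A) (hT : ∀ v, IsMultilin (T v))
    (hv : v.1.proj ∈ e.1.source) (hc : ∀ I J, DAt (comp T e I J) v)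
    (hθ : ∀ a i, DAt (fun u => θ u a (frame e i u.1.proj)) v)
    (hX : ∀ b j, DAt (fun u => coframe e j u.1.proj (X u b)) v) :
    DAt (fun u => T u (θ u) (X u)) v := by
  refine DAt.of_over hA e hv ?_ fun u hu => comp_eq_sum hT e hu (θ u) (X u)
  exact DAt.sum hA _ fun I => DAt.sum hA _ fun J =>
    ((hc I J).mul (DAt.prod hA _ fun a => hθ a (I a))).mul (DAt.prod hA _ fun b => hX b (J b))

/-- Expanded in a chart, `T(θ, X)` is a sum of products of a component of `T`, coordinates of the
`θ`'s and coordinates of the `X`'s. Differentiating the three kinds of factor produces the three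
groups of terms. -/
theorem der_apply_fields (hA : IsOpen A) (hT : ∀ v, IsMultilin (T v))
    (hv : v.1.proj ∈ e.1.source) (hc : ∀ I J, DAt (comp T e I J) v)
    (hθ : ∀ a i, DAt (fun u => θ u a (frame e i u.1.proj)) v)
    (hX : ∀ b j, DAt (fun u => coframe e j u.1.proj (X u b)) v)
    (W : TangentSpace (𝓡 n).tangent v.1) :
    der (fun u => T u (θ u) (X u)) v W = derTensor e T v W (θ v) (X v) +
      ∑ a, T v (Function.update (θ v) a (derCov e (fun u => θ u a) v W)) (X v) +
      ∑ b, T v (θ v) (Function.update (X v) b (derVec e (fun u => X u b) v W)) := by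
  have hP : ∀ I : Fin r → Fin n, DAt (fun u => ∏ a, θ u a (frame e (I a) u.1.proj)) v :=
    fun I => DAt.prod hA _ fun a => hθ a (I a)
  have hQ : ∀ J : Fin s → Fin n, DAt (fun u => ∏ b, coframe e (J b) u.1.proj (X u b)) v :=
    fun J => DAt.prod hA _ fun b => hX b (J b)
  -- Replacing one argument by its derivative replaces exactly one factor of each monomial in the
  -- expansion; this matches the shape of `der_prod`. The vector slots are treated likewise in `h2`.
  have h1 : ∀ a, T v (Function.update (θ v) a (derCov e (fun u => θ u a) v W)) (X v) =
      ∑ I : Fin r → Fin n, ∑ J : Fin s → Fin n, comp T e I J v *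
        (∏ a', Function.update (fun a' => θ v a' (frame e (I a') v.1.proj)) a
          (der (fun u => θ u a (frame e (I a) u.1.proj)) v W) a') *
        ∏ b, coframe e (J b) v.1.proj (X v b) := by
    intro a
    rw [comp_eq_sum hT e hv]
    refine Finset.sum_congr rfl fun I _ => Finset.sum_congr rfl fun J _ => ?_
    congr 2
    refine Finset.prod_congr rfl fun a' _ => ?_
    have h3 : derCov e (fun u => θ u a) v W (frame e (I a) v.1.proj) =
        der (fun u => θ u a (frame e (I a) u.1.proj)) v W := by
      simp [derCov, coframe_frame e hv]
    rw [← h3]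
    exact Function.apply_update (fun a' (α : Module.Dual ℝ (TangentSpace (𝓡 n) v.1.proj)) =>
      α (frame e (I a') v.1.proj)) (θ v) a _ a'
  have h2 : ∀ b, T v (θ v) (Function.update (X v) b (derVec e (fun u => X u b) v W)) =
      ∑ I : Fin r → Fin n, ∑ J : Fin s → Fin n, comp T e I J v *
        (∏ a, θ v a (frame e (I a) v.1.proj)) *
        ∏ b', Function.update (fun b' => coframe e (J b') v.1.proj (X v b')) b
          (der (fun u => coframe e (J b) u.1.proj (X u b)) v W) b' := by
    intro b
    rw [comp_eq_sum hT e hv]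
    refine Finset.sum_congr rfl fun I _ => Finset.sum_congr rfl fun J _ => ?_
    congr 1
    refine Finset.prod_congr rfl fun b' _ => ?_
    have h3 : coframe e (J b) v.1.proj (derVec e (fun u => X u b) v W) =
        der (fun u => coframe e (J b) u.1.proj (X u b)) v W :=
      coframe_sum_frame e hv _ _
    rw [← h3]
    exact Function.apply_update (fun b' (w : TangentSpace (𝓡 n) v.1.proj) =>
      coframe e (J b') v.1.proj w) (X v) b _ b'
  have h4 := der_of_over hA e hv (fun u hu => comp_eq_sum hT e hu (θ u) (X u))
  rw [h4, der_sum hA _ (fun I => DAt.sum hA _ fun J => ((hc I J).mul (hP I)).mul (hQ J))]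
  simp only [h1, h2]
  rw [Finset.sum_comm (s := Finset.univ (α := Fin r)),
    Finset.sum_comm (s := Finset.univ (α := Fin s)), derTensor, ofComp,
    ← Finset.sum_add_distrib, ← Finset.sum_add_distrib]
  refine Finset.sum_congr rfl fun I _ => ?_
  rw [der_sum hA _ (fun J => ((hc I J).mul (hP I)).mul (hQ J)),
    Finset.sum_comm (s := Finset.univ (α := Fin r)),
    Finset.sum_comm (s := Finset.univ (α := Fin s)),
    ← Finset.sum_add_distrib, ← Finset.sum_add_distrib]
  refine Finset.sum_congr rfl fun J _ => ?_
  rw [der_mul ((hc I J).mul (hP I)) (hQ J), der_mul (hc I J) (hP I),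
    der_prod hA (fun a => hθ a (I a)), der_prod hA (fun b => hX b (J b)),
    ← Finset.mul_sum, ← Finset.sum_mul, ← Finset.mul_sum]
  ring

end FieldCalculus

end

end Aniso

namespace Aniso

noncomputable section

/-! ### Derivations built from local data: chart independence, Leibniz rule, contractions. -/

section Operators

variable {n : ℕ} {M : Type*} [TopologicalSpace M] [ChartedSpace (EuclideanSpace ℝ (Fin n)) M]
  [IsManifold (𝓡 n) ∞ M] {A : Set (TangentBundle (𝓡 n) M)} {r s : ℕ}

theorem SmoothVFOn.contMDiffOn_coframe {X : ∀ p : M, TangentSpace (𝓡 n) p} {U : Set M}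
    (hX : SmoothVFOn X U) (e : Chart n M) (i : Fin n) :
    ContMDiffOn (𝓡 n) 𝓘(ℝ, ℝ) ∞ (fun p => coframe e i p (X p)) (U ∩ e.1.source) := by
  have h1 : ContMDiffOn (𝓡 n) 𝓘(ℝ, EuclideanSpace ℝ (Fin n) × EuclideanSpace ℝ (Fin n)) ∞
      (fun p => tcoord e ⟨p, X p⟩) (U ∩ e.1.source) :=
    (contMDiffOn_tcoord e).comp (ContMDiffOn.mono hX Set.inter_subset_left) fun p hp => hp.2
  have h2 : ContDiff ℝ ∞
      (fun z : EuclideanSpace ℝ (Fin n) × EuclideanSpace ℝ (Fin n) => z.2 i) := by fun_prop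
  exact h2.contMDiff.comp_contMDiffOn h1

theorem contMDiffOn_coframe_frame (e e' : Chart n M) (i j : Fin n) :
    ContMDiffOn (𝓡 n) 𝓘(ℝ, ℝ) ∞ (fun p => coframe e' i p (frame e j p))
      (e.1.source ∩ e'.1.source) :=
  (smoothVFOn_frame e j).contMDiffOn_coframe e' i

theorem mdifferentiableAt_coframe_frame (e e' : Chart n M) {p : M} (hp : p ∈ e.1.source)
    (hp' : p ∈ e'.1.source) (i j : Fin n) :
    MDifferentiableAt (𝓡 n) 𝓘(ℝ, ℝ) (fun p => coframe e' i p (frame e j p)) p :=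
  ((contMDiffOn_coframe_frame e e' i j).contMDiffAt
    ((e.1.open_source.inter e'.1.open_source).mem_nhds ⟨hp, hp'⟩)).mdifferentiableAt (by simp)

theorem dAt_coframe_frame (hA : IsOpen A) (e e' : Chart n M) {v : A}
    (hv : v.1.proj ∈ e.1.source) (hv' : v.1.proj ∈ e'.1.source) (i j : Fin n) :
    DAt (fun u : A => coframe e' i u.1.proj (frame e j u.1.proj)) v :=
  DAt.base hA (mdifferentiableAt_coframe_frame e e' hv hv' i j)

theorem der_pairing (hA : IsOpen A) {e : Chart n M} {v : A} (hv : v.1.proj ∈ e.1.source)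
    {θ : ∀ u : A, Module.Dual ℝ (TangentSpace (𝓡 n) u.1.proj)}
    {X : ∀ u : A, TangentSpace (𝓡 n) u.1.proj}
    (hθ : ∀ i, DAt (fun u => θ u (frame e i u.1.proj)) v)
    (hX : ∀ i, DAt (fun u : A => coframe e i u.1.proj (X u)) v)
    (W : TangentSpace (𝓡 n).tangent v.1) :
    der (fun u => θ u (X u)) v W = derCov e θ v W (X v) + θ v (derVec e X v W) := by
  rw [der_of_over hA e hv fun u hu => apply_eq_sum e hu (θ u) (X u),
    der_sum hA _ fun k => (hθ k).mul (hX k)]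
  simp only [der_mul (hθ _) (hX _), Finset.sum_add_distrib, derCov, derVec, map_sum, map_smul,
    smul_eq_mul, LinearMap.sum_apply, LinearMap.smul_apply]
  rw [add_comm]
  congr 1
  exact Finset.sum_congr rfl fun k _ => mul_comm _ _

theorem derVec_frame_self (hA : IsOpen A) {e : Chart n M} {v : A} (hv : v.1.proj ∈ e.1.source)
    (j : Fin n) (W : TangentSpace (𝓡 n).tangent v.1) :
    derVec e (fun u : A => frame e j u.1.proj) v W = 0 := by
  refine Finset.sum_eq_zero fun i _ => ?_
  rw [der_of_over hA e hv fun u hu => coframe_frame e hu i j, der_const hA]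
  exact zero_smul _ _

theorem derCov_coframe_self (hA : IsOpen A) {e : Chart n M} {v : A} (hv : v.1.proj ∈ e.1.source)
    (j : Fin n) (W : TangentSpace (𝓡 n).tangent v.1) :
    derCov e (fun u : A => coframe e j u.1.proj) v W = 0 := by
  refine Finset.sum_eq_zero fun i _ => ?_
  rw [der_of_over hA e hv fun u hu => coframe_frame e hu j i, der_const hA]
  exact zero_smul _ _

theorem dAt_comp (hA : IsOpen A) (T : Tensor A r s) {e : Chart n M} {v : A}
    (hv : v.1.proj ∈ e.1.source) (I : Fin r → Fin n) (J : Fin s → Fin n) :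
    DAt (comp T.1 e I J) v :=
  (T.2.2 e I J).dAt hA hv

theorem ext_tensor {T S : Tensor A r s}
    (h : ∀ (e : Chart n M) (v : A), v.1.proj ∈ e.1.source → ∀ I J,
      comp T.1 e I J v = comp S.1 e I J v) : T = S := by
  refine Subtype.ext (funext fun v => ?_)
  exact (T.2.1 v).ext_comp (S.2.1 v) (prefChart v.1.proj)
    (mem_chart_source _ v.1.proj) fun I J => h _ v (mem_chart_source _ v.1.proj) I J

theorem comp_contract (a : Fin (r + 1)) (c : Fin (s + 1)) (T : Tensor A (r + 1) (s + 1))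
    (e : Chart n M) {v : A} (hv : v.1.proj ∈ e.1.source) (I : Fin r → Fin n)
    (J : Fin s → Fin n) :
    comp (contract a c T).1 e I J v =
      ∑ k, comp T.1 e (Fin.insertNth (α := fun _ => Fin n) a k I)
        (Fin.insertNth (α := fun _ => Fin n) c k J) v := by
  refine (trace_eq (fun α w => T.1 v
    (Fin.insertNth (α := fun _ => Module.Dual ℝ (TangentSpace (𝓡 n) v.1.proj)) a α
      (fun i => coframe e (I i) v.1.proj))
    (Fin.insertNth (α := fun _ => TangentSpace (𝓡 n) v.1.proj) c w
      (fun j => frame e (J j) v.1.proj))) (fun w => ?_) (fun α => ?_) (tbasis v.1.proj)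
      (fun k => frame e k v.1.proj) (fun k => coframe e k v.1.proj)
      (sum_coframe_frame e hv)).trans ?_
  · obtain ⟨m, hm⟩ := (T.2.1 v).1
      (Fin.insertNth (α := fun _ => TangentSpace (𝓡 n) v.1.proj) c w
        (fun j => frame e (J j) v.1.proj))
    simp only [hm]
    exact exists_insertNth_lin m a _
  · obtain ⟨m, hm⟩ := (T.2.1 v).2
      (Fin.insertNth (α := fun _ => Module.Dual ℝ (TangentSpace (𝓡 n) v.1.proj)) a α
        (fun i => coframe e (I i) v.1.proj))
    simp only [hm]
    exact exists_insertNth_lin m c _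
  · refine Finset.sum_congr rfl fun k _ => ?_
    exact congrArg₂ (T.1 v) (insertNth_comp (fun i => coframe e i v.1.proj) a k I)
      (insertNth_comp (fun i => frame e i v.1.proj) c k J)

theorem comp_tprod {r' s' : ℕ} (T : Tensor A r s) (S : Tensor A r' s') (e : Chart n M)
    (I : Fin (r + r') → Fin n) (J : Fin (s + s') → Fin n) :
    comp (tprod T S).1 e I J = fun v =>
      comp T.1 e (fun a => I (Fin.castAdd r' a)) (fun b => J (Fin.castAdd s' b)) v *
        comp S.1 e (fun a => I (Fin.natAdd r a)) (fun b => J (Fin.natAdd s b)) v := rfl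

variable (A) in
/-- The data of a derivation of the anisotropic tensor algebra: the vector field on `A` by which
it acts on functions, and in each chart the endomorphism `∂ⱼ ↦ -D(∂ⱼ)`. -/
structure DerivationData where
  W : ∀ v : A, TangentSpace (𝓡 n).tangent v.1
  B : Chart n M → ∀ v : A, TangentSpace (𝓡 n) v.1.proj →ₗ[ℝ] TangentSpace (𝓡 n) v.1.proj
  smooth_fst : ∀ e i, SmoothOver e (fun v : A => (dcoord e v.1 (W v)).1 i)
  smooth_snd : ∀ e i, SmoothOver e (fun v : A => (dcoord e v.1 (W v)).2 i)
  smooth_B : ∀ e i j,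
    SmoothOver e (fun v : A => coframe e i v.1.proj (B e v (frame e j v.1.proj)))
  compat : ∀ (e e' : Chart n M) (v : A), v.1.proj ∈ e.1.source → v.1.proj ∈ e'.1.source → ∀ j,
    derVec e' (fun u : A => frame e j u.1.proj) v (W v) =
      B e' v (frame e j v.1.proj) - B e v (frame e j v.1.proj)

namespace DerivationData

variable (D : DerivationData A)

/-- The derivation applied to a vector field. -/
def bracket (e : Chart n M) (X : ∀ u : A, TangentSpace (𝓡 n) u.1.proj) (v : A) :
    TangentSpace (𝓡 n) v.1.proj :=
  derVec e X v (D.W v) - D.B e v (X v)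

/-- The derivation applied to a covector field. -/
def cobracket (e : Chart n M) (θ : ∀ u : A, Module.Dual ℝ (TangentSpace (𝓡 n) u.1.proj))
    (v : A) : Module.Dual ℝ (TangentSpace (𝓡 n) v.1.proj) :=
  derCov e θ v (D.W v) + (θ v).comp (D.B e v)

/-- The derivation applied to a tensor field, at a point. -/
def opAt (e : Chart n M) (T : PreTensor A r s) (v : A)
    (θ : Fin r → Module.Dual ℝ (TangentSpace (𝓡 n) v.1.proj))
    (x : Fin s → TangentSpace (𝓡 n) v.1.proj) : ℝ :=
  derTensor e T v (D.W v) θ x + ∑ b, T v θ (Function.update x b (D.B e v (x b))) -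
    ∑ a, T v (Function.update θ a ((θ a).comp (D.B e v))) x

variable {D}

theorem isMultilin_opAt (e : Chart n M) {T : PreTensor A r s} (hT : ∀ v, IsMultilin (T v))
    (v : A) : IsMultilin (D.opAt e T v) :=
  ((isMultilin_ofComp e _ _).add
    (isMultilin_sum _ fun b => (hT v).comp_vector (D.B e v) b)).sub
    (isMultilin_sum _ fun a => (hT v).comp_covector (D.B e v) a)

/-- The product rule trades the derivative of the components for the derivative of the scalar `T(θ,
X)`. On the right the chart enters only through `bracket` and `cobracket` of the arguments, which
serves both chart independence and the invariant formula for `𝔩^H_Z`. -/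
theorem opAt_fields (hA : IsOpen A) (T : Tensor A r s) {e : Chart n M} {v : A}
    (hv : v.1.proj ∈ e.1.source)
    {θ : ∀ u : A, Fin r → Module.Dual ℝ (TangentSpace (𝓡 n) u.1.proj)}
    {X : ∀ u : A, Fin s → TangentSpace (𝓡 n) u.1.proj}
    (hθ : ∀ a i, DAt (fun u => θ u a (frame e i u.1.proj)) v)
    (hX : ∀ b j, DAt (fun u : A => coframe e j u.1.proj (X u b)) v) :
    D.opAt e T.1 v (θ v) (X v) = der (fun u => T.1 u (θ u) (X u)) v (D.W v) -
      ∑ a, T.1 v (Function.update (θ v) a (D.cobracket e (fun u => θ u a) v)) (X v) -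
      ∑ b, T.1 v (θ v) (Function.update (X v) b (D.bracket e (fun u => X u b) v)) := by
  rw [der_apply_fields hA T.2.1 hv (fun I J => dAt_comp hA T hv I J) hθ hX]
  simp only [opAt, cobracket, bracket, (T.2.1 v).map_update_covector_add,
    (T.2.1 v).map_update_vector_sub, Finset.sum_add_distrib, Finset.sum_sub_distrib]
  ring

/-- In its own chart `∂ⱼ` has constant coordinates, so its bracket there is `-B e ∂ⱼ`; `compat` says
that the other chart gives the same vector. -/
theorem bracket_frame (hA : IsOpen A) {e e' : Chart n M} {v : A} (hv : v.1.proj ∈ e.1.source)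
    (hv' : v.1.proj ∈ e'.1.source) (j : Fin n) :
    D.bracket e (fun u : A => frame e j u.1.proj) v =
      D.bracket e' (fun u : A => frame e j u.1.proj) v := by
  rw [bracket, bracket, derVec_frame_self hA hv, D.compat e e' v hv hv' j]
  abel

/-- Dual to `bracket_frame`: the pairing `dxⁱ(∂ₖ)` is constant, and differentiating it in the chart
`e'` expresses the derivative of `dxⁱ` through that of `∂ₖ`, which `compat` controls. -/
theorem cobracket_coframe (hA : IsOpen A) {e e' : Chart n M} {v : A}
    (hv : v.1.proj ∈ e.1.source) (hv' : v.1.proj ∈ e'.1.source) (i : Fin n) :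
    D.cobracket e (fun u : A => coframe e i u.1.proj) v =
      D.cobracket e' (fun u : A => coframe e i u.1.proj) v := by
  rw [cobracket, cobracket, derCov_coframe_self hA hv, zero_add]
  refine LinearMap.ext fun w => ?_
  have key : ∀ k, coframe e i v.1.proj (D.B e v (frame e k v.1.proj)) =
      derCov e' (fun u : A => coframe e i u.1.proj) v (D.W v) (frame e k v.1.proj) +
        coframe e i v.1.proj (D.B e' v (frame e k v.1.proj)) := by
    intro k
    have h1 := der_pairing hA hv' (θ := fun u : A => coframe e i u.1.proj)
      (X := fun u : A => frame e k u.1.proj) (fun m => dAt_coframe_frame hA e' e hv' hv i m)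
      (fun m => dAt_coframe_frame hA e e' hv hv' m k) (D.W v)
    rw [der_of_over hA e hv fun u hu => coframe_frame e hu i k, der_const hA,
      D.compat e e' v hv hv' k, map_sub] at h1
    have h2 : (0 : TangentSpace (𝓡 n).tangent v.1 →L[ℝ] ℝ) (D.W v) = 0 := rfl
    linarith
  rw [← sum_coframe_frame e hv w]
  simp only [map_sum, map_smul, LinearMap.comp_apply, LinearMap.add_apply, key, smul_add,
    Finset.sum_add_distrib]

/-- Both sides are multilinear, so it suffices to evaluate on the frame and coframe of `e`. By
`opAt_fields` only the brackets of these particular fields can depend on the chart, and they do not.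
-/
theorem opAt_chart (hA : IsOpen A) (T : Tensor A r s) {e e' : Chart n M} {v : A}
    (hv : v.1.proj ∈ e.1.source) (hv' : v.1.proj ∈ e'.1.source) :
    D.opAt e T.1 v = D.opAt e' T.1 v := by
  refine (isMultilin_opAt e T.2.1 v).ext_comp (isMultilin_opAt e' T.2.1 v) e hv fun I J => ?_
  have h1 := opAt_fields (D := D) hA T hv (θ := fun u a => coframe e (I a) u.1.proj)
    (X := fun u b => frame e (J b) u.1.proj) (fun a i => dAt_coframe_frame hA e e hv hv _ _)
    (fun a i => dAt_coframe_frame hA e e hv hv _ _)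
  have h2 := opAt_fields (D := D) hA T hv' (θ := fun u a => coframe e (I a) u.1.proj)
    (X := fun u b => frame e (J b) u.1.proj) (fun a i => dAt_coframe_frame hA e' e hv' hv _ _)
    (fun a i => dAt_coframe_frame hA e e' hv hv' _ _)
  rw [h1, h2]
  simp only [cobracket_coframe hA hv hv', bracket_frame hA hv hv']

theorem comp_opAt {T : PreTensor A r s} (hT : ∀ v, IsMultilin (T v)) {e : Chart n M} {v : A}
    (hv : v.1.proj ∈ e.1.source) (I : Fin r → Fin n) (J : Fin s → Fin n) :
    D.opAt e T v (fun a => coframe e (I a) v.1.proj) (fun b => frame e (J b) v.1.proj) =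
      der (comp T e I J) v (D.W v) +
      ∑ b, ∑ k, coframe e k v.1.proj (D.B e v (frame e (J b) v.1.proj)) *
        comp T e I (Function.update J b k) v -
      ∑ a, ∑ k, coframe e (I a) v.1.proj (D.B e v (frame e k v.1.proj)) *
        comp T e (Function.update I a k) J v := by
  have h1 : ∀ b k, (fun b' => frame e (Function.update J b k b') v.1.proj) =
      Function.update (fun b' => frame e (J b') v.1.proj) b (frame e k v.1.proj) := by
    intro b k
    funext b'
    exact Function.apply_update (fun _ j => frame e j v.1.proj) J b k b'
  have h2 : ∀ a k, (fun a' => coframe e (Function.update I a k a') v.1.proj) =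
      Function.update (fun a' => coframe e (I a') v.1.proj) a (coframe e k v.1.proj) := by
    intro a k
    funext a'
    exact Function.apply_update (fun _ j => coframe e j v.1.proj) I a k a'
  rw [opAt, derTensor, ofComp_frame e hv]
  congr 1
  · congr 1
    refine Finset.sum_congr rfl fun b _ => ?_
    conv_lhs => rw [← sum_coframe_frame e hv (D.B e v (frame e (J b) v.1.proj))]
    rw [(hT v).map_update_vector_sum]
    simp only [comp, h1]
  · refine Finset.sum_congr rfl fun a _ => ?_
    conv_lhs => rw [← sum_dual_coframe e hv ((coframe e (I a) v.1.proj).comp (D.B e v))]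
    rw [(hT v).map_update_covector_sum]
    simp only [comp, h2, LinearMap.comp_apply]

theorem smoothOver_der (hA : IsOpen A) {e : Chart n M} {f : A → ℝ} (hf : SmoothOver e f) :
    SmoothOver e (fun v => der f v (D.W v)) := by
  refine SmoothOver.congr (SmoothOver.add
    (SmoothOver.sum Finset.univ fun i => (D.smooth_fst e i).mul (hf.pdx hA i))
    (SmoothOver.sum Finset.univ fun i => (D.smooth_snd e i).mul (hf.pdy hA i)))
    fun v hv => der_eq_sum (hf.dAt hA hv) hv _

variable (D)

/-- The derivation applied to a tensor field. -/
def apply (hA : IsOpen A) (T : Tensor A r s) : Tensor A r s :=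
  ⟨fun v => D.opAt (prefChart v.1.proj) T.1 v,
    fun v => isMultilin_opAt _ T.2.1 v, fun e I J => by
      have h : ∀ v : A, v.1.proj ∈ e.1.source →
          D.opAt (prefChart v.1.proj) T.1 v (fun a => coframe e (I a) v.1.proj)
            (fun b => frame e (J b) v.1.proj) = _ := fun v hv =>
        (congrFun (congrFun (opAt_chart hA T (mem_chart_source _ v.1.proj) hv) _) _).trans
          (comp_opAt T.2.1 hv I J)
      refine SmoothOver.congr ?_ h
      refine ((smoothOver_der hA (T.2.2 e I J)).add ?_).sub ?_
      · exact SmoothOver.sum _ fun b => SmoothOver.sum _ fun k =>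
          (D.smooth_B e k (J b)).mul (T.2.2 e I _)
      · exact SmoothOver.sum _ fun a => SmoothOver.sum _ fun k =>
          (D.smooth_B e (I a) k).mul (T.2.2 e _ J)⟩

variable {D}

theorem apply_eq (hA : IsOpen A) (T : Tensor A r s) {e : Chart n M} {v : A}
    (hv : v.1.proj ∈ e.1.source) : (D.apply hA T).1 v = D.opAt e T.1 v :=
  opAt_chart hA T (mem_chart_source _ v.1.proj) hv

theorem comp_apply (hA : IsOpen A) (T : Tensor A r s) {e : Chart n M} {v : A}
    (hv : v.1.proj ∈ e.1.source) (I : Fin r → Fin n) (J : Fin s → Fin n) :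
    comp (D.apply hA T).1 e I J v = der (comp T.1 e I J) v (D.W v) +
      ∑ b, ∑ k, coframe e k v.1.proj (D.B e v (frame e (J b) v.1.proj)) *
        comp T.1 e I (Function.update J b k) v -
      ∑ a, ∑ k, coframe e (I a) v.1.proj (D.B e v (frame e k v.1.proj)) *
        comp T.1 e (Function.update I a k) J v :=
  (congrFun (congrFun (apply_eq hA T hv) _) _).trans (comp_opAt T.2.1 hv I J)

variable (D)

/-- The derivation as an operator on anisotropic tensors. -/
def op (hA : IsOpen A) : TensorOp A := fun r s =>
  { toFun := fun T => D.apply hA T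
    map_add' := fun T S => by
      refine ext_tensor fun e v hv I J => ?_
      have h1 : ∀ (T S : Tensor A r s) I J,
          comp (T + S).1 e I J = fun v => comp T.1 e I J v + comp S.1 e I J v :=
        fun _ _ _ _ => rfl
      rw [h1]
      simp only [comp_apply hA _ hv, h1, der_add (dAt_comp hA T hv I J) (dAt_comp hA S hv I J),
        mul_add, Finset.sum_add_distrib]
      ring
    map_smul' := fun c T => by
      refine ext_tensor fun e v hv I J => ?_
      have h1 : ∀ (T : Tensor A r s) I J,
          comp (c • T).1 e I J = fun v => c * comp T.1 e I J v := fun _ _ _ => rfl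
      rw [RingHom.id_apply, h1]
      simp only [comp_apply hA _ hv, h1, der_mul (DAt.const hA c v) (dAt_comp hA T hv I J),
        der_const hA, mul_left_comm _ c, ← Finset.mul_sum]
      rw [show (0 : TangentSpace (𝓡 n).tangent v.1 →L[ℝ] ℝ) (D.W v) = 0 from rfl]
      ring }

variable {D}

theorem op_leibniz (hA : IsOpen A) {r s r' s' : ℕ} (T : Tensor A r s) (S : Tensor A r' s') :
    D.op hA (r + r') (s + s') (tprod T S) =
      tprod (D.op hA r s T) S + tprod T (D.op hA r' s' S) := by
  refine ext_tensor fun e v hv I J => ?_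
  have h1 : ∀ (T S : Tensor A (r + r') (s + s')) I J,
      comp (T + S).1 e I J v = comp T.1 e I J v + comp S.1 e I J v := fun _ _ _ _ => rfl
  -- The slots of a tensor product form two blocks; `c1` to `c4` say that changing an index in one
  -- block affects that block alone. Each correction term therefore falls on exactly one of the two
  -- factors.
  have c1 : ∀ {m m' : ℕ} (I : Fin (m + m') → Fin n) (a : Fin m) (k : Fin n),
      (fun a' => Function.update I (Fin.castAdd m' a) k (Fin.castAdd m' a')) =
        Function.update (fun a' => I (Fin.castAdd m' a')) a k := by
    intro m m' I a k
    funext a'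
    simp only [Function.update_apply, (Fin.castAdd_injective m m').eq_iff]
  have c2 : ∀ {m m' : ℕ} (I : Fin (m + m') → Fin n) (a : Fin m) (k : Fin n),
      (fun a' => Function.update I (Fin.castAdd m' a) k (Fin.natAdd m a')) =
        fun a' => I (Fin.natAdd m a') := by
    intro m m' I a k
    funext a'
    refine Function.update_of_ne (fun h => ?_) _ _
    have := congrArg Fin.val h
    simp at this
    omega
  have c3 : ∀ {m m' : ℕ} (I : Fin (m + m') → Fin n) (a : Fin m') (k : Fin n),
      (fun a' => Function.update I (Fin.natAdd m a) k (Fin.natAdd m a')) =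
        Function.update (fun a' => I (Fin.natAdd m a')) a k := by
    intro m m' I a k
    funext a'
    simp only [Function.update_apply, (Fin.natAdd_injective m' m).eq_iff]
  have c4 : ∀ {m m' : ℕ} (I : Fin (m + m') → Fin n) (a : Fin m') (k : Fin n),
      (fun a' => Function.update I (Fin.natAdd m a) k (Fin.castAdd m' a')) =
        fun a' => I (Fin.castAdd m' a') := by
    intro m m' I a k
    funext a'
    refine Function.update_of_ne (fun h => ?_) _ _
    have := congrArg Fin.val h
    simp at this
    omega
  rw [h1]
  simp only [comp_tprod]
  change comp (D.apply hA _).1 e I J v = comp (D.apply hA T).1 e _ _ v * _ +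
    _ * comp (D.apply hA S).1 e _ _ v
  simp only [comp_apply hA _ hv, comp_tprod, Fin.sum_univ_add, c1, c2, c3, c4,
    der_mul (dAt_comp hA T hv _ _) (dAt_comp hA S hv _ _)]
  simp only [← mul_assoc, ← Finset.sum_mul]
  simp only [mul_right_comm _ (comp T.1 e _ _ v) (comp S.1 e _ _ v), ← Finset.sum_mul]
  ring

/-- The only correction terms not already present on the left are those in the two contracted slots;
they have opposite signs and both equal the full contraction of `B` with these slots. -/
theorem op_contraction (hA : IsOpen A) {r s : ℕ} (a : Fin (r + 1)) (c : Fin (s + 1))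
    (T : Tensor A (r + 1) (s + 1)) :
    D.op hA r s (contract a c T) = contract a c (D.op hA (r + 1) (s + 1) T) := by
  refine ext_tensor fun e v hv I J => ?_
  rw [comp_contract a c _ e hv]
  change comp (D.apply hA _).1 e I J v = ∑ k, comp (D.apply hA T).1 e _ _ v
  simp only [comp_apply hA _ hv, comp_contract a c T e hv,
    der_of_over hA e hv (fun u hu => comp_contract a c T e hu I J),
    der_sum hA Finset.univ (fun k => dAt_comp hA T hv _ _)]
  simp only [Fin.sum_univ_succAbove _ c, Fin.sum_univ_succAbove _ a, Fin.insertNth_apply_same,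
    Fin.insertNth_apply_succAbove, Fin.update_insertNth, ← Fin.insertNth_update,
    Finset.sum_sub_distrib, Finset.sum_add_distrib, Finset.mul_sum]
  -- Exchanging the two indices turns the term from the contracted covariant slot into the one from
  -- the contracted contravariant slot, so that the two cancel.
  rw [Finset.sum_comm (f := fun k l => coframe e l v.1.proj (D.B e v (frame e k v.1.proj)) *
    comp T.1 e (Fin.insertNth (α := fun _ => Fin n) a k I)
      (Fin.insertNth (α := fun _ => Fin n) c l J) v)]
  have h3 : ∀ (m : ℕ) (f : Fin m → Fin n → Fin n → ℝ),
      ∑ b, ∑ l, ∑ k, f b l k = ∑ k, ∑ b, ∑ l, f b l k := by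
    intro m f
    rw [Finset.sum_comm]
    simp only [Finset.sum_comm (s := Finset.univ (α := Fin m))]
    rw [Finset.sum_comm]
  rw [h3, h3]
  ring

theorem isTensorDerivation_op (hA : IsOpen A) : IsTensorDerivation (D.op hA) :=
  ⟨fun _ _ _ _ T S => op_leibniz hA T S, fun _ _ a c T => op_contraction hA a c T⟩

end DerivationData

end Operators

end

end Aniso

namespace Aniso

noncomputable section

/-! ### Global fields with prescribed values at a point. -/

section Extensions

variable {n : ℕ} {M : Type*} [TopologicalSpace M] [ChartedSpace (EuclideanSpace ℝ (Fin n)) M]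
  [IsManifold (𝓡 n) ∞ M] {A : Set (TangentBundle (𝓡 n) M)} {r s : ℕ}

theorem SmoothVFOn.add {X Y : ∀ p : M, TangentSpace (𝓡 n) p} {U : Set M} (hX : SmoothVFOn X U)
    (hY : SmoothVFOn Y U) : SmoothVFOn (fun p => X p + Y p) U :=
  ContMDiffOn.add_section hX hY

theorem SmoothVFOn.sum {ι : Type*} (S : Finset ι) {X : ι → ∀ p : M, TangentSpace (𝓡 n) p}
    {U : Set M} (hX : ∀ i, SmoothVFOn (X i) U) : SmoothVFOn (fun p => ∑ i ∈ S, X i p) U :=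
  ContMDiffOn.sum_section fun i _ => hX i

theorem SmoothVFOn.smul {f : M → ℝ} {X : ∀ p : M, TangentSpace (𝓡 n) p} {U : Set M}
    (hf : ContMDiffOn (𝓡 n) 𝓘(ℝ, ℝ) ∞ f U) (hX : SmoothVFOn X U) :
    SmoothVFOn (fun p => f p • X p) U :=
  ContMDiffOn.smul_section hf hX

/-- Since a tensor acts pointwise, this allows identities between tensors to be tested on global
isotropic vector fields. -/
theorem exists_vectorField [T2Space M] (p : M) (w : TangentSpace (𝓡 n) p) :
    ∃ X : ∀ q : M, TangentSpace (𝓡 n) q, SmoothVFOn X Set.univ ∧ X p = w := by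
  have hp : p ∈ (prefChart (n := n) p).1.source := mem_chart_source _ p
  refine ⟨fun q => ∑ i, coframe (prefChart p) i p w • frameExt (prefChart p) i p q,
    SmoothVFOn.sum _ fun i => SmoothVFOn.smul contMDiffOn_const (frameExt_spec _ i hp).1, ?_⟩
  conv_rhs => rw [← sum_coframe_frame (prefChart p) hp w]
  exact Finset.sum_congr rfl fun i _ => by rw [(frameExt_spec _ i hp).2.self_of_nhds]

theorem SmoothVFOn.smoothAVF {X : ∀ p : M, TangentSpace (𝓡 n) p} (hX : SmoothVFOn X Set.univ) :
    SmoothAVF (fun v : A => X v.1.proj) := fun e i =>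
  SmoothOver.base ((hX.contMDiffOn_coframe e i).mono (by simp))

/-- The tensor of type `(0, 1)` given by a smooth anisotropic covector field. -/
def covTensor (L : ∀ u : A, Module.Dual ℝ (TangentSpace (𝓡 n) u.1.proj))
    (hL : ∀ e j, SmoothOver e (fun u => L u (frame e j u.1.proj))) : Tensor A 0 1 :=
  ⟨fun v _ x => L v (x 0), fun v => by
    have h := isMultilin_prod (r := 0) (s := 1) 1 ![] ![L v]
    simpa using h, fun e I J => hL e (J 0)⟩

theorem exists_cutoff [T2Space M] (p : M) {U : Set M} (hU : U ∈ 𝓝 p) :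
    ∃ f : M → ℝ, ContMDiff (𝓡 n) 𝓘(ℝ, ℝ) ∞ f ∧ tsupport f ⊆ U ∧ ∀ᶠ q in 𝓝 p, f q = 1 := by
  obtain ⟨f, -, hf⟩ := (SmoothBumpFunction.nhds_basis_tsupport (I := 𝓡 n) p).mem_iff.1 hU
  exact ⟨f, f.contMDiff, hf, f.eventuallyEq_one⟩

theorem contMDiffOn_cutoff_mul {f g : M → ℝ} {U V : Set M} (hf : ContMDiff (𝓡 n) 𝓘(ℝ, ℝ) ∞ f)
    (hU : IsOpen U) (hV : IsOpen V) (hfU : tsupport f ⊆ U)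
    (hg : ContMDiffOn (𝓡 n) 𝓘(ℝ, ℝ) ∞ g (U ∩ V)) :
    ContMDiffOn (𝓡 n) 𝓘(ℝ, ℝ) ∞ (fun q => f q * g q) V := by
  intro q hq
  refine ContMDiffAt.contMDiffWithinAt ?_
  by_cases h : q ∈ U
  · exact ContMDiffAt.mul hf.contMDiffAt (hg.contMDiffAt ((hU.inter hV).mem_nhds ⟨h, hq⟩))
  · refine (contMDiffAt_const (c := (0 : ℝ))).congr_of_eventuallyEq ?_
    filter_upwards [(isClosed_tsupport f).isOpen_compl.mem_nhds fun h' => h (hfU h')] with q' hq'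
    rw [image_eq_zero_of_notMem_tsupport hq', zero_mul]

variable (A) in
theorem exists_covTensor [T2Space M] (p : M) (α : Module.Dual ℝ (TangentSpace (𝓡 n) p)) :
    ∃ θ : Tensor A 0 1, ∀ (v : A) (hv : v.1.proj = p), covec θ v = hv ▸ α := by
  have hp : p ∈ (prefChart (n := n) p).1.source := mem_chart_source _ p
  obtain ⟨f, hf, hfU, hf1⟩ := exists_cutoff (n := n) p
    ((prefChart (n := n) p).1.open_source.mem_nhds hp)
  refine ⟨covTensor (fun u => f u.1.proj • ∑ i, α (frame (prefChart p) i p) •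
    coframe (prefChart p) i u.1.proj) fun e j => ?_, ?_⟩
  · have h1 : ContMDiffOn (𝓡 n) 𝓘(ℝ, ℝ) ∞ (fun q => f q * ∑ i, α (frame (prefChart p) i p) *
        coframe (prefChart p) i q (frame e j q)) e.1.source := by
      refine contMDiffOn_cutoff_mul hf (prefChart p).1.open_source e.1.open_source hfU ?_
      refine contMDiffOn_finsetSum fun i _ => ContMDiffOn.mul contMDiffOn_const ?_
      rw [Set.inter_comm]
      exact contMDiffOn_coframe_frame e (prefChart p) i j
    refine (SmoothOver.base h1).congr fun v _ => ?_
    simp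
  · rintro v rfl
    refine LinearMap.ext fun w => ?_
    change (f v.1.proj • ∑ i, α (frame (prefChart v.1.proj) i v.1.proj) •
      coframe (prefChart v.1.proj) i v.1.proj) w = α w
    rw [sum_dual_coframe _ hp, hf1.self_of_nhds, one_smul]

end Extensions

/-! ### A tensor derivation is determined by its values on functions and vector fields. -/

section Uniqueness

variable {n : ℕ} {M : Type*} [TopologicalSpace M] [ChartedSpace (EuclideanSpace ℝ (Fin n)) M]
  [IsManifold (𝓡 n) ∞ M] {A : Set (TangentBundle (𝓡 n) M)} {r s : ℕ}

theorem IsTensorDerivation.sub {D D' : TensorOp A} (h : IsTensorDerivation D)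
    (h' : IsTensorDerivation D') : IsTensorDerivation (fun r s => D r s - D' r s) := by
  refine ⟨fun r s r' s' T S => ?_, fun r s a c T => ?_⟩
  · simp only [LinearMap.sub_apply, h.leibniz, h'.leibniz]
    refine Subtype.ext (funext fun v => funext fun θ => funext fun x => ?_)
    simp only [tprod, Submodule.coe_sub, Submodule.coe_add, Pi.sub_apply, Pi.add_apply]
    ring
  · simp only [LinearMap.sub_apply, h.contraction, h'.contraction]
    refine Subtype.ext (funext fun v => funext fun θ => funext fun x => ?_)
    simp only [contract, Submodule.coe_sub, Pi.sub_apply, Finset.sum_sub_distrib]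

theorem tprod_zero {r' s' : ℕ} (T : Tensor A r s) : tprod T (0 : Tensor A r' s') = 0 :=
  Subtype.ext (funext fun _ => funext fun _ => funext fun _ => mul_zero _)

/-- The contraction of the first covariant slot of a tensor with a vector field. -/
def insertVec (T : Tensor A r (s + 1)) (X : Tensor A 1 0) : Tensor A r s :=
  contract (r := r) (s := s) (Fin.last r) 0 (tprod (r := r) (s := s + 1) (r' := 1) (s' := 0) T X)

/-- The contraction of the first contravariant slot of a tensor with a covector field. -/
def insertCovec (T : Tensor A (r + 1) s) (α : Tensor A 0 1) : Tensor A r s :=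
  contract (r := r) (s := s) 0 (Fin.last s) (tprod (r := r + 1) (s := s) (r' := 0) (s' := 1) T α)

/-- `E(T ⊗ X) = E T ⊗ X + T ⊗ E X`, the last term is zero, and `E` passes through the contraction.
-/
theorem IsTensorDerivation.map_insertVec {E : TensorOp A} (hE : IsTensorDerivation E)
    (T : Tensor A r (s + 1)) {X : Tensor A 1 0} (hX : E 1 0 X = 0) :
    E r s (insertVec T X) = insertVec (E r (s + 1) T) X := by
  have h : E (r + 1) (s + 1) (tprod (r := r) (s := s + 1) (r' := 1) (s' := 0) T X) =
      tprod (r := r) (s := s + 1) (r' := 1) (s' := 0) (E r (s + 1) T) X := by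
    refine (hE.leibniz r (s + 1) 1 0 T X).trans ?_
    rw [hX, tprod_zero]
    exact add_zero (tprod (r := r) (s := s + 1) (r' := 1) (s' := 0) (E r (s + 1) T) X)
  exact (hE.contraction r s (Fin.last r) 0 _).trans (congrArg _ h)

theorem IsTensorDerivation.map_insertCovec {E : TensorOp A} (hE : IsTensorDerivation E)
    (T : Tensor A (r + 1) s) {α : Tensor A 0 1} (hα : E 0 1 α = 0) :
    E r s (insertCovec T α) = insertCovec (E (r + 1) s T) α := by
  have h : E (r + 1) (s + 1) (tprod (r := r + 1) (s := s) (r' := 0) (s' := 1) T α) =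
      tprod (r := r + 1) (s := s) (r' := 0) (s' := 1) (E (r + 1) s T) α := by
    refine (hE.leibniz (r + 1) s 0 1 T α).trans ?_
    rw [hα, tprod_zero]
    exact add_zero (tprod (r := r + 1) (s := s) (r' := 0) (s' := 1) (E (r + 1) s T) α)
  exact (hE.contraction r s 0 (Fin.last s) _).trans (congrArg _ h)

theorem insertVec_apply (T : Tensor A r (s + 1))
    {X : ∀ v : A, TangentSpace (𝓡 n) v.1.proj} (hX : SmoothAVF X) (v : A)
    (θ : Fin r → Module.Dual ℝ (TangentSpace (𝓡 n) v.1.proj))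
    (x : Fin s → TangentSpace (𝓡 n) v.1.proj) :
    (insertVec T (vecTensor X hX)).1 v θ x =
      T.1 v θ (Fin.cons (α := fun _ => TangentSpace (𝓡 n) v.1.proj) (X v) x) := by
  obtain ⟨m, hm⟩ := (T.2.1 v).2 θ
  obtain ⟨L, hL⟩ := exists_insertNth_lin m 0 x
  have h1 : ∀ k, T.1 v (fun a => Fin.insertNth
        (α := fun _ => Module.Dual ℝ (TangentSpace (𝓡 n) v.1.proj)) (Fin.last r)
        ((tbasis v.1.proj).coord k) θ (Fin.castAdd 1 a))
      (fun b => Fin.insertNth (α := fun _ => TangentSpace (𝓡 n) v.1.proj) 0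
        (tbasis v.1.proj k) x (Fin.castAdd 0 b)) = L (tbasis v.1.proj k) := by
    intro k
    rw [← hL, ← hm]
    refine congrArg₂ (T.1 v) (funext fun a => ?_) rfl
    -- The contracted covector was inserted in the last of `r + 1` slots, which belongs to `X`; the
    -- first `r` slots therefore still carry `θ`.
    rw [show Fin.castAdd 1 a = (Fin.last r).succAbove a by simp; rfl,
      Fin.insertNth_apply_succAbove]
  have h2 : ∀ k, (vecTensor X hX).1 v (fun a => Fin.insertNth
        (α := fun _ => Module.Dual ℝ (TangentSpace (𝓡 n) v.1.proj)) (Fin.last r)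
        ((tbasis v.1.proj).coord k) θ (Fin.natAdd r a))
      (fun b => Fin.insertNth (α := fun _ => TangentSpace (𝓡 n) v.1.proj) 0
        (tbasis v.1.proj k) x (Fin.natAdd (s + 1) b)) = (tbasis v.1.proj).coord k (X v) := by
    intro k
    change Fin.insertNth (α := fun _ => Module.Dual ℝ (TangentSpace (𝓡 n) v.1.proj)) (Fin.last r)
        ((tbasis v.1.proj).coord k) θ (Fin.last r) (X v) = _
    rw [Fin.insertNth_apply_same]
  have h0 : ∀ k, _ = _ := fun k => congrArg₂ (· * ·) (h1 k) (h2 k)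
  have h3 := Finset.sum_congr (rfl : (Finset.univ : Finset (Fin n)) = _) fun k _ => h0 k
  refine Eq.trans h3 ?_
  rw [← Fin.insertNth_zero', hm, hL]
  conv_rhs => rw [← (tbasis v.1.proj).sum_repr (X v)]
  rw [map_sum]
  exact Finset.sum_congr rfl fun k _ => by rw [map_smul, smul_eq_mul, mul_comm]; rfl

theorem insertCovec_apply (T : Tensor A (r + 1) s) (α : Tensor A 0 1) (v : A)
    (θ : Fin r → Module.Dual ℝ (TangentSpace (𝓡 n) v.1.proj))
    (x : Fin s → TangentSpace (𝓡 n) v.1.proj) :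
    (insertCovec T α).1 v θ x =
      T.1 v (Fin.cons (α := fun _ => Module.Dual ℝ (TangentSpace (𝓡 n) v.1.proj))
        (covec α v) θ) x := by
  obtain ⟨m, hm⟩ := (T.2.1 v).1 x
  obtain ⟨L, hL⟩ := exists_insertNth_lin m 0 θ
  have h1 : ∀ k, T.1 v (fun a => Fin.insertNth
        (α := fun _ => Module.Dual ℝ (TangentSpace (𝓡 n) v.1.proj)) 0
        ((tbasis v.1.proj).coord k) θ (Fin.castAdd 0 a))
      (fun b => Fin.insertNth (α := fun _ => TangentSpace (𝓡 n) v.1.proj) (Fin.last s)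
        (tbasis v.1.proj k) x (Fin.castAdd 1 b)) = L ((tbasis v.1.proj).coord k) := by
    intro k
    rw [← hL, ← hm]
    refine congrArg₂ (T.1 v) rfl (funext fun b => ?_)
    rw [show Fin.castAdd 1 b = (Fin.last s).succAbove b by simp; rfl,
      Fin.insertNth_apply_succAbove]
  have h2 : ∀ k, α.1 v (fun a => Fin.insertNth
        (α := fun _ => Module.Dual ℝ (TangentSpace (𝓡 n) v.1.proj)) 0
        ((tbasis v.1.proj).coord k) θ (Fin.natAdd (r + 1) a))
      (fun b => Fin.insertNth (α := fun _ => TangentSpace (𝓡 n) v.1.proj) (Fin.last s)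
        (tbasis v.1.proj k) x (Fin.natAdd s b)) = covec α v (tbasis v.1.proj k) := by
    intro k
    change _ = α.1 v ![] ![tbasis v.1.proj k]
    refine congrArg₂ (α.1 v) (Subsingleton.elim _ _) (funext fun b => ?_)
    have hb : b = 0 := Subsingleton.elim _ _
    subst hb
    exact Fin.insertNth_apply_same _ _ _
  have h0 : ∀ k, _ = _ := fun k => congrArg₂ (· * ·) (h1 k) (h2 k)
  have h3 := Finset.sum_congr (rfl : (Finset.univ : Finset (Fin n)) = _) fun k _ => h0 k
  refine Eq.trans h3 ?_
  rw [← Fin.insertNth_zero', hm, hL]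
  have h4 : covec α v = ∑ k, covec α v (tbasis v.1.proj k) • (tbasis v.1.proj).coord k := by
    refine (tbasis v.1.proj).ext fun j => ?_
    classical
    simp
  conv_rhs => rw [h4]
  rw [map_sum]
  exact Finset.sum_congr rfl fun k _ => by rw [map_smul, smul_eq_mul, mul_comm]

/-- Induction on the type. Filling a slot of `T` with a field annihilated by `E` lowers the degree,
and `E T` is recovered pointwise because every vector and covector extends to a global field.
Covariant slots come before contravariant ones: the case `(0, 1)` is needed to know that `E`
annihilates the covector fields inserted afterwards. -/
theorem IsTensorDerivation.eq_zero [T2Space M] {E : TensorOp A} (hE : IsTensorDerivation E)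
    (h0 : ∀ f, E 0 0 f = 0)
    (h1 : ∀ (X : ∀ p : M, TangentSpace (𝓡 n) p) (hX : SmoothVFOn X Set.univ),
      E 1 0 (vecTensor (fun v : A => X v.1.proj) hX.smoothAVF) = 0) :
    ∀ (r s : ℕ) (T : Tensor A r s), E r s T = 0 := by
  have hs : ∀ r s, (∀ T : Tensor A r s, E r s T = 0) →
      ∀ T : Tensor A r (s + 1), E r (s + 1) T = 0 := by
    intro r s h T
    refine Subtype.ext (funext fun v => funext fun θ => funext fun x => ?_)
    obtain ⟨X, hX, hXv⟩ := exists_vectorField v.1.proj (x 0)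
    have h2 := h (insertVec T (vecTensor (fun v : A => X v.1.proj) hX.smoothAVF))
    rw [hE.map_insertVec T (h1 X hX)] at h2
    have h6 := insertVec_apply (E r (s + 1) T) (hX.smoothAVF (A := A)) v θ (fun b => x b.succ)
    rw [h2, hXv] at h6
    have h7 : Fin.cons (α := fun _ => TangentSpace (𝓡 n) v.1.proj) (x 0) (fun b => x b.succ) = x :=
      Fin.cons_self_tail x
    rw [h7] at h6
    exact h6.symm
  have hr : ∀ r s, (∀ T : Tensor A 0 1, E 0 1 T = 0) → (∀ T : Tensor A r s, E r s T = 0) →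
      ∀ T : Tensor A (r + 1) s, E (r + 1) s T = 0 := by
    intro r s h01 h T
    refine Subtype.ext (funext fun v => funext fun θ => funext fun x => ?_)
    obtain ⟨α, hα⟩ := exists_covTensor A v.1.proj (θ 0)
    have h2 := h (insertCovec T α)
    rw [hE.map_insertCovec T (h01 α)] at h2
    have h6 := insertCovec_apply (E (r + 1) s T) α v (fun a => θ a.succ) x
    rw [h2, hα v rfl] at h6
    have h7 : Fin.cons (α := fun _ => Module.Dual ℝ (TangentSpace (𝓡 n) v.1.proj)) (θ 0)
        (fun a => θ a.succ) = θ := Fin.cons_self_tail θ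
    rw [h7] at h6
    exact h6.symm
  have h0s : ∀ s (T : Tensor A 0 s), E 0 s T = 0 := by
    intro s
    induction s with
    | zero => exact h0
    | succ s ih => exact hs 0 s ih
  intro r s
  induction r with
  | zero => exact h0s s
  | succ r ih => exact hr r s (h0s 1) ih

/-- `X ⊗ f` is the vector field `fX`, so `0 = E(X ⊗ f) = X ⊗ E f`. Pairing with a covector that is
`1` on `X` at the given point isolates `E f`; such an `X` exists because the dimension is positive.
-/
theorem IsTensorDerivation.eq_zero_on_functions [T2Space M] (hn : 0 < n) {E : TensorOp A}
    (hE : IsTensorDerivation E)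
    (h1 : ∀ (X : ∀ v : A, TangentSpace (𝓡 n) v.1.proj) (hX : SmoothAVF X),
      E 1 0 (vecTensor X hX) = 0) (f : Tensor A 0 0) : E 0 0 f = 0 := by
  refine Subtype.ext (funext fun v => funext fun θ => funext fun x => ?_)
  have hv : v.1.proj ∈ (prefChart (n := n) v.1.proj).1.source := mem_chart_source _ v.1.proj
  obtain ⟨X, hX, hXv⟩ := exists_vectorField v.1.proj (frame (prefChart v.1.proj) ⟨0, hn⟩ v.1.proj)
  have hfX : SmoothAVF (fun u : A => f.1 u ![] ![] • X u.1.proj) := by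
    intro e i
    refine SmoothOver.congr ((f.2.2 e ![] ![]).mul (hX.smoothAVF (A := A) e i)) fun u _ => ?_
    rw [map_smul, smul_eq_mul]
    congr 1
    exact congrArg₂ (f.1 u) (Subsingleton.elim _ _) (Subsingleton.elim _ _)
  have h2 : tprod (vecTensor (fun v : A => X v.1.proj) hX.smoothAVF) f = vecTensor _ hfX := by
    refine Subtype.ext (funext fun u => funext fun α => funext fun y => ?_)
    change α 0 (X u.1.proj) * f.1 u _ _ = α 0 (f.1 u ![] ![] • X u.1.proj)
    rw [map_smul, smul_eq_mul, mul_comm]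
    congr 1
    exact congrArg₂ (f.1 u) (Subsingleton.elim _ _) (Subsingleton.elim _ _)
  have h3 := hE.leibniz 1 0 0 0 (vecTensor (fun v : A => X v.1.proj) hX.smoothAVF) f
  rw [h1 _ hX.smoothAVF] at h3
  have h4 : E (1 + 0) (0 + 0) (tprod (vecTensor (fun v : A => X v.1.proj) hX.smoothAVF) f) = 0 :=
    (congrArg (E 1 0) h2).trans (h1 _ hfX)
  rw [h4] at h3
  have h5 := congrArg (fun T : Tensor A (1 + 0) (0 + 0) =>
    T.1 v (fun _ => coframe (prefChart v.1.proj) ⟨0, hn⟩ v.1.proj) ![]) h3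
  have h6 : (0 : ℝ) = 0 * f.1 v _ _ +
      coframe (prefChart v.1.proj) ⟨0, hn⟩ v.1.proj (X v.1.proj) * (E 0 0 f).1 v _ _ := h5
  rw [hXv, coframe_frame _ hv, if_pos rfl, zero_mul, zero_add, one_mul] at h6
  refine Eq.trans ?_ h6.symm
  exact congrArg₂ ((E 0 0 f).1 v) (Subsingleton.elim _ _) (Subsingleton.elim _ _)

end Uniqueness

end

end Aniso

namespace Aniso

noncomputable section

/-! ### Directional derivatives on the base and coordinates of vectors tangent to `TM`. -/

section BaseDerivatives

variable {n : ℕ} {M : Type*} [TopologicalSpace M] [ChartedSpace (EuclideanSpace ℝ (Fin n)) M]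
  [IsManifold (𝓡 n) ∞ M] {A : Set (TangentBundle (𝓡 n) M)}

theorem dirDeriv_sum_smul (f : M → ℝ) (p : M) {ι : Type*} (S : Finset ι) (c : ι → ℝ)
    (w : ι → TangentSpace (𝓡 n) p) :
    dirDeriv f p (∑ k ∈ S, c k • w k) = ∑ k ∈ S, c k * dirDeriv f p (w k) := by
  simp only [dirDeriv, map_sum, map_smul]
  rfl

theorem dirDeriv_eq_sum (f : M → ℝ) (e : Chart n M) {p : M} (hp : p ∈ e.1.source)
    (w : TangentSpace (𝓡 n) p) :
    dirDeriv f p w = ∑ k, coframe e k p w * dirDeriv f p (frame e k p) := by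
  conv_lhs => rw [← sum_coframe_frame e hp w]
  exact dirDeriv_sum_smul f p _ _ _

theorem dirDeriv_zero (f : M → ℝ) (p : M) : dirDeriv f p (0 : TangentSpace (𝓡 n) p) = 0 :=
  map_zero _

theorem dirDeriv_frame {f : M → ℝ} {p : M} (hf : MDifferentiableAt (𝓡 n) 𝓘(ℝ, ℝ) f p)
    (e : Chart n M) (hp : p ∈ e.1.source) (k : Fin n) :
    dirDeriv f p (frame e k p) =
      fderiv ℝ (fun x => f (e.1.symm x)) (e.1 p) (EuclideanSpace.single k 1) := by
  have h1 := (mdifferentiable_chart e).mdifferentiableAt_symm (e.1.map_source hp)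
  have h2 : MDifferentiableAt (𝓡 n) 𝓘(ℝ, ℝ) f (e.1.symm (e.1 p)) := by
    rwa [e.1.left_inv hp]
  have h3 := mfderiv_comp (e.1 p) h2 h1
  -- The chain rule yields the differential at `e.1.symm (e.1 p)`, which equals `p` only
  -- propositionally; the common model of the tangent spaces allows the transport.
  have h4 : ∀ q : M, q = p → (mfderiv (𝓡 n) 𝓘(ℝ, ℝ) f q : EuclideanSpace ℝ (Fin n) →L[ℝ] ℝ) =
      mfderiv (𝓡 n) 𝓘(ℝ, ℝ) f p := by
    rintro _ rfl
    rfl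
  have h5 := congrArg (fun L : EuclideanSpace ℝ (Fin n) →L[ℝ] ℝ =>
    L (EuclideanSpace.single k 1)) h3
  have h6 := congrArg (fun L : EuclideanSpace ℝ (Fin n) →L[ℝ] ℝ => L (frame e k p))
    (h4 _ (e.1.left_inv hp))
  refine h6.symm.trans (h5.symm.trans ?_)
  simp only [mfderiv_eq_fderiv]
  rfl

theorem dirDeriv_congr {f g : M → ℝ} {p : M} (h : f =ᶠ[𝓝 p] g) (w : TangentSpace (𝓡 n) p) :
    dirDeriv f p w = dirDeriv g p w := by
  simp only [dirDeriv, h.mfderiv_eq]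
  rfl

theorem coframe_frame_eq_fderiv (e e' : Chart n M) {x : EuclideanSpace ℝ (Fin n)}
    (hx : x ∈ e.1.target) (hx' : e.1.symm x ∈ e'.1.source) (i j : Fin n) :
    coframe e' i (e.1.symm x) (frame e j (e.1.symm x)) =
      fderiv ℝ (fun z => e'.1 (e.1.symm z) i) x (EuclideanSpace.single j 1) := by
  have h1 := (mdifferentiable_chart e).mdifferentiableAt_symm hx
  have h2 := (mdifferentiable_chart e').mdifferentiableAt hx'
  have h3 : MDifferentiableAt 𝓘(ℝ, EuclideanSpace ℝ (Fin n)) 𝓘(ℝ, EuclideanSpace ℝ (Fin n))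
      (e'.1 ∘ e.1.symm) x := h2.comp x h1
  have h4 := mfderiv_comp x h2 h1
  have h5 := ((EuclideanSpace.proj i : EuclideanSpace ℝ (Fin n) →L[ℝ] ℝ).hasFDerivAt.comp x
    h3.differentiableAt.hasFDerivAt).fderiv
  have h6 : (fun z => e'.1 (e.1.symm z) i) =
      (EuclideanSpace.proj i : EuclideanSpace ℝ (Fin n) →L[ℝ] ℝ) ∘ (e'.1 ∘ e.1.symm) := rfl
  rw [h6, h5, ← mfderiv_eq_fderiv]
  have h7 := congrArg (fun L : EuclideanSpace ℝ (Fin n) →L[ℝ] EuclideanSpace ℝ (Fin n) =>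
    L (EuclideanSpace.single j 1) i) h4
  refine Eq.trans ?_ h7.symm
  have h8 : e.1 (e.1.symm x) = x := e.1.right_inv hx
  have h9 : ∀ y, y = x → ((mfderiv (𝓡 n) (𝓡 n) e.1.symm y :
      EuclideanSpace ℝ (Fin n) →L[ℝ] EuclideanSpace ℝ (Fin n)) (EuclideanSpace.single j 1)) =
      ((mfderiv (𝓡 n) (𝓡 n) e.1.symm x :
      EuclideanSpace ℝ (Fin n) →L[ℝ] EuclideanSpace ℝ (Fin n)) (EuclideanSpace.single j 1)) := by
    rintro _ rfl
    rfl
  exact congrArg (coframe e' i (e.1.symm x)) (h9 _ h8)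

/-- `dx'ⁱ(∂ⱼ)` is the partial derivative `∂x'ⁱ/∂xʲ`, so this is the symmetry of the second
derivative of the transition map. It is the analytic reason for which the bracket `𝔩^H_Z` is
independent of the chart. -/
theorem dirDeriv_coframe_frame_symm (e e' : Chart n M) {p : M} (hp : p ∈ e.1.source)
    (hp' : p ∈ e'.1.source) (i j k : Fin n) :
    dirDeriv (fun q => coframe e' i q (frame e j q)) p (frame e k p) =
      dirDeriv (fun q => coframe e' i q (frame e k q)) p (frame e j p) := by
  set g : EuclideanSpace ℝ (Fin n) → ℝ := fun z => e'.1 (e.1.symm z) i with hg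
  have h1 : ContMDiffAt (𝓡 n) (𝓡 n) ∞ e.1.symm (e.1 p) :=
    (contMDiffOn_symm_of_mem_maximalAtlas e.2).contMDiffAt
      (e.1.open_target.mem_nhds (e.1.map_source hp))
  have h2 : ContMDiffAt (𝓡 n) (𝓡 n) ∞ e'.1 (e.1.symm (e.1 p)) := by
    rw [e.1.left_inv hp]
    exact (contMDiffOn_of_mem_maximalAtlas e'.2).contMDiffAt (e'.1.open_source.mem_nhds hp')
  have h3 : ContDiffAt ℝ ∞ g (e.1 p) :=
    (EuclideanSpace.proj i : EuclideanSpace ℝ (Fin n) →L[ℝ] ℝ).contDiff.contDiffAt.comp (e.1 p)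
      (h2.comp (e.1 p) h1).contDiffAt
  have h4 : IsSymmSndFDerivAt ℝ g (e.1 p) := h3.isSymmSndFDerivAt (by
    simp only [minSmoothness_of_isRCLikeNormedField]
    exact WithTop.coe_le_coe.2 le_top)
  have h5 : ∀ᶠ x in 𝓝 (e.1 p), x ∈ e.1.target ∧ e.1.symm x ∈ e'.1.source := by
    refine Filter.Eventually.and (e.1.open_target.mem_nhds (e.1.map_source hp)) ?_
    exact (e.1.tendsto_symm hp).eventually (e'.1.open_source.mem_nhds hp')
  have h6 : DifferentiableAt ℝ (fderiv ℝ g) (e.1 p) :=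
    (h3.fderiv_right (m := 1) (by norm_num; exact WithTop.coe_le_coe.2 le_top)).differentiableAt
      (by simp)
  have h7 : ∀ j k, dirDeriv (fun q => coframe e' i q (frame e j q)) p (frame e k p) =
      fderiv ℝ (fderiv ℝ g) (e.1 p) (EuclideanSpace.single k 1) (EuclideanSpace.single j 1) := by
    intro j k
    rw [dirDeriv_frame (mdifferentiableAt_coframe_frame e e' hp hp' i j) e hp k]
    have h8 : (fun x => coframe e' i (e.1.symm x) (frame e j (e.1.symm x))) =ᶠ[𝓝 (e.1 p)]
        fun x => fderiv ℝ g x (EuclideanSpace.single j 1) := by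
      filter_upwards [h5] with x hx
      exact coframe_frame_eq_fderiv e e' hx.1 hx.2 i j
    rw [h8.fderiv_eq, fderiv_clm_apply h6 (differentiableAt_const _)]
    simp
  rw [h7, h7]
  exact h4 _ _

/-- `tcoord e ∘ tpoint e` is the identity near the point, so the chain rule provides a right inverse
of the differential. -/
theorem surjective_dcoord (e : Chart n M) {v : TangentBundle (𝓡 n) M}
    (hv : v.proj ∈ e.1.source) : Function.Surjective (dcoord e v) := by
  have h1 : Function.Surjective (dcoord e (tpoint e (tcoord e v))) := by
    intro w
    have hz := tcoord_mem e hv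
    have h2 : MDifferentiableAt (𝓡 n).tangent
        𝓘(ℝ, EuclideanSpace ℝ (Fin n) × EuclideanSpace ℝ (Fin n)) (tcoord e)
        (tpoint e (tcoord e v)) :=
      mdifferentiableAt_tcoord e (e.1.map_target hz)
    have h3 := mfderiv_comp (tcoord e v) h2 (mdifferentiableAt_tpoint e hz)
    have h4 : tcoord e ∘ tpoint e =ᶠ[𝓝 (tcoord e v)] id := by
      filter_upwards [(e.1.open_target.preimage continuous_fst).mem_nhds hz] with z hz
      exact tcoord_tpoint e hz
    rw [h4.mfderiv_eq, mfderiv_id] at h3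
    exact ⟨_, (congrArg (fun L : EuclideanSpace ℝ (Fin n) × EuclideanSpace ℝ (Fin n) →L[ℝ]
      EuclideanSpace ℝ (Fin n) × EuclideanSpace ℝ (Fin n) => L w) h3).symm⟩
  rwa [tpoint_tcoord e hv] at h1

theorem surjective_dproj (v : TangentBundle (𝓡 n) M) : Function.Surjective (dproj v) := by
  intro w
  have hv : v.proj ∈ (prefChart (n := n) v.proj).1.source := mem_chart_source _ v.proj
  obtain ⟨u, hu⟩ := surjective_dcoord (prefChart v.proj) hv
    -- By `dcoord_fst` only the first half of the coordinates is seen by `dproj`; the second half is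
    -- arbitrary and set to zero.
    (tcoord (prefChart v.proj) ⟨v.proj, w⟩ |>.2, 0)
  refine ⟨u, ext_coframe (prefChart v.proj) hv fun i => ?_⟩
  rw [← dcoord_fst _ hv, hu]
  rfl

theorem dAt_fiberCoord (hA : IsOpen A) (e : Chart n M) {v : A} (hv : v.1.proj ∈ e.1.source)
    (i : Fin n) : DAt (fun u : A => coframe e i u.1.proj u.1.2) v := by
  have h1 := ((EuclideanSpace.proj i : EuclideanSpace ℝ (Fin n) →L[ℝ] ℝ).comp
    (ContinuousLinearMap.snd ℝ (EuclideanSpace ℝ (Fin n))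
      (EuclideanSpace ℝ (Fin n)))).mdifferentiableAt.comp v.1 (mdifferentiableAt_tcoord e hv)
  exact h1.congr_of_eventuallyEq
    (ext0_eventuallyEq_of hA (Filter.Eventually.of_forall fun _ => rfl))

theorem smoothAVF_liouville : SmoothAVF (liouville : ∀ v : A, TangentSpace (𝓡 n) v.1.proj) := by
  intro e i
  have h1 : ContDiff ℝ ∞
      (fun z : EuclideanSpace ℝ (Fin n) × EuclideanSpace ℝ (Fin n) => z.2 i) := by fun_prop
  exact SmoothOver.congr' (h1.contMDiff.comp_contMDiffOn
    ((contMDiffOn_tcoord e).mono fun v hv => hv.2)) fun _ _ => rfl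

theorem der_fiberCoord (hA : IsOpen A) (e : Chart n M) {v : A} (hv : v.1.proj ∈ e.1.source)
    (i : Fin n) (W : TangentSpace (𝓡 n).tangent v.1) :
    der (fun u : A => coframe e i u.1.proj u.1.2) v W = (dcoord e v.1 W).2 i := by
  set L := (EuclideanSpace.proj i : EuclideanSpace ℝ (Fin n) →L[ℝ] ℝ).comp
    (ContinuousLinearMap.snd ℝ (EuclideanSpace ℝ (Fin n)) (EuclideanSpace ℝ (Fin n)))
  have h1 := mfderiv_comp v.1 L.mdifferentiableAt (mdifferentiableAt_tcoord e hv)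
  have h2 := (ext0_eventuallyEq_of hA (f := fun u : A => coframe e i u.1.proj u.1.2) (v := v)
    (F := L ∘ tcoord e) (Filter.Eventually.of_forall fun _ => rfl)).mfderiv_eq
    (I := (𝓡 n).tangent) (I' := 𝓘(ℝ, ℝ))
  rw [der, h2, h1, L.mfderiv_eq]
  rfl

end BaseDerivatives

/-! ### Vertical lifts and the vertical derivation. -/

section Vertical

variable {n : ℕ} {M : Type*} [TopologicalSpace M] [ChartedSpace (EuclideanSpace ℝ (Fin n)) M]
  [IsManifold (𝓡 n) ∞ M] {A : Set (TangentBundle (𝓡 n) M)} {r s : ℕ}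

/-- The vertical lift of a tangent vector. -/
def vlift (v : TangentBundle (𝓡 n) M) (y : TangentSpace (𝓡 n) v.proj) :
    TangentSpace (𝓡 n).tangent v :=
  (surjective_dcoord (prefChart v.proj) (mem_chart_source _ v.proj)
    (0, (tcoord (prefChart v.proj) ⟨v.proj, y⟩).2)).choose

theorem dcoord_prefChart_vlift (v : TangentBundle (𝓡 n) M) (y : TangentSpace (𝓡 n) v.proj) :
    dcoord (prefChart v.proj) v (vlift v y) = (0, (tcoord (prefChart v.proj) ⟨v.proj, y⟩).2) :=
  (surjective_dcoord (prefChart v.proj) (mem_chart_source _ v.proj) _).choose_spec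

theorem dproj_vlift (v : TangentBundle (𝓡 n) M) (y : TangentSpace (𝓡 n) v.proj) :
    dproj v (vlift v y) = 0 := by
  have hv : v.proj ∈ (prefChart (n := n) v.proj).1.source := mem_chart_source _ v.proj
  refine ext_coframe (prefChart v.proj) hv fun i => ?_
  rw [← dcoord_fst _ hv, dcoord_prefChart_vlift, map_zero]
  rfl

theorem tpoint_line (e : Chart n M) {v : TangentBundle (𝓡 n) M} (hv : v.proj ∈ e.1.source)
    (y : TangentSpace (𝓡 n) v.proj) (t : ℝ) :
    tpoint e (tcoord e v + t • ((0, (tcoord e ⟨v.proj, y⟩).2) :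
      EuclideanSpace ℝ (Fin n) × EuclideanSpace ℝ (Fin n))) = ⟨v.proj, v.2 + t • y⟩ := by
  have h1 : tcoord e v + t • ((0, (tcoord e ⟨v.proj, y⟩).2) :
      EuclideanSpace ℝ (Fin n) × EuclideanSpace ℝ (Fin n)) =
      tcoord e ⟨v.proj, v.2 + t • y⟩ := by
    refine Prod.ext ?_ ?_
    · simp [tcoord]
    · simp only [tcoord, Prod.snd_add, Prod.smul_snd]
      exact ((mfderiv (𝓡 n) (𝓡 n) e.1 v.proj :
        TangentSpace (𝓡 n) v.proj →L[ℝ] EuclideanSpace ℝ (Fin n)).map_add v.2 (t • y)).trans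
        (congrArg _ (map_smul _ t y)) |>.symm
  rw [h1]
  exact tpoint_tcoord e (v := ⟨v.proj, v.2 + t • y⟩) hv

/-- In induced coordinates the curve `v + t y` is an affine line with direction `(0, y)`, the
coordinates by which `vlift` is chosen. -/
theorem hasDerivAt_line {f : A → ℝ} {v : A} (hf : DAt f v) (y : TangentSpace (𝓡 n) v.1.proj) :
    HasDerivAt (fun t : ℝ => ext0 f ⟨v.1.proj, v.1.2 + t • y⟩) (der f v (vlift v.1 y)) 0 := by
  have hv : v.1.proj ∈ (prefChart (n := n) v.1.proj).1.source := mem_chart_source _ v.1.proj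
  rw [der_eq_fderiv hf hv, dcoord_prefChart_vlift]
  set e := prefChart (n := n) v.1.proj
  set w : EuclideanSpace ℝ (Fin n) × EuclideanSpace ℝ (Fin n) := (0, (tcoord e ⟨v.1.proj, y⟩).2)
  have h1 : HasDerivAt (fun t : ℝ => tcoord e v.1 + t • w) w 0 := by
    simpa using ((hasDerivAt_id (0 : ℝ)).smul_const w).const_add (tcoord e v.1)
  have h2 : HasFDerivAt (inChart e f) (fderiv ℝ (inChart e f) (tcoord e v.1))
      (tcoord e v.1 + (0 : ℝ) • w) := by
    rw [zero_smul, add_zero]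
    exact (hf.differentiableAt_inChart hv).hasFDerivAt
  refine (h2.comp_hasDerivAt (0 : ℝ) h1).congr_of_eventuallyEq
    (Filter.Eventually.of_forall fun t => ?_)
  simp only [Function.comp, inChart]
  rw [tpoint_line e hv]

/-- `vlift` is chosen by means of the preferred chart. Its description in any other chart follows by
differentiating the fibre coordinate of that chart along `v + t y`, on which it is affine in `t` as
long as the line stays in `A`. -/
theorem dcoord_vlift (hA : IsOpen A) {v : A} {e : Chart n M} (hv : v.1.proj ∈ e.1.source)
    (y : TangentSpace (𝓡 n) v.1.proj) (i : Fin n) :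
    (dcoord e v.1 (vlift v.1 y)).2 i = coframe e i v.1.proj y := by
  rw [← der_fiberCoord hA e hv i]
  refine (hasDerivAt_line (dAt_fiberCoord hA e hv i) y).unique ?_
  have h3 : HasDerivAt (fun t : ℝ => coframe e i v.1.proj v.1.2 + t * coframe e i v.1.proj y)
      (coframe e i v.1.proj y) 0 := by
    simpa using ((hasDerivAt_id (0 : ℝ)).mul_const (coframe e i v.1.proj y)).const_add
      (coframe e i v.1.proj v.1.2)
  refine h3.congr_of_eventuallyEq ?_
  have h4 : ContinuousAt (fun t : ℝ => tpoint e (tcoord e v.1 +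
      t • ((0, (tcoord e ⟨v.1.proj, y⟩).2) :
        EuclideanSpace ℝ (Fin n) × EuclideanSpace ℝ (Fin n)))) 0 := by
    refine ContinuousAt.comp (g := tpoint e) ?_ (by fun_prop)
    simp only [zero_smul, add_zero]
    exact (mdifferentiableAt_tpoint e (tcoord_mem e hv)).continuousAt
  have h5 := h4.eventually_mem (s := A) (by
    simp only [zero_smul, add_zero]
    rw [tpoint_tcoord e hv]
    exact hA.mem_nhds v.2)
  filter_upwards [h5] with t ht
  rw [tpoint_line e hv] at ht
  rw [ext0_apply _ ht]
  simp

theorem der_vlift (hA : IsOpen A) {f : A → ℝ} {v : A} (hf : DAt f v) {e : Chart n M}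
    (hv : v.1.proj ∈ e.1.source) (y : TangentSpace (𝓡 n) v.1.proj) :
    der f v (vlift v.1 y) = ∑ i, coframe e i v.1.proj y * pdy e i f v := by
  have h1 : ∀ i, (dcoord e v.1 (vlift v.1 y)).1 i = 0 := fun i => by
    rw [dcoord_fst e hv, dproj_vlift, map_zero]
  rw [der_eq_sum hf hv]
  simp only [h1, dcoord_vlift hA hv, zero_mul, Finset.sum_const_zero, zero_add]

theorem vertDeriv_eq {T : PreTensor A r s} (hT : ∀ v, IsMultilin (T v)) {e : Chart n M} {v : A}
    (hv : v.1.proj ∈ e.1.source) (hc : ∀ I J, DAt (comp T e I J) v)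
    (y : TangentSpace (𝓡 n) v.1.proj)
    (θ : Fin r → Module.Dual ℝ (TangentSpace (𝓡 n) v.1.proj))
    (x : Fin s → TangentSpace (𝓡 n) v.1.proj) :
    vertDeriv T v y θ x = derTensor e T v (vlift v.1 y) θ x := by
  refine HasDerivAt.deriv ?_
  have h1 : HasDerivAt (fun t : ℝ => ∑ I : Fin r → Fin n, ∑ J : Fin s → Fin n,
      ext0 (comp T e I J) ⟨v.1.proj, v.1.2 + t • y⟩ * (∏ a, θ a (frame e (I a) v.1.proj)) *
        ∏ b, coframe e (J b) v.1.proj (x b)) (derTensor e T v (vlift v.1 y) θ x) 0 :=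
    HasDerivAt.fun_sum fun I _ => HasDerivAt.fun_sum fun J _ =>
      ((hasDerivAt_line (hc I J) y).mul_const _).mul_const _
  -- The two functions agree for every `t`: outside `A` the default value `0` of `vertDeriv` matches
  -- the extension of the components by zero.
  refine h1.congr_of_eventuallyEq (Filter.Eventually.of_forall fun t => ?_)
  dsimp only
  split_ifs with h
  · simp only [ext0_apply _ h]
    exact comp_eq_sum hT e (u := ⟨_, h⟩) hv θ x
  · simp only [ext0_of_notMem _ h, zero_mul, Finset.sum_const_zero]

/-- The data of the vertical derivation `∂̇_Y`. -/
def vertData (hA : IsOpen A) {Y : ∀ v : A, TangentSpace (𝓡 n) v.1.proj} (hY : SmoothAVF Y) :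
    DerivationData A where
  W v := vlift v.1 (Y v)
  B _ _ := 0
  smooth_fst e i := (SmoothOver.zero e).congr fun v hv => by
    rw [dcoord_fst e hv, dproj_vlift, map_zero]
  smooth_snd e i := (hY e i).congr fun v hv => dcoord_vlift hA hv _ i
  smooth_B e i j := (SmoothOver.zero e).congr fun v hv => by
    rw [LinearMap.zero_apply, map_zero]
  -- With `B = 0`, compatibility says that the entries of the Jacobian, being functions on the base,
  -- are constant along the fibres.
  compat e e' v hv hv' j := by
    rw [LinearMap.zero_apply, sub_self]
    refine Finset.sum_eq_zero fun i _ => ?_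
    rw [der_base hA (mdifferentiableAt_coframe_frame e e' hv hv' i j), dproj_vlift,
      dirDeriv_zero]
    exact zero_smul _ _

theorem vertData_apply (hA : IsOpen A) {Y : ∀ v : A, TangentSpace (𝓡 n) v.1.proj}
    (hY : SmoothAVF Y) (T : Tensor A r s) (v : A)
    (θ : Fin r → Module.Dual ℝ (TangentSpace (𝓡 n) v.1.proj))
    (x : Fin s → TangentSpace (𝓡 n) v.1.proj) :
    ((vertData hA hY).op hA r s T).1 v θ x = vertDeriv T.1 v (Y v) θ x := by
  have hv : v.1.proj ∈ (prefChart (n := n) v.1.proj).1.source := mem_chart_source _ v.1.proj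
  rw [vertDeriv_eq T.2.1 hv (fun I J => dAt_comp hA T hv I J)]
  change (vertData hA hY).opAt _ T.1 v θ x = _
  -- Multilinearity on an empty sum: a zero argument gives the value zero.
  have h1 : ∀ b, T.1 v θ (Function.update x b 0) = 0 := fun b => by
    simpa using (T.2.1 v).map_update_vector_sum θ x b (∅ : Finset ℕ) 0 0
  have h2 : ∀ a, T.1 v (Function.update θ a 0) x = 0 := fun a => by
    simpa using (T.2.1 v).map_update_covector_sum θ x a (∅ : Finset ℕ) 0 0
  simp only [DerivationData.opAt, vertData, LinearMap.zero_apply, LinearMap.comp_zero, h1, h2,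
    Finset.sum_const_zero, add_zero, sub_zero]

end Vertical

end

end Aniso

namespace Aniso

noncomputable section

/-! ### Horizontal lifts and the derivation `𝔩^H_Z`. -/

section Horizontal

variable {n : ℕ} {M : Type*} [TopologicalSpace M] [ChartedSpace (EuclideanSpace ℝ (Fin n)) M]
  [IsManifold (𝓡 n) ∞ M] {A : Set (TangentBundle (𝓡 n) M)} {r s : ℕ}

namespace NonlinearConnection

variable (HA : NonlinearConnection A)

theorem hlift_spec (v : A) (w : TangentSpace (𝓡 n) v.1.proj) :
    hlift v.1 (HA.H v) w ∈ HA.H v ∧ dproj v.1 (hlift v.1 (HA.H v) w) = w := by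
  refine Classical.epsilon_spec (p := fun u => u ∈ HA.H v ∧ dproj v.1 u = w) ?_
  obtain ⟨u, hu⟩ := surjective_dproj v.1 w
  obtain ⟨a, ha, b, hb, hab⟩ := Submodule.mem_sup.1
    ((HA.isCompl v).sup_eq_top ▸ Submodule.mem_top (x := u))
  refine ⟨a, ha, ?_⟩
  have hb' : dproj v.1 b = 0 := hb
  rw [← hu, ← hab, map_add, hb', add_zero]

theorem eq_hlift {v : A} {w : TangentSpace (𝓡 n) v.1.proj} {u : TangentSpace (𝓡 n).tangent v.1}
    (hu : u ∈ HA.H v) (hw : dproj v.1 u = w) : hlift v.1 (HA.H v) w = u := by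
  have h := HA.hlift_spec v w
  refine sub_eq_zero.1 ((Submodule.disjoint_def.1 (HA.isCompl v).disjoint) _
    ((HA.H v).sub_mem h.1 hu) ?_)
  change dproj v.1 (hlift v.1 (HA.H v) w - u) = 0
  rw [map_sub, h.2, hw, sub_self]

/-- The horizontal lift as a linear map. -/
def lift (v : A) : TangentSpace (𝓡 n) v.1.proj →ₗ[ℝ] TangentSpace (𝓡 n).tangent v.1 where
  toFun := hlift v.1 (HA.H v)
  map_add' a b := HA.eq_hlift
    ((HA.H v).add_mem (HA.hlift_spec v a).1 (HA.hlift_spec v b).1) (by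
      rw [map_add, (HA.hlift_spec v a).2, (HA.hlift_spec v b).2])
  map_smul' c a := HA.eq_hlift ((HA.H v).smul_mem c (HA.hlift_spec v a).1) (by
      rw [map_smul, (HA.hlift_spec v a).2, RingHom.id_apply])

theorem dproj_lift (v : A) (w : TangentSpace (𝓡 n) v.1.proj) : dproj v.1 (HA.lift v w) = w :=
  (HA.hlift_spec v w).2

theorem dcoord_lift_frame (e : Chart n M) (v : A) (i j : Fin n) :
    (dcoord e v.1 (HA.lift v (frame e j v.1.proj))).2 i = -HA.N e i j v :=
  (neg_neg _).symm

theorem lift_eq_sum {e : Chart n M} {v : A} (hv : v.1.proj ∈ e.1.source)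
    (w : TangentSpace (𝓡 n) v.1.proj) :
    HA.lift v w = ∑ j, coframe e j v.1.proj w • HA.lift v (frame e j v.1.proj) := by
  conv_lhs => rw [← sum_coframe_frame e hv w]
  simp only [map_sum, map_smul]

theorem dcoord_lift_snd {e : Chart n M} {v : A} (hv : v.1.proj ∈ e.1.source)
    (w : TangentSpace (𝓡 n) v.1.proj) (i : Fin n) :
    (dcoord e v.1 (HA.lift v w)).2 i = -∑ j, coframe e j v.1.proj w * HA.N e i j v := by
  rw [HA.lift_eq_sum hv, map_sum, Prod.snd_sum, ← Finset.sum_neg_distrib]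
  simp only [map_smul, Prod.smul_snd]
  refine (map_sum (EuclideanSpace.proj i : EuclideanSpace ℝ (Fin n) →L[ℝ] ℝ) _ _).trans ?_
  refine Finset.sum_congr rfl fun j _ => ?_
  change coframe e j v.1.proj w * (dcoord e v.1 (HA.lift v (frame e j v.1.proj))).2 i = _
  rw [dcoord_lift_frame, mul_neg]

/-- This identifies the coordinate operator `δⱼ` with the derivative along an intrinsic vector, so
that horizontal derivatives can be compared between charts. -/
theorem der_lift_frame {f : A → ℝ} {v : A} (hf : DAt f v) {e : Chart n M}
    (hv : v.1.proj ∈ e.1.source) (j : Fin n) :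
    der f v (HA.lift v (frame e j v.1.proj)) = HA.delta e j f v := by
  rw [der_eq_sum hf hv]
  simp only [dcoord_fst e hv, dproj_lift, coframe_frame e hv, dcoord_lift_frame, delta]
  simp [sub_eq_add_neg]

theorem der_lift {f : A → ℝ} {v : A} (hf : DAt f v) {e : Chart n M}
    (hv : v.1.proj ∈ e.1.source) (w : TangentSpace (𝓡 n) v.1.proj) :
    der f v (HA.lift v w) = ∑ j, coframe e j v.1.proj w * HA.delta e j f v := by
  rw [HA.lift_eq_sum hv, map_sum]
  refine Finset.sum_congr rfl fun j _ => ?_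
  rw [map_smul, HA.der_lift_frame hf hv]
  rfl

theorem smoothOver_delta (hA : IsOpen A) {e : Chart n M} {f : A → ℝ} (hf : SmoothOver e f)
    (j : Fin n) : SmoothOver e (HA.delta e j f) :=
  (hf.pdx hA j).sub (SmoothOver.sum _ fun i => (HA.smooth e i j).mul (hf.pdy hA i))

theorem lieIn_eq {e : Chart n M} {v : A} (hv : v.1.proj ∈ e.1.source)
    {Z X : ∀ u : A, TangentSpace (𝓡 n) u.1.proj}
    (hZ : ∀ i, DAt (fun u : A => coframe e i u.1.proj (Z u)) v)
    (hX : ∀ i, DAt (fun u : A => coframe e i u.1.proj (X u)) v) :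
    HA.lieIn e Z X v = derVec e X v (HA.lift v (Z v)) - derVec e Z v (HA.lift v (X v)) := by
  simp only [lieIn, derVec, HA.der_lift (hZ _) hv, HA.der_lift (hX _) hv,
    ← Finset.sum_sub_distrib, ← sub_smul]

/-- The compatibility condition for `𝔩^H_Z`. Applying `δⱼ` to `Z'ⁱ = (∂x'ⁱ/∂xᵐ) Zᵐ` gives the
transformed `δⱼZᵐ` plus `∂ⱼ(∂x'ⁱ/∂xᵐ) Zᵐ`, and by symmetry the latter is the derivative of
`∂x'ⁱ/∂xʲ` along `Z`. -/
theorem derVec_frame_lift (hA : IsOpen A) {Z : ∀ u : A, TangentSpace (𝓡 n) u.1.proj}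
    {e e' : Chart n M} {v : A} (hv : v.1.proj ∈ e.1.source) (hv' : v.1.proj ∈ e'.1.source)
    (hZ : ∀ i, DAt (fun u : A => coframe e i u.1.proj (Z u)) v) (j : Fin n) :
    derVec e' (fun u : A => frame e j u.1.proj) v (HA.lift v (Z v)) =
      derVec e' Z v (HA.lift v (frame e j v.1.proj)) -
        derVec e Z v (HA.lift v (frame e j v.1.proj)) := by
  refine ext_coframe e' hv' fun i => ?_
  have hc := fun m => mdifferentiableAt_coframe_frame e e' hv hv' i m
  have h1 : der (fun u : A => coframe e' i u.1.proj (Z u)) v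
      (HA.lift v (frame e j v.1.proj)) =
      ∑ m, (coframe e' i v.1.proj (frame e m v.1.proj) *
          der (fun u : A => coframe e m u.1.proj (Z u)) v (HA.lift v (frame e j v.1.proj)) +
        dirDeriv (fun q => coframe e' i q (frame e m q)) v.1.proj (frame e j v.1.proj) *
          coframe e m v.1.proj (Z v)) := by
    rw [der_of_over hA e hv fun u hu => apply_eq_sum e hu (coframe e' i u.1.proj) (Z u),
      der_sum hA _ fun m => (DAt.base hA (hc m)).mul (hZ m)]
    refine Finset.sum_congr rfl fun m _ => ?_
    rw [der_mul (DAt.base hA (hc m)) (hZ m), der_base hA (hc m), dproj_lift]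
  rw [map_sub, derVec, derVec, derVec, coframe_sum_frame e' hv', coframe_sum_frame e' hv', h1,
    der_base hA (hc j), dproj_lift, dirDeriv_eq_sum _ e hv]
  simp only [map_sum, map_smul, smul_eq_mul, Finset.sum_add_distrib]
  -- Only here are the second derivatives of the transition map exchanged.
  simp only [dirDeriv_coframe_frame_symm e e' hv hv' i j, mul_comm]
  ring

/-- The data of the derivation `𝔩^H_Z`. -/
def lieData (hA : IsOpen A) {Z : ∀ v : A, TangentSpace (𝓡 n) v.1.proj} (hZ : SmoothAVF Z) :
    DerivationData A where
  W v := HA.lift v (Z v)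
  B e v := ∑ i, ((der (fun u : A => coframe e i u.1.proj (Z u)) v).toLinearMap.comp
    (HA.lift v)).smulRight (frame e i v.1.proj)
  smooth_fst e i := (hZ e i).congr fun v hv => by rw [dcoord_fst e hv, dproj_lift]
  smooth_snd e i := (SmoothOver.sum Finset.univ fun j =>
    (hZ e j).mul (HA.smooth e i j)).neg.congr fun v hv => HA.dcoord_lift_snd hv _ i
  smooth_B e i j := (HA.smoothOver_delta hA (hZ e i) j).congr fun v hv => by
    rw [← HA.der_lift_frame ((hZ e i).dAt hA hv) hv, LinearMap.sum_apply]
    exact coframe_sum_frame e hv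
      (fun k => der (fun u : A => coframe e k u.1.proj (Z u)) v (HA.lift v (frame e j v.1.proj))) i
  compat e e' v hv hv' j := by
    simp only [LinearMap.sum_apply]
    exact HA.derVec_frame_lift hA hv hv' (fun i => (hZ e i).dAt hA hv) j

variable {HA}

theorem lieData_B (hA : IsOpen A) {Z : ∀ v : A, TangentSpace (𝓡 n) v.1.proj} (hZ : SmoothAVF Z)
    (e : Chart n M) (v : A) (w : TangentSpace (𝓡 n) v.1.proj) :
    (HA.lieData hA hZ).B e v w = derVec e Z v (HA.lift v w) :=
  LinearMap.sum_apply _ _ _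

theorem lieData_bracket (hA : IsOpen A) {Z : ∀ v : A, TangentSpace (𝓡 n) v.1.proj}
    (hZ : SmoothAVF Z) {e : Chart n M} {v : A} (hv : v.1.proj ∈ e.1.source)
    {X : ∀ u : A, TangentSpace (𝓡 n) u.1.proj}
    (hX : ∀ i, DAt (fun u : A => coframe e i u.1.proj (X u)) v) :
    (HA.lieData hA hZ).bracket e X v = HA.lieIn e Z X v := by
  rw [HA.lieIn_eq hv (fun i => (hZ e i).dAt hA hv) hX, DerivationData.bracket, lieData_B]
  rfl

theorem op_vecTensor (hA : IsOpen A) {Z : ∀ v : A, TangentSpace (𝓡 n) v.1.proj}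
    (hZ : SmoothAVF Z) {X : ∀ u : A, TangentSpace (𝓡 n) u.1.proj} (hX : SmoothAVF X)
    {e : Chart n M} {v : A} (hv : v.1.proj ∈ e.1.source)
    (θ : Fin 1 → Module.Dual ℝ (TangentSpace (𝓡 n) v.1.proj))
    (x : Fin 0 → TangentSpace (𝓡 n) v.1.proj) :
    ((HA.lieData hA hZ).op hA 1 0 (vecTensor X hX)).1 v θ x = θ 0 (HA.lieIn e Z X v) := by
  have h1 : ∀ v : A, v.1.proj ∈ e.1.source → ∀ (I : Fin 1 → Fin n) (J : Fin 0 → Fin n),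
      comp ((HA.lieData hA hZ).op hA 1 0 (vecTensor X hX)).1 e I J v =
        coframe e (I 0) v.1.proj (HA.lieIn e Z X v) := by
    intro v hv I J
    refine (DerivationData.comp_apply hA _ hv I J).trans ?_
    have hX' := fun i => (hX e i).dAt hA hv
    rw [HA.lieIn_eq hv (fun i => (hZ e i).dAt hA hv) hX', map_sub,
      derVec, coframe_sum_frame e hv, HA.lift_eq_sum hv (X v)]
    simp only [Finset.univ_eq_empty, Finset.sum_empty, add_zero, Finset.univ_unique,
      Finset.sum_singleton, Fin.default_eq_zero]
    congr 1
    rw [derVec, coframe_sum_frame e hv, map_sum]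
    refine Finset.sum_congr rfl fun k _ => ?_
    rw [lieData_B, derVec, coframe_sum_frame e hv, map_smul, mul_comm]
    simp only [comp, vecTensor, Function.update_self]
    rfl
  have h2 := ((HA.lieData hA hZ).op hA 1 0 (vecTensor X hX)).2.1 v
  -- Evaluation of a covector on the bracket is written as a product with a single factor, so that
  -- equality on coordinate covectors suffices.
  have h3 := isMultilin_prod (n := n) (M := M) (p := v.1.proj) (s := 0) 1
    ![HA.lieIn e Z X v] ![]
  have h4 := congrFun (congrFun (h2.ext_comp h3 e hv fun I J => by
    simpa using! h1 v hv I J) θ) x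
  simpa using h4

/-- The left side of `op_vecTensor` does not mention the chart in which the bracket on the right is
computed; apply it in both charts and test against the coordinate covectors of one of them. -/
theorem lieIn_chart (hA : IsOpen A) {Z X : ∀ v : A, TangentSpace (𝓡 n) v.1.proj}
    (hZ : SmoothAVF Z) (hX : SmoothAVF X) {e e' : Chart n M} {v : A}
    (hv : v.1.proj ∈ e.1.source) (hv' : v.1.proj ∈ e'.1.source) :
    HA.lieIn e Z X v = HA.lieIn e' Z X v :=
  ext_coframe e hv fun i => (op_vecTensor hA hZ hX hv (fun _ => coframe e i v.1.proj) ![]).symm.trans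
    (op_vecTensor hA hZ hX hv' (fun _ => coframe e i v.1.proj) ![])

theorem lie_eq_lieIn (hA : IsOpen A) {Z X : ∀ v : A, TangentSpace (𝓡 n) v.1.proj}
    (hZ : SmoothAVF Z) (hX : SmoothAVF X) {e : Chart n M} {v : A}
    (hv : v.1.proj ∈ e.1.source) : HA.lie Z X v = HA.lieIn e Z X v :=
  lieIn_chart hA hZ hX (mem_chart_source _ v.1.proj) hv

theorem smoothAVF_lie (hA : IsOpen A) {Z X : ∀ v : A, TangentSpace (𝓡 n) v.1.proj}
    (hZ : SmoothAVF Z) (hX : SmoothAVF X) : SmoothAVF (HA.lie Z X) := fun e i =>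
  (((HA.lieData hA hZ).op hA 1 0 (vecTensor X hX)).2.2 e ![i] ![]).congr fun v hv => by
    rw [lie_eq_lieIn hA hZ hX hv, ← op_vecTensor hA hZ hX hv (fun _ => coframe e i v.1.proj) ![]]
    simp only [comp]
    congr 1

theorem covec_op (hA : IsOpen A) {Z : ∀ v : A, TangentSpace (𝓡 n) v.1.proj}
    (hZ : SmoothAVF Z) (θ : Tensor A 0 1) {e : Chart n M} {v : A} (hv : v.1.proj ∈ e.1.source) :
    covec ((HA.lieData hA hZ).op hA 0 1 θ) v = (HA.lieData hA hZ).cobracket e (covec θ) v := by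
  refine LinearMap.ext fun w => ?_
  refine (congrFun (congrFun (DerivationData.apply_eq hA θ hv) ![]) ![w]).trans ?_
  simp only [DerivationData.opAt, Finset.univ_eq_empty, Finset.sum_empty, sub_zero,
    Finset.univ_unique, Finset.sum_singleton, DerivationData.cobracket, LinearMap.add_apply,
    LinearMap.comp_apply]
  congr 1
  · have h1 := (isMultilin_prod (n := n) (M := M) (p := v.1.proj) (r := 0) 1 ![]
      ![derCov e (covec θ) v ((HA.lieData hA hZ).W v)])
    have h2 := isMultilin_ofComp (r := 0) (s := 1) e v.1.proj fun I J =>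
      der (comp θ.1 e I J) v ((HA.lieData hA hZ).W v)
    have h3 := congrFun (congrFun (h2.ext_comp h1 e hv fun I J => ?_) ![]) ![w]
    · simpa using! h3
    · rw [ofComp_frame e hv]
      simp [derCov, coframe_frame e hv]
      refine congrArg (fun f => der f v ((HA.lieData hA hZ).W v)) (funext fun u => ?_)
      refine congrArg₂ (θ.1 u) (Subsingleton.elim _ _) (funext fun b => ?_)
      rw [Subsingleton.elim b 0]
      rfl
  · refine congrArg (θ.1 v ![]) (funext fun b => ?_)
    rw [Subsingleton.elim b default, Function.update_self]
    rfl

theorem dAt_covec (hA : IsOpen A) (θ : Tensor A 0 1) {e : Chart n M} {v : A}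
    (hv : v.1.proj ∈ e.1.source) (i : Fin n) :
    DAt (fun u : A => covec θ u (frame e i u.1.proj)) v := by
  refine (dAt_comp hA θ hv ![] ![i]).congr hA (Filter.Eventually.of_forall fun u => ?_)
  refine congrArg₂ (θ.1 u) (Subsingleton.elim _ _) (funext fun b => ?_)
  rw [Subsingleton.elim b 0]
  rfl

/-- An instance of `DerivationData.opAt_fields`, once `bracket`, `cobracket` and the derivative
along `W` are recognised as `𝔩^H_Z` on vectors, on covectors and as `Z^H`. -/
theorem op_fields (hA : IsOpen A) {Z : ∀ v : A, TangentSpace (𝓡 n) v.1.proj}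
    (hZ : SmoothAVF Z) (T : Tensor A r s) (θ : Fin r → Tensor A 0 1)
    (X : Fin s → ∀ v : A, TangentSpace (𝓡 n) v.1.proj) (hX : ∀ ν, SmoothAVF (X ν))
    {e : Chart n M} {v : A} (hv : v.1.proj ∈ e.1.source) :
    ((HA.lieData hA hZ).op hA r s T).1 v (fun μ => covec (θ μ) v) (fun ν => X ν v) =
      HA.horDeriv e Z (fun u => T.1 u (fun μ => covec (θ μ) u) (fun ν => X ν u)) v
      - ∑ μ, T.1 v (Function.update (fun μ' => covec (θ μ') v) μ
          (covec ((HA.lieData hA hZ).op hA 0 1 (θ μ)) v)) (fun ν => X ν v)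
      - ∑ ν, T.1 v (fun μ => covec (θ μ) v)
          (Function.update (fun ν' => X ν' v) ν (HA.lie Z (X ν) v)) := by
  have h1 := fun a i => dAt_covec hA (θ a) hv i
  have h2 := fun b j => (hX b e j).dAt hA hv
  refine (congrFun (congrFun (DerivationData.apply_eq hA T hv) _) _).trans
    ((DerivationData.opAt_fields hA T hv (θ := fun u a => covec (θ a) u)
      (X := fun u b => X b u) h1 h2).trans ?_)
  simp only [covec_op hA hZ _ hv, lie_eq_lieIn hA hZ (hX _) hv, lieData_bracket hA hZ hv (h2 _)]
  congr 2
  exact HA.der_lift (DAt.apply_fields hA T.2.1 hv (fun I J => dAt_comp hA T hv I J)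
    (θ := fun u a => covec (θ a) u) (X := fun u b => X b u) h1 h2) hv (Z v)

theorem comp_op (hA : IsOpen A) {Z : ∀ v : A, TangentSpace (𝓡 n) v.1.proj}
    (hZ : SmoothAVF Z) (T : Tensor A r s) {e : Chart n M} {v : A}
    (hv : v.1.proj ∈ e.1.source) (I : Fin r → Fin n) (J : Fin s → Fin n) :
    comp ((HA.lieData hA hZ).op hA r s T).1 e I J v =
      ∑ k, coframe e k v.1.proj (Z v) * HA.delta e k (comp T.1 e I J) v
      - ∑ μ, ∑ k, HA.delta e k (fun u => coframe e (I μ) u.1.proj (Z u)) v *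
          comp T.1 e (Function.update I μ k) J v
      + ∑ ν, ∑ k, HA.delta e (J ν) (fun u => coframe e k u.1.proj (Z u)) v *
          comp T.1 e I (Function.update J ν k) v := by
  have h1 : ∀ i j, coframe e i v.1.proj ((HA.lieData hA hZ).B e v (frame e j v.1.proj)) =
      HA.delta e j (fun u => coframe e i u.1.proj (Z u)) v := fun i j => by
    rw [lieData_B, derVec, coframe_sum_frame e hv, HA.der_lift_frame ((hZ e i).dAt hA hv) hv]
  refine (DerivationData.comp_apply hA T hv I J).trans ?_
  simp only [h1]
  rw [show der (comp T.1 e I J) v ((HA.lieData hA hZ).W v) = _ from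
    HA.der_lift (dAt_comp hA T hv I J) hv (Z v)]
  ring

end NonlinearConnection

end Horizontal

end

end Aniso

namespace Aniso

noncomputable section

/-! ### The Lie bracket of vector fields in coordinates. -/

section Bracket

variable {n : ℕ} {M : Type*} [TopologicalSpace M] [ChartedSpace (EuclideanSpace ℝ (Fin n)) M]
  [IsManifold (𝓡 n) ∞ M]

theorem dirDeriv_eq_fderiv {f : M → ℝ} {p : M} (hf : MDifferentiableAt (𝓡 n) 𝓘(ℝ, ℝ) f p)
    (e : Chart n M) (hp : p ∈ e.1.source) (w : TangentSpace (𝓡 n) p) :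
    dirDeriv f p w = fderiv ℝ (fun x => f (e.1.symm x)) (e.1 p) (tcoord e ⟨p, w⟩).2 := by
  rw [dirDeriv_eq_sum f e hp]
  conv_rhs => rw [← (EuclideanSpace.basisFun (Fin n) ℝ).sum_repr (tcoord e ⟨p, w⟩).2]
  simp only [map_sum, map_smul, dirDeriv_frame hf e hp]
  simp
  rfl

theorem mpullback_symm (e : Chart n M) (X : ∀ p : M, TangentSpace (𝓡 n) p)
    {x : EuclideanSpace ℝ (Fin n)} (hx : x ∈ e.1.target) :
    VectorField.mpullback (𝓡 n) (𝓡 n) e.1.symm X x = (tcoord e ⟨e.1.symm x, X (e.1.symm x)⟩).2 := by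
  rw [VectorField.mpullback_apply]
  have h1 := congrArg (fun L => L (X (e.1.symm x))) (ContinuousLinearMap.inverse_equiv
    ((mdifferentiable_chart e).symm.mfderiv hx))
  exact h1

/-- The bracket is natural under pullback by the inverse chart, and on the model space it is `DY(X)
- DX(Y)`. -/
theorem coframe_mlieBracket {X Y : ∀ p : M, TangentSpace (𝓡 n) p} (e : Chart n M) {p : M}
    (hp : p ∈ e.1.source)
    (hX : MDifferentiableAt (𝓡 n) (𝓡 n).tangent (fun q => (⟨q, X q⟩ : TangentBundle (𝓡 n) M)) p)
    (hY : MDifferentiableAt (𝓡 n) (𝓡 n).tangent (fun q => (⟨q, Y q⟩ : TangentBundle (𝓡 n) M)) p)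
    (i : Fin n) :
    coframe e i p (VectorField.mlieBracket (𝓡 n) X Y p) =
      dirDeriv (fun q => coframe e i q (Y q)) p (X p) -
        dirDeriv (fun q => coframe e i q (X q)) p (Y p) := by
  -- Writing the point as `e.1.symm x` from the outset makes the pullback formulas apply without
  -- transport between tangent spaces.
  obtain ⟨x, hx, rfl⟩ : ∃ x ∈ e.1.target, e.1.symm x = p :=
    ⟨e.1 p, e.1.map_source hp, e.1.left_inv hp⟩
  have : IsManifold (𝓡 n) (minSmoothness ℝ 3) M := IsManifold.of_le (n := ∞) (by
    simp only [minSmoothness_of_isRCLikeNormedField]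
    exact WithTop.coe_le_coe.2 le_top)
  have h1 := VectorField.mpullback_mlieBracket (n := ∞) hX hY
    ((contMDiffOn_symm_of_mem_maximalAtlas e.2).contMDiffAt (e.1.open_target.mem_nhds hx)) (by
    simp only [minSmoothness_of_isRCLikeNormedField]
    exact WithTop.coe_le_coe.2 le_top)
  have h0 : ∀ V W : EuclideanSpace ℝ (Fin n) → EuclideanSpace ℝ (Fin n),
      VectorField.mlieBracket (𝓡 n) V W x = fderiv ℝ W x (V x) - fderiv ℝ V x (W x) := by
    intro V W
    refine (congrFun (VectorField.mlieBracketWithin_univ (I := 𝓡 n) (V := V) (W := W)).symm x).trans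
      ((congrFun VectorField.mlieBracketWithin_eq_lieBracketWithin x).trans ?_)
    rw [VectorField.lieBracketWithin_univ, VectorField.lieBracket_eq]
  have h2 : ∀ X : ∀ p : M, TangentSpace (𝓡 n) p, VectorField.mpullback (𝓡 n) (𝓡 n) e.1.symm X
      =ᶠ[𝓝 x] fun x => (tcoord e ⟨e.1.symm x, X (e.1.symm x)⟩).2 := fun X => by
    filter_upwards [e.1.open_target.mem_nhds hx] with z hz
    exact mpullback_symm e X hz
  have h9 : (tcoord e ⟨e.1.symm x, VectorField.mlieBracket (𝓡 n) X Y (e.1.symm x)⟩).2 =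
      fderiv ℝ (fun x => (tcoord e ⟨e.1.symm x, Y (e.1.symm x)⟩).2) x
        (tcoord e ⟨e.1.symm x, X (e.1.symm x)⟩).2 -
      fderiv ℝ (fun x => (tcoord e ⟨e.1.symm x, X (e.1.symm x)⟩).2) x
        (tcoord e ⟨e.1.symm x, Y (e.1.symm x)⟩).2 :=
    (mpullback_symm e _ hx).symm.trans (h1.trans
      (((h2 X).mlieBracket_vectorField_eq (h2 Y)).trans (h0 _ _)))
  have h3 : ∀ {X : ∀ p : M, TangentSpace (𝓡 n) p}, MDifferentiableAt (𝓡 n) (𝓡 n).tangent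
      (fun q => (⟨q, X q⟩ : TangentBundle (𝓡 n) M)) (e.1.symm x) →
      MDifferentiableAt (𝓡 n) 𝓘(ℝ, EuclideanSpace ℝ (Fin n))
        (fun q => (tcoord e ⟨q, X q⟩).2) (e.1.symm x) := by
    intro X hX
    have h4 := (mdifferentiableAt_tcoord e (v := ⟨e.1.symm x, X (e.1.symm x)⟩) hp).comp
      (e.1.symm x) hX
    exact (ContinuousLinearMap.snd ℝ (EuclideanSpace ℝ (Fin n))
      (EuclideanSpace ℝ (Fin n))).mdifferentiableAt.comp (e.1.symm x) h4
  have h5 : ∀ {X : ∀ p : M, TangentSpace (𝓡 n) p}, MDifferentiableAt (𝓡 n) (𝓡 n).tangent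
      (fun q => (⟨q, X q⟩ : TangentBundle (𝓡 n) M)) (e.1.symm x) → ∀ w,
      dirDeriv (fun q => coframe e i q (X q)) (e.1.symm x) w =
        fderiv ℝ (fun x => (tcoord e ⟨e.1.symm x, X (e.1.symm x)⟩).2) x
          (tcoord e ⟨e.1.symm x, w⟩).2 i := by
    intro X hX w
    have h6 : MDifferentiableAt (𝓡 n) 𝓘(ℝ, ℝ) (fun q => coframe e i q (X q)) (e.1.symm x) :=
      (EuclideanSpace.proj i : EuclideanSpace ℝ (Fin n) →L[ℝ] ℝ).mdifferentiableAt.comp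
        (e.1.symm x) (h3 hX)
    rw [dirDeriv_eq_fderiv h6 e hp, e.1.right_inv hx]
    have h7 := ((h3 hX).comp x ((mdifferentiable_chart e).mdifferentiableAt_symm hx)).differentiableAt
    have h8 := ((EuclideanSpace.proj i : EuclideanSpace ℝ (Fin n) →L[ℝ] ℝ).hasFDerivAt.comp x
      h7.hasFDerivAt).fderiv
    exact congrArg (fun L => L (tcoord e ⟨e.1.symm x, w⟩).2) h8
  rw [h5 hX, h5 hY]
  exact congrArg (fun z : EuclideanSpace ℝ (Fin n) => z i) h9

theorem SmoothVFOn.mdifferentiableAt {X : ∀ p : M, TangentSpace (𝓡 n) p} {U : Set M}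
    (hX : SmoothVFOn X U) {p : M} (hU : U ∈ 𝓝 p) :
    MDifferentiableAt (𝓡 n) (𝓡 n).tangent (fun q => (⟨q, X q⟩ : TangentBundle (𝓡 n) M)) p :=
  (ContMDiffOn.contMDiffAt hX hU).mdifferentiableAt (by simp)

end Bracket

/-! ### Locality of anisotropic connections, Christoffel symbols and torsion. -/

namespace AnisoConnection

variable {n : ℕ} {M : Type*} [TopologicalSpace M] [ChartedSpace (EuclideanSpace ℝ (Fin n)) M]
  [IsManifold (𝓡 n) ∞ M] {A : Set (TangentBundle (𝓡 n) M)} (C : AnisoConnection A)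

theorem smoothVFOn_zero (U : Set M) :
    SmoothVFOn (fun p : M => (0 : TangentSpace (𝓡 n) p)) U :=
  SmoothVFOn.sum (ι := Empty) Finset.univ (X := fun i => i.elim) (fun i => i.elim)

theorem nabla_zero_left {Y : ∀ p : M, TangentSpace (𝓡 n) p} (hY : SmoothVFOn Y Set.univ) (v : A) :
    C.nabla (fun _ => 0) Y v = 0 := by
  have h := C.smul_left (fun _ => 0) (fun _ => 0) Y contMDiff_const (smoothVFOn_zero _) hY v
  simpa using h

theorem nabla_zero_right {X : ∀ p : M, TangentSpace (𝓡 n) p} (hX : SmoothVFOn X Set.univ)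
    (v : A) : C.nabla X (fun _ => 0) v = 0 := by
  have h := C.leibniz (fun _ => 0) X (fun _ => 0) contMDiff_const hX (smoothVFOn_zero _) v
  simpa using h

theorem nabla_sum_left {ι : Type*} (S : Finset ι) {X : ι → ∀ p : M, TangentSpace (𝓡 n) p}
    (hX : ∀ i, SmoothVFOn (X i) Set.univ) {Y : ∀ p : M, TangentSpace (𝓡 n) p}
    (hY : SmoothVFOn Y Set.univ) (v : A) :
    C.nabla (fun p => ∑ i ∈ S, X i p) Y v = ∑ i ∈ S, C.nabla (X i) Y v := by
  classical
  induction S using Finset.induction_on with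
  | empty => simpa using C.nabla_zero_left hY v
  | insert a S ha ih =>
    simp only [Finset.sum_insert ha]
    rw [C.add_left _ _ _ (hX a) (SmoothVFOn.sum S hX) hY, ih]

theorem nabla_sum_right {ι : Type*} (S : Finset ι) {Y : ι → ∀ p : M, TangentSpace (𝓡 n) p}
    (hY : ∀ i, SmoothVFOn (Y i) Set.univ) {X : ∀ p : M, TangentSpace (𝓡 n) p}
    (hX : SmoothVFOn X Set.univ) (v : A) :
    C.nabla X (fun p => ∑ i ∈ S, Y i p) v = ∑ i ∈ S, C.nabla X (Y i) v := by
  classical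
  induction S using Finset.induction_on with
  | empty => simpa using C.nabla_zero_right hX v
  | insert a S ha ih =>
    simp only [Finset.sum_insert ha]
    rw [C.add_right _ _ _ hX (hY a) (SmoothVFOn.sum S hY), ih]

/-- The standard locality device: if `R = f R` with `f` and `R` zero at `p`, then the Koszul rules
force `∇` to vanish at `p` when either argument is `R`. -/
theorem exists_smul_eq_sub [T2Space M] {X X' : ∀ p : M, TangentSpace (𝓡 n) p} {p : M}
    (hX : SmoothVFOn X Set.univ) (hX' : SmoothVFOn X' Set.univ) (h : ∀ᶠ q in 𝓝 p, X q = X' q) :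
    ∃ (f : M → ℝ) (R : ∀ p : M, TangentSpace (𝓡 n) p), ContMDiff (𝓡 n) 𝓘(ℝ, ℝ) ∞ f ∧
      SmoothVFOn R Set.univ ∧ f p = 0 ∧ R p = 0 ∧ (fun q => f q • R q) = R ∧
        X = fun q => X' q + R q := by
  obtain ⟨f, hf, hfU, hf1⟩ := exists_cutoff (n := n) p h
  -- The cutoff `f` is `1` near `p` and supported where `X = X'`. So `1 - f` vanishes at `p` and
  -- equals `1` wherever the difference `R = X - X'` is nonzero.
  refine ⟨fun q => 1 + (-1) * f q, fun q => X q + (-1 : ℝ) • X' q,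
    contMDiff_const.add (contMDiff_const.mul hf), hX.add (SmoothVFOn.smul contMDiffOn_const hX'),
    by simp [hf1.self_of_nhds], by simp [h.self_of_nhds], funext fun q => ?_,
    funext fun q => by simp⟩
  by_cases hq : q ∈ tsupport f
  · have h1 : X q = X' q := hfU hq
    simp [h1]
  · simp [image_eq_zero_of_notMem_tsupport hq]

theorem nabla_congr_left [T2Space M] {X X' Y : ∀ p : M, TangentSpace (𝓡 n) p}
    (hX : SmoothVFOn X Set.univ) (hX' : SmoothVFOn X' Set.univ) (hY : SmoothVFOn Y Set.univ)
    {v : A} (h : ∀ᶠ q in 𝓝 v.1.proj, X q = X' q) : C.nabla X Y v = C.nabla X' Y v := by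
  obtain ⟨f, R, hf, hR, hfp, -, hfR, rfl⟩ := exists_smul_eq_sub hX hX' h
  rw [C.add_left _ _ _ hX' hR hY, ← hfR, C.smul_left _ _ _ hf hR hY, hfp, zero_smul, add_zero]

theorem nabla_congr_right [T2Space M] {X Y Y' : ∀ p : M, TangentSpace (𝓡 n) p}
    (hX : SmoothVFOn X Set.univ) (hY : SmoothVFOn Y Set.univ) (hY' : SmoothVFOn Y' Set.univ)
    {v : A} (h : ∀ᶠ q in 𝓝 v.1.proj, Y q = Y' q) : C.nabla X Y v = C.nabla X Y' v := by
  obtain ⟨f, R, hf, hR, hfp, hRp, hfR, rfl⟩ := exists_smul_eq_sub hY hY' h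
  rw [C.add_right _ _ _ hX hY' hR, ← hfR, C.leibniz _ _ _ hf hX hR, hfp, hRp, zero_smul,
    smul_zero, add_zero, add_zero]

/-- A global expansion of a vector field in a local frame, valid near a point. -/
theorem exists_frame_expansion [T2Space M] (e : Chart n M) {p : M} (hp : p ∈ e.1.source)
    {X : ∀ p : M, TangentSpace (𝓡 n) p} (hX : SmoothVFOn X Set.univ) :
    ∃ a : Fin n → M → ℝ, (∀ j, ContMDiff (𝓡 n) 𝓘(ℝ, ℝ) ∞ (a j)) ∧
      (∀ j, ∀ᶠ q in 𝓝 p, a j q = coframe e j q (X q)) ∧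
      ∀ᶠ q in 𝓝 p, X q = ∑ j, a j q • frameExt e j p q := by
  obtain ⟨f, hf, hfU, hf1⟩ := exists_cutoff (n := n) p (e.1.open_source.mem_nhds hp)
  refine ⟨fun j q => f q * coframe e j q (X q), fun j => ?_, fun j => ?_, ?_⟩
  · rw [← contMDiffOn_univ]
    refine contMDiffOn_cutoff_mul hf e.1.open_source isOpen_univ hfU ?_
    rw [Set.inter_comm]
    exact hX.contMDiffOn_coframe e j
  · filter_upwards [hf1] with q hq
    rw [hq, one_mul]
  · have h1 := Filter.eventually_all.2 fun j => (frameExt_spec e j hp).2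
    filter_upwards [hf1, h1, e.1.open_source.mem_nhds hp] with q hq hq1 hq2
    conv_lhs => rw [← sum_coframe_frame e hq2 (X q)]
    simp only [hq, one_mul, hq1]

theorem coframe_nabla [T2Space M] {X Y : ∀ p : M, TangentSpace (𝓡 n) p}
    (hX : SmoothVFOn X Set.univ) (hY : SmoothVFOn Y Set.univ) (e : Chart n M) {v : A}
    (hv : v.1.proj ∈ e.1.source) (i : Fin n) :
    coframe e i v.1.proj (C.nabla X Y v) =
      dirDeriv (fun q => coframe e i q (Y q)) v.1.proj (X v.1.proj) +
        ∑ j, ∑ k, C.christoffel e i j k v *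
          (coframe e j v.1.proj (X v.1.proj) * coframe e k v.1.proj (Y v.1.proj)) := by
  obtain ⟨a, ha, ha1, ha2⟩ := exists_frame_expansion e hv hX
  obtain ⟨b, hb, hb1, hb2⟩ := exists_frame_expansion e hv hY
  have hF := fun j => (frameExt_spec e j hv).1
  have haF := fun j => SmoothVFOn.smul (ha j).contMDiffOn (hF j)
  have hbF := fun j => SmoothVFOn.smul (hb j).contMDiffOn (hF j)
  rw [C.nabla_congr_left hX (SmoothVFOn.sum Finset.univ haF) hY ha2,
    C.nabla_congr_right (SmoothVFOn.sum Finset.univ haF) hY (SmoothVFOn.sum Finset.univ hbF) hb2,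
    C.nabla_sum_left _ haF (SmoothVFOn.sum Finset.univ hbF)]
  simp only [C.smul_left _ _ _ (ha _) (hF _) (SmoothVFOn.sum Finset.univ hbF),
    C.nabla_sum_right _ hbF (hF _), C.leibniz _ _ _ (hb _) (hF _) (hF _),
    (ha1 _).self_of_nhds, (hb1 _).self_of_nhds, (frameExt_spec e _ hv).2.self_of_nhds,
    map_sum, map_smul, map_add, coframe_frame e hv, smul_eq_mul]
  simp only [mul_ite, mul_one, mul_zero, Finset.sum_add_distrib, Finset.sum_ite_eq,
    Finset.mem_univ, if_true, mul_add, Finset.mul_sum]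
  rw [add_comm]
  congr 1
  · rw [dirDeriv_eq_sum _ e hv]
    exact Finset.sum_congr rfl fun j _ => by rw [dirDeriv_congr (hb1 i)]
  · refine Finset.sum_congr rfl fun j _ => Finset.sum_congr rfl fun k _ => ?_
    rw [christoffel]
    ring

/-- The derivative terms of the two covariant derivatives are those of the Lie bracket. What is left
depends only on the values of `X` and `Y` at the point, which is why the torsion is a tensor. -/
theorem coframe_torsion [T2Space M] {X Y : ∀ p : M, TangentSpace (𝓡 n) p}
    (hX : SmoothVFOn X Set.univ) (hY : SmoothVFOn Y Set.univ) (e : Chart n M) {v : A}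
    (hv : v.1.proj ∈ e.1.source) (i : Fin n) :
    coframe e i v.1.proj
        (C.nabla X Y v - C.nabla Y X v - VectorField.mlieBracket (𝓡 n) X Y v.1.proj) =
      ∑ j, ∑ k, (C.christoffel e i j k v - C.christoffel e i k j v) *
          (coframe e j v.1.proj (X v.1.proj) * coframe e k v.1.proj (Y v.1.proj)) := by
  rw [map_sub, map_sub, C.coframe_nabla hX hY e hv, C.coframe_nabla hY hX e hv,
    coframe_mlieBracket e hv (hX.mdifferentiableAt Filter.univ_mem)
      (hY.mdifferentiableAt Filter.univ_mem)]
  simp only [sub_mul, Finset.sum_sub_distrib]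
  rw [Finset.sum_comm (f := fun j k => C.christoffel e i k j v * _)]
  simp only [mul_comm (coframe e _ v.1.proj (Y v.1.proj))]
  ring

/-- `frameExt` is chosen anew at every base point. By locality the extensions chosen at one point
also compute the symbols at nearby points, and for fixed global fields smoothness is part of the
definition of `∇`. -/
theorem smoothOver_christoffel [T2Space M] (hA : IsOpen A) (e : Chart n M) (i j k : Fin n) :
    SmoothOver e (C.christoffel e i j k) := by
  refine smoothOver_of_contMDiffAt fun v hv => ?_
  have hF := fun j => frameExt_spec e j hv
  refine (((C.smooth _ _ (hF j).1 (hF k).1) e i).contMDiffAt hA hv).congr_of_eventuallyEq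
    (ext0_eventuallyEq hA ?_)
  have h1 : ∀ᶠ q in 𝓝 v.1.proj, ∀ j, ∀ᶠ q' in 𝓝 q, frameExt e j v.1.proj q' = frame e j q' :=
    Filter.eventually_all.2 fun j => (hF j).2.eventually_nhds
  have h2 : ContinuousAt (fun u : A => u.1.proj) v :=
    ((FiberBundle.continuous_proj (EuclideanSpace ℝ (Fin n)) _).comp
      continuous_subtype_val).continuousAt
  filter_upwards [h2.eventually h1, eventually_over e hv] with u hu hu'
  have hG := fun j => frameExt_spec e j hu'
  have h3 : ∀ j, ∀ᶠ q in 𝓝 u.1.proj, frameExt e j u.1.proj q = frameExt e j v.1.proj q :=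
    fun j => by
      filter_upwards [hu j, (hG j).2] with q h h'
      rw [h, h']
  rw [christoffel, C.nabla_congr_left (hG j).1 (hF j).1 (hG k).1 (h3 j),
    C.nabla_congr_right (hF j).1 (hG k).1 (hF k).1 (h3 k)]

/-- The torsion at a point, by its components in a chart. -/
def torsionAt (e : Chart n M) (v : A)
    (θ : Fin 1 → Module.Dual ℝ (TangentSpace (𝓡 n) v.1.proj))
    (x : Fin 2 → TangentSpace (𝓡 n) v.1.proj) : ℝ :=
  ∑ i, ∑ j, ∑ k, (C.christoffel e i j k v - C.christoffel e i k j v) *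
    (∏ a, θ a (![frame e i v.1.proj] a)) *
      ∏ b, (![coframe e j v.1.proj, coframe e k v.1.proj] : Fin 2 → _) b (x b)

theorem torsionAt_apply [T2Space M] {X Y : ∀ p : M, TangentSpace (𝓡 n) p}
    (hX : SmoothVFOn X Set.univ) (hY : SmoothVFOn Y Set.univ) (e : Chart n M) {v : A}
    (hv : v.1.proj ∈ e.1.source) (θ : Fin 1 → Module.Dual ℝ (TangentSpace (𝓡 n) v.1.proj)) :
    C.torsionAt e v θ ![X v.1.proj, Y v.1.proj] =
      θ 0 (C.nabla X Y v - C.nabla Y X v - VectorField.mlieBracket (𝓡 n) X Y v.1.proj) := by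
  rw [apply_eq_sum e hv (θ 0)]
  simp only [C.coframe_torsion hX hY e hv, torsionAt, Finset.mul_sum]
  refine Finset.sum_congr rfl fun i _ => Finset.sum_congr rfl fun j _ =>
    Finset.sum_congr rfl fun k _ => ?_
  simp only [Finset.univ_unique, Finset.prod_singleton, Fin.default_eq_zero, Fin.prod_univ_two,
    Matrix.cons_val_zero, Matrix.cons_val_one]
  ring

theorem isMultilin_torsionAt (e : Chart n M) (v : A) : IsMultilin (C.torsionAt e v) :=
  isMultilin_sum _ fun _ => isMultilin_sum _ fun _ => isMultilin_sum _ fun _ =>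
    isMultilin_prod _ _ _

/-- Extend the two vectors to global fields; `torsionAt_apply` then equates both sides with an
expression free of charts. -/
theorem torsionAt_chart [T2Space M] {e e' : Chart n M} {v : A} (hv : v.1.proj ∈ e.1.source)
    (hv' : v.1.proj ∈ e'.1.source) : C.torsionAt e v = C.torsionAt e' v := by
  funext θ x
  obtain ⟨X, hX, hX0⟩ := exists_vectorField v.1.proj (x 0)
  obtain ⟨Y, hY, hY0⟩ := exists_vectorField v.1.proj (x 1)
  have hx : x = ![X v.1.proj, Y v.1.proj] := by
    funext b
    fin_cases b
    · exact hX0.symm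
    · exact hY0.symm
  rw [hx, C.torsionAt_apply hX hY e hv, C.torsionAt_apply hX hY e' hv']

/-- The torsion of an anisotropic connection. -/
def torsion [T2Space M] (hA : IsOpen A) : Tensor A 1 2 :=
  ⟨fun v => C.torsionAt (prefChart v.1.proj) v, fun v => C.isMultilin_torsionAt _ v,
    fun e I J => by
      have h1 : SmoothOver e (fun v => C.christoffel e (I 0) (J 0) (J 1) v -
          C.christoffel e (I 0) (J 1) (J 0) v) :=
        (C.smoothOver_christoffel hA e _ _ _).sub (C.smoothOver_christoffel hA e _ _ _)
      refine h1.congr fun v hv => ?_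
      rw [comp, C.torsionAt_chart (mem_chart_source _ v.1.proj) hv, torsionAt]
      simp [coframe_frame e hv, Fin.prod_univ_two]⟩

theorem torsion_eq [T2Space M] (hA : IsOpen A) {e : Chart n M} {v : A}
    (hv : v.1.proj ∈ e.1.source) : (C.torsion hA).1 v = C.torsionAt e v :=
  C.torsionAt_chart (mem_chart_source _ v.1.proj) hv

theorem isTorsion_torsion [T2Space M] (hA : IsOpen A) : C.IsTorsion (C.torsion hA) :=
  fun _ _ hX hY v θ => C.torsionAt_apply hX hY _ (mem_chart_source _ v.1.proj) θ

variable {C}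

theorem IsTorsion.unique [T2Space M] {T T' : Tensor A 1 2} (h : C.IsTorsion T)
    (h' : C.IsTorsion T') : T = T' := by
  refine Subtype.ext (funext fun v => funext fun θ => funext fun x => ?_)
  obtain ⟨X, hX, hX0⟩ := exists_vectorField v.1.proj (x 0)
  obtain ⟨Y, hY, hY0⟩ := exists_vectorField v.1.proj (x 1)
  have hx : x = ![X v.1.proj, Y v.1.proj] := by
    funext b
    fin_cases b
    · exact hX0.symm
    · exact hY0.symm
  rw [hx, h X Y hX hY, h' X Y hX hY]

theorem sum_torsion_identity (t : ℝ) (Γ : Fin n → Fin n → ℝ) (z x a b : Fin n → ℝ) :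
    ∑ j, ∑ k, (Γ j k - Γ k j) * t * (z j * x k) =
      (∑ j, z j * (a j + ∑ k, Γ j k * x k) - ∑ j, x j * (b j + ∑ k, Γ j k * z k) -
        ∑ j, (z j * a j - x j * b j)) * t := by
  have h1 : ∑ j, ∑ k, Γ k j * t * (z j * x k) = ∑ j, ∑ k, x j * (Γ j k * z k) * t := by
    rw [Finset.sum_comm]
    exact Finset.sum_congr rfl fun j _ => Finset.sum_congr rfl fun k _ => by ring
  have h2 : ∑ j, ∑ k, Γ j k * t * (z j * x k) = ∑ j, ∑ k, z j * (Γ j k * x k) * t :=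
    Finset.sum_congr rfl fun j _ => Finset.sum_congr rfl fun k _ => by ring
  simp only [sub_mul, Finset.sum_sub_distrib, h1, h2, mul_add, Finset.sum_add_distrib,
    Finset.mul_sum, Finset.sum_mul, add_mul]
  ring

/-- The `δ`-terms of the two covariant derivatives are exactly those of `𝔩^H_Z X` and cancel. The
Christoffel terms that remain are the components of the torsion. -/
theorem IsTorsion.apply_eq [T2Space M] (hA : IsOpen A) {T : Tensor A 1 2} (h : C.IsTorsion T)
    (HA : NonlinearConnection A) (Z X : ∀ v : A, TangentSpace (𝓡 n) v.1.proj)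
    {e : Chart n M} {v : A} (hv : v.1.proj ∈ e.1.source)
    (θ : Fin 1 → Module.Dual ℝ (TangentSpace (𝓡 n) v.1.proj)) :
    T.1 v θ ![Z v, X v] = θ 0 (C.cov HA e Z X v - C.cov HA e X Z v - HA.lieIn e Z X v) := by
  rw [h.unique (C.isTorsion_torsion hA), C.torsion_eq hA hv, apply_eq_sum e hv (θ 0), torsionAt]
  refine Finset.sum_congr rfl fun i _ => ?_
  rw [map_sub, map_sub, cov, cov, NonlinearConnection.lieIn, coframe_sum_frame e hv,
    coframe_sum_frame e hv, coframe_sum_frame e hv, mul_comm (θ 0 (frame e i v.1.proj)),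
    ← sum_torsion_identity]
  simp only [Finset.univ_unique, Finset.prod_singleton, Fin.default_eq_zero, Fin.prod_univ_two,
    Matrix.cons_val_zero, Matrix.cons_val_one]

end AnisoConnection

end
end Aniso

/-! ### The trace identity for top-degree forms, and composition with observer fields. -/

namespace Aniso

noncomputable section

/-- The infinitesimal form of `m(Ly₁, …, Lyₙ) = det L · m(y)`. The left side is again alternating in
`y`, so it is enough to compare on bases, where the `i`-th term contributes the diagonal entry
`Fᵢᵢ`. -/
theorem sum_map_update {V : Type*} [AddCommGroup V] [Module ℝ V] {n : ℕ}
    (b : Module.Basis (Fin n) ℝ V) (m : V [⋀^Fin n]→ₗ[ℝ] ℝ) (F : V →ₗ[ℝ] V) (y : Fin n → V) :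
    ∑ i, m (Function.update y i (F (y i))) = LinearMap.trace ℝ V F * m y := by
  let q : MultilinearMap ℝ (fun _ : Fin n => V) ℝ := ∑ i, m.toMultilinearMap.compLinearMap
    (Function.update (fun _ => LinearMap.id) i F)
  have hq : ∀ y, q y = ∑ i, m (Function.update y i (F (y i))) := by
    intro y
    simp only [q, sum_apply, MultilinearMap.compLinearMap_apply]
    refine Finset.sum_congr rfl fun i _ => congrArg m (funext fun j => ?_)
    by_cases h : j = i
    · subst h
      simp
    · simp [Function.update_of_ne h]
  let g : V [⋀^Fin n]→ₗ[ℝ] ℝ :=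
    { q with
      map_eq_zero_of_eq' := fun y i j hij hne => by
        change q y = 0
        -- If `y i = y j`, every other term still has two equal arguments and vanishes; the terms
        -- `i` and `j` differ by a transposition and cancel.
        rw [hq, ← Finset.sum_subset (Finset.subset_univ {i, j}), Finset.sum_pair hne]
        · have h1 : Function.update y j (F (y j)) =
              (Function.update y i (F (y i))) ∘ Equiv.swap i j := by
            funext k
            simp only [Function.comp]
            by_cases hk : k = i
            · subst hk
              simp [hij, Function.update_of_ne hne, Function.update_of_ne hne.symm]
            · by_cases hk' : k = j
              · subst hk'
                simp [hij]
              · rw [Equiv.swap_apply_of_ne_of_ne hk hk', Function.update_of_ne hk,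
                  Function.update_of_ne hk']
          rw [h1, m.map_swap _ hne, add_neg_cancel]
        · intro k _ hk
          simp only [Finset.mem_insert, Finset.mem_singleton, not_or] at hk
          exact m.map_eq_zero_of_eq _ (by
            rw [Function.update_of_ne (Ne.symm hk.1), Function.update_of_ne (Ne.symm hk.2), hij]) hne }
  have h : g = LinearMap.trace ℝ V F • m := by
    -- An injective choice of `n` basis vectors is a reordering `c` of the basis, and the trace may
    -- be computed in `c`.
    refine b.ext_alternating fun σ hσ => ?_
    let τ := Equiv.ofBijective σ (Finite.injective_iff_bijective.1 hσ)
    let c := b.reindex τ.symm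
    have hc : (fun i => b (σ i)) = c := by
      funext i
      simp [c, τ]
    change q _ = _ * m _
    rw [hc, hq, LinearMap.trace_eq_matrix_trace ℝ c, Matrix.trace, Finset.sum_mul]
    refine Finset.sum_congr rfl fun i _ => ?_
    conv_lhs => rw [← c.sum_repr (F (c i)), m.map_update_sum]
    simp only [m.map_update_smul, smul_eq_mul]
    rw [Finset.sum_eq_single i]
    · simp [LinearMap.toMatrix_apply]
    · intro k _ hk
      rw [m.map_update_self _ (Ne.symm hk), mul_zero]
    · simp
  rw [← hq]
  exact congrArg (fun f : V [⋀^Fin n]→ₗ[ℝ] ℝ => f y) h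

section AlongField

variable {n : ℕ} {M : Type*} [TopologicalSpace M] [ChartedSpace (EuclideanSpace ℝ (Fin n)) M]
  [IsManifold (𝓡 n) ∞ M] {A : Set (TangentBundle (𝓡 n) M)} {r s : ℕ}

theorem derTensor_vec (e : Chart n M) {v : A} (hv : v.1.proj ∈ e.1.source)
    (Z : ∀ u : A, TangentSpace (𝓡 n) u.1.proj) (W : TangentSpace (𝓡 n).tangent v.1)
    (θ : Fin 1 → Module.Dual ℝ (TangentSpace (𝓡 n) v.1.proj))
    (x : Fin 0 → TangentSpace (𝓡 n) v.1.proj) :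
    derTensor (r := 1) (s := 0) e (fun u θ _ => θ 0 (Z u)) v W θ x = θ 0 (derVec e Z v W) := by
  have h1 := isMultilin_prod (n := n) (M := M) (p := v.1.proj) (s := 0) 1 ![derVec e Z v W] ![]
  have h2 := isMultilin_ofComp (r := 1) (s := 0) e v.1.proj fun I J =>
    der (comp (r := 1) (s := 0) (fun u θ _ => θ 0 (Z u)) e I J) v W
  have h3 := congrFun (congrFun (h2.ext_comp h1 e hv fun I J => ?_) θ) x
  · simpa using! h3
  · rw [ofComp_frame e hv]
    simp only [derVec, Finset.univ_unique, Finset.prod_singleton, Fin.default_eq_zero,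
      Matrix.cons_val_zero, Finset.univ_eq_empty, Finset.prod_empty, coframe_sum_frame e hv,
      one_mul, mul_one]
    rfl

theorem vertDerivVec_eq (hA : IsOpen A) {Z : ∀ u : A, TangentSpace (𝓡 n) u.1.proj}
    (hZ : SmoothAVF Z) {e : Chart n M} {v : A} (hv : v.1.proj ∈ e.1.source)
    (y : TangentSpace (𝓡 n) v.1.proj) :
    vertDerivVec Z v y = derVec e Z v (vlift v.1 y) := by
  have h1 : ∀ θ x, vertDeriv (r := 1) (s := 0) (fun u θ _ => θ 0 (Z u)) v y θ x =
      θ 0 (derVec e Z v (vlift v.1 y)) := fun θ x =>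
    (vertDeriv_eq (vecTensor Z hZ).2.1 hv (fun I J => dAt_comp hA (vecTensor Z hZ) hv I J) y θ x).trans
      (derTensor_vec e hv Z _ θ x)
  simp only [vertDerivVec, h1, Matrix.cons_val_zero]
  exact (tbasis v.1.proj).sum_repr _

/-- The nonlinear covariant derivative of an observer field, as a linear map. -/
def NonlinearConnection.DLin (HA : NonlinearConnection A) (e : Chart n M)
    (V : ∀ p : M, TangentSpace (𝓡 n) p) (p : M)
    (hp : (⟨p, V p⟩ : TangentBundle (𝓡 n) M) ∈ A) :
    TangentSpace (𝓡 n) p →ₗ[ℝ] TangentSpace (𝓡 n) p :=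
  ∑ i, ∑ j, (fderiv ℝ (fun x => coframe e i (e.1.symm x) (V (e.1.symm x))) (e.1 p)
        (EuclideanSpace.single j 1) + HA.N e i j ⟨⟨p, V p⟩, hp⟩) •
    (coframe e j p).smulRight (frame e i p)

theorem NonlinearConnection.DLin_apply (HA : NonlinearConnection A) (e : Chart n M)
    (V : ∀ p : M, TangentSpace (𝓡 n) p) (p : M)
    (hp : (⟨p, V p⟩ : TangentBundle (𝓡 n) M) ∈ A) (w : TangentSpace (𝓡 n) p) :
    HA.DLin e V p hp w = HA.D e V p hp w := by
  simp only [DLin, D, LinearMap.sum_apply, LinearMap.smul_apply, LinearMap.smulRight_apply,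
    Finset.sum_smul, smul_smul]
  simp only [mul_comm]

/-- The vertical derivative of a vector field, as a linear map. -/
def vertLin (e : Chart n M) (Z : ∀ u : A, TangentSpace (𝓡 n) u.1.proj) (v : A) :
    TangentSpace (𝓡 n) v.1.proj →ₗ[ℝ] TangentSpace (𝓡 n) v.1.proj :=
  ∑ i, ∑ k, pdy e k (fun u : A => coframe e i u.1.proj (Z u)) v •
    (coframe e k v.1.proj).smulRight (frame e i v.1.proj)

theorem vertLin_apply (hA : IsOpen A) {Z : ∀ u : A, TangentSpace (𝓡 n) u.1.proj}
    (hZ : SmoothAVF Z) {e : Chart n M} {v : A} (hv : v.1.proj ∈ e.1.source)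
    (y : TangentSpace (𝓡 n) v.1.proj) : vertLin e Z v y = vertDerivVec Z v y := by
  rw [vertDerivVec_eq hA hZ hv, derVec]
  simp only [vertLin, der_vlift hA ((hZ e _).dAt hA hv) hv, LinearMap.sum_apply,
    LinearMap.smul_apply, LinearMap.smulRight_apply, Finset.sum_smul, smul_smul]
  simp only [mul_comm]

theorem mdifferentiableAt_coframe {X : ∀ p : M, TangentSpace (𝓡 n) p} {e : Chart n M} {p : M}
    (hp : p ∈ e.1.source)
    (hX : MDifferentiableAt (𝓡 n) (𝓡 n).tangent (fun q => (⟨q, X q⟩ : TangentBundle (𝓡 n) M)) p)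
    (i : Fin n) : MDifferentiableAt (𝓡 n) 𝓘(ℝ, ℝ) (fun q => coframe e i q (X q)) p := by
  have h1 : MDifferentiableAt (𝓡 n)
      𝓘(ℝ, EuclideanSpace ℝ (Fin n) × EuclideanSpace ℝ (Fin n)) (fun q => tcoord e ⟨q, X q⟩) p :=
    (mdifferentiableAt_tcoord e (v := ⟨p, X p⟩) hp).comp p hX
  exact ((EuclideanSpace.proj i : EuclideanSpace ℝ (Fin n) →L[ℝ] ℝ).comp
    (ContinuousLinearMap.snd ℝ (EuclideanSpace ℝ (Fin n))
      (EuclideanSpace ℝ (Fin n)))).mdifferentiableAt.comp p h1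

/-- The derivative, along an observer field, of a function on `A`. -/
theorem dirDeriv_along (hA : IsOpen A) (HA : NonlinearConnection A)
    {V : ∀ p : M, TangentSpace (𝓡 n) p} {e : Chart n M} {p : M} (hp : p ∈ e.1.source)
    (hV : MDifferentiableAt (𝓡 n) (𝓡 n).tangent (fun q => (⟨q, V q⟩ : TangentBundle (𝓡 n) M)) p)
    (hVA : (⟨p, V p⟩ : TangentBundle (𝓡 n) M) ∈ A) {g : A → ℝ} (hg : DAt g ⟨⟨p, V p⟩, hVA⟩)
    (w : TangentSpace (𝓡 n) p) :
    dirDeriv (fun q => ext0 g ⟨q, V q⟩) p w =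
      der g ⟨⟨p, V p⟩, hVA⟩ (HA.lift ⟨⟨p, V p⟩, hVA⟩ w) +
        der g ⟨⟨p, V p⟩, hVA⟩ (vlift ⟨p, V p⟩ (HA.D e V p hVA w)) := by
  change _ = _ + der g ⟨⟨p, V p⟩, hVA⟩
    (vlift (⟨⟨p, V p⟩, hVA⟩ : A).1 (HA.D e V p hVA w))
  set v : A := ⟨⟨p, V p⟩, hVA⟩
  have hv : v.1.proj ∈ e.1.source := hp
  let W : TangentSpace (𝓡 n).tangent v.1 :=
    (mfderiv (𝓡 n) (𝓡 n).tangent (fun q => (⟨q, V q⟩ : TangentBundle (𝓡 n) M)) p :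
      TangentSpace (𝓡 n) p →L[ℝ] TangentSpace (𝓡 n).tangent v.1) w
  have h0 : dirDeriv (fun q => ext0 g ⟨q, V q⟩) p w = der g v W := by
    have h := mfderiv_comp (I' := (𝓡 n).tangent) (I'' := 𝓘(ℝ, ℝ))
      (f := fun q => (⟨q, V q⟩ : TangentBundle (𝓡 n) M)) p (g := ext0 g) hg hV
    exact congrArg (fun L : TangentSpace (𝓡 n) p →L[ℝ] ℝ => L w) h
  have h2 := mfderiv_comp p (mdifferentiableAt_tcoord e hv) hV
  have h3 : dcoord e v.1 W = (mfderiv (𝓡 n)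
      𝓘(ℝ, EuclideanSpace ℝ (Fin n) × EuclideanSpace ℝ (Fin n)) (fun q => tcoord e ⟨q, V q⟩) p :
      TangentSpace (𝓡 n) p →L[ℝ] EuclideanSpace ℝ (Fin n) × EuclideanSpace ℝ (Fin n)) w :=
    (congrArg (fun L : TangentSpace (𝓡 n) p →L[ℝ]
      EuclideanSpace ℝ (Fin n) × EuclideanSpace ℝ (Fin n) => L w) h2).symm
  have h4 : ∀ L : EuclideanSpace ℝ (Fin n) × EuclideanSpace ℝ (Fin n) →L[ℝ] ℝ,
      L (dcoord e v.1 W) = dirDeriv (fun q => L (tcoord e ⟨q, V q⟩)) p w := by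
    intro L
    rw [h3]
    have h5 := mfderiv_comp p L.mdifferentiableAt ((mdifferentiableAt_tcoord e hv).comp p hV)
    rw [L.mfderiv_eq] at h5
    exact (congrArg (fun L : TangentSpace (𝓡 n) p →L[ℝ] ℝ => L w) h5).symm
  have h6 : ∀ i, (dcoord e v.1 W).1 i = coframe e i p w := by
    intro i
    refine (h4 ((EuclideanSpace.proj i).comp (ContinuousLinearMap.fst ℝ _ _))).trans ?_
    have h5 := mfderiv_comp p (EuclideanSpace.proj i :
      EuclideanSpace ℝ (Fin n) →L[ℝ] ℝ).mdifferentiableAt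
      ((mdifferentiable_chart e).mdifferentiableAt hp)
    rw [ContinuousLinearMap.mfderiv_eq] at h5
    exact congrArg (fun L : TangentSpace (𝓡 n) p →L[ℝ] ℝ => L w) h5
  have h7 : ∀ i, (dcoord e v.1 W).2 i = dirDeriv (fun q => coframe e i q (V q)) p w := fun i =>
    h4 ((EuclideanSpace.proj i).comp (ContinuousLinearMap.snd ℝ _ _))
  -- This is the splitting of `W = dV(w)`: the lift contributes `-wʲNⁱⱼ` and the vertical part
  -- `wʲ(∂ⱼVⁱ + Nⁱⱼ)`, which together give the derivative of `Vⁱ` along `w`.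
  have h8 : ∀ i, (dcoord e v.1 W).2 i = (dcoord e v.1 (HA.lift v w)).2 i +
      (dcoord e v.1 (vlift v.1 (HA.D e V p hVA w))).2 i := by
    intro i
    rw [h7, dcoord_vlift hA hv, HA.dcoord_lift_snd hv, NonlinearConnection.D,
      coframe_sum_frame e hv, dirDeriv_eq_sum _ e hp, ← Finset.sum_neg_distrib,
      ← Finset.sum_add_distrib]
    refine Finset.sum_congr rfl fun j _ => ?_
    rw [dirDeriv_frame (mdifferentiableAt_coframe hp hV i) e hp]
    change _ = -(coframe e j p w * _) + _
    ring
  rw [h0, der_eq_sum hg hv, der_eq_sum hg hv, der_eq_sum hg hv]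
  simp only [h6, h8, dcoord_fst e hv, HA.dproj_lift, dproj_vlift, map_zero, zero_mul,
    Finset.sum_const_zero, zero_add, add_mul, Finset.sum_add_distrib]
  rw [add_assoc]

theorem compose_eq_ext0 (S : Tensor A 0 s) (V : ∀ p : M, TangentSpace (𝓡 n) p)
    (Y : Fin s → ∀ p : M, TangentSpace (𝓡 n) p) (q : M) :
    compose S V q (fun i => Y i q) =
      ext0 (fun u : A => S.1 u ![] (fun i => Y i u.1.proj)) ⟨q, V q⟩ := by
  by_cases h : (⟨q, V q⟩ : TangentBundle (𝓡 n) M) ∈ A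
  · rw [compose, dif_pos h, ext0_apply _ h]
  · rw [compose, dif_neg h, ext0_of_notMem _ h]

theorem composeVec_of_mem (Z : ∀ u : A, TangentSpace (𝓡 n) u.1.proj)
    (V : ∀ p : M, TangentSpace (𝓡 n) p) {p : M} (h : (⟨p, V p⟩ : TangentBundle (𝓡 n) M) ∈ A) :
    composeVec Z V p = Z ⟨⟨p, V p⟩, h⟩ := dif_pos h

theorem coframe_composeVec (Z : ∀ u : A, TangentSpace (𝓡 n) u.1.proj)
    (V : ∀ p : M, TangentSpace (𝓡 n) p) (e : Chart n M) (i : Fin n) (q : M) :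
    coframe e i q (composeVec Z V q) =
      ext0 (fun u : A => coframe e i u.1.proj (Z u)) ⟨q, V q⟩ := by
  by_cases h : (⟨q, V q⟩ : TangentBundle (𝓡 n) M) ∈ A
  · rw [composeVec, dif_pos h, ext0_apply _ h]
  · rw [composeVec, dif_neg h, ext0_of_notMem _ h, map_zero]

theorem smoothVFOn_composeVec {Z : ∀ u : A, TangentSpace (𝓡 n) u.1.proj} (hZ : SmoothAVF Z)
    {V : ∀ p : M, TangentSpace (𝓡 n) p} {U : Set M} (hV : SmoothVFOn V U)
    (hVA : ∀ p ∈ U, (⟨p, V p⟩ : TangentBundle (𝓡 n) M) ∈ A) (e : Chart n M) :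
    SmoothVFOn (composeVec Z V) (U ∩ e.1.source) := by
  have h1 : ∀ i, SmoothVFOn (fun q => coframe e i q (composeVec Z V q) • frame e i q)
      (U ∩ e.1.source) := fun i => by
    refine SmoothVFOn.smul ?_ (ContMDiffOn.mono (smoothVFOn_frame e i) Set.inter_subset_right)
    have h2 := ContMDiffOn.comp (hZ e i) (ContMDiffOn.mono hV Set.inter_subset_left)
      fun p hp => ⟨hVA p hp.1, hp.2⟩
    exact h2.congr fun q _ => coframe_composeVec Z V e i q
  refine ContMDiffOn.congr (SmoothVFOn.sum Finset.univ h1) fun q hq => ?_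
  exact congrArg (fun w => (⟨q, w⟩ : TangentBundle (𝓡 n) M)) (sum_coframe_frame e hq.2 _).symm

/-- In `[Z_V, Y]ⁱ = Z_V(Yⁱ) - Y(Zⁱ ∘ V)` the second term splits by `dirDeriv_along` into the
horizontal derivative of `Zⁱ`, which completes the bracket `𝔩^H_Z Y`, and a vertical derivative
along `D_Y V`. -/
theorem mlieBracket_composeVec (hA : IsOpen A) {HA : NonlinearConnection A}
    {Z : ∀ u : A, TangentSpace (𝓡 n) u.1.proj} (hZ : SmoothAVF Z)
    {V : ∀ p : M, TangentSpace (𝓡 n) p} {U : Set M} (hU : IsOpen U) (hV : SmoothVFOn V U)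
    (hVA : ∀ p ∈ U, (⟨p, V p⟩ : TangentBundle (𝓡 n) M) ∈ A) {e : Chart n M} {p : M}
    (hpU : p ∈ U) (hp : p ∈ e.1.source) {Y : ∀ p : M, TangentSpace (𝓡 n) p}
    (hY : SmoothVFOn Y U) :
    VectorField.mlieBracket (𝓡 n) (composeVec Z V) Y p =
      (HA.lieData hA hZ).bracket e (fun u : A => Y u.1.proj) ⟨⟨p, V p⟩, hVA p hpU⟩ -
        vertDerivVec Z ⟨⟨p, V p⟩, hVA p hpU⟩ (HA.D e V p (hVA p hpU) (Y p)) := by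
  have hY' := hY.mdifferentiableAt (hU.mem_nhds hpU)
  have hV' := hV.mdifferentiableAt (hU.mem_nhds hpU)
  have hW := (smoothVFOn_composeVec hZ hV hVA e).mdifferentiableAt
    ((hU.inter e.1.open_source).mem_nhds ⟨hpU, hp⟩)
  set v : A := ⟨⟨p, V p⟩, hVA p hpU⟩
  have hv : v.1.proj ∈ e.1.source := hp
  refine ext_coframe e hp fun i => ?_
  rw [coframe_mlieBracket e hp hW hY', vertDerivVec_eq hA hZ hv, DerivationData.bracket,
    NonlinearConnection.lieData_B, map_sub, map_sub]
  simp only [coframe_composeVec]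
  rw [dirDeriv_along hA HA hp hV' (hVA p hpU) ((hZ e i).dAt hA hv)]
  change _ = coframe e i v.1.proj _ - coframe e i v.1.proj _ - coframe e i v.1.proj _
  rw [derVec, derVec, derVec, coframe_sum_frame e hv, coframe_sum_frame e hv,
    coframe_sum_frame e hv, der_base hA (g := fun q => coframe e i q (Y q))
      (mdifferentiableAt_coframe hp hY' i)]
  have h1 : dproj v.1 ((HA.lieData hA hZ).W v) = composeVec Z V p :=
    (HA.dproj_lift v _).trans (composeVec_of_mem Z V (hVA p hpU)).symm
  rw [h1]
  exact sub_add_eq_sub_sub _ _ _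

/-- The product rule along a vertical direction, in which isotropic arguments do not vary. -/
theorem vertDeriv_fields (hA : IsOpen A) (S : Tensor A 0 s) {e : Chart n M} {v : A}
    (hv : v.1.proj ∈ e.1.source) {Y : Fin s → ∀ p : M, TangentSpace (𝓡 n) p}
    (hY : ∀ b i, MDifferentiableAt (𝓡 n) 𝓘(ℝ, ℝ) (fun q => coframe e i q (Y b q)) v.1.proj)
    (y : TangentSpace (𝓡 n) v.1.proj) :
    der (fun u : A => S.1 u ![] (fun b => Y b u.1.proj)) v (vlift v.1 y) =
      vertDeriv S.1 v y ![] (fun b => Y b v.1.proj) := by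
  have h1 := der_apply_fields hA S.2.1 hv (fun I J => dAt_comp hA S hv I J)
    (θ := fun _ => ![]) (X := fun u b => Y b u.1.proj) (fun a => a.elim0)
    (fun b i => DAt.base hA (hY b i)) (vlift v.1 y)
  have h2 : ∀ b, derVec e (fun u : A => Y b u.1.proj) v (vlift v.1 y) = 0 := fun b => by
    refine Finset.sum_eq_zero fun i _ => ?_
    rw [der_base hA (hY b i), dproj_vlift, dirDeriv_zero]
    exact zero_smul _ _
  have h3 : ∀ b, S.1 v ![] (Function.update (fun b => Y b v.1.proj) b 0) = 0 := fun b => by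
    simpa using (S.2.1 v).map_update_vector_sum ![] (fun b => Y b v.1.proj) b (∅ : Finset ℕ) 0 0
  rw [vertDeriv_eq S.2.1 hv (fun I J => dAt_comp hA S hv I J), h1]
  simp only [h2, h3, Finset.univ_eq_empty, Finset.sum_empty, Finset.sum_const_zero, add_zero]

theorem IsForm.sum_map_update {S : Tensor A 0 n} (hS : IsForm S) (v : A)
    (F : TangentSpace (𝓡 n) v.1.proj →ₗ[ℝ] TangentSpace (𝓡 n) v.1.proj)
    (y : Fin n → TangentSpace (𝓡 n) v.1.proj) :
    ∑ i, S.1 v ![] (Function.update y i (F (y i))) =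
      LinearMap.trace ℝ (TangentSpace (𝓡 n) v.1.proj) F * S.1 v ![] y := by
  obtain ⟨m, hm⟩ := (S.2.1 v).2 ![]
  have h := Aniso.sum_map_update (tbasis v.1.proj)
    { m with
      map_eq_zero_of_eq' := fun x i j hij hne => (hm x).symm.trans (hS v x i j hne hij) } F y
  simp only [hm]
  exact h

/-- Part (D) for covariant tensors of any degree, with a sum in place of the trace. Expand the
classical Lie derivative: `dirDeriv_along` applied to `S(Y₁, …, Y_s)` produces the term `∂̇_{D_Z V}
S`, and `mlieBracket_composeVec` produces one correction per slot. -/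
theorem compose_op (hA : IsOpen A) {HA : NonlinearConnection A}
    {Z : ∀ u : A, TangentSpace (𝓡 n) u.1.proj} (hZ : SmoothAVF Z)
    {V : ∀ p : M, TangentSpace (𝓡 n) p} {U : Set M} (hU : IsOpen U) (hV : SmoothVFOn V U)
    (hVA : ∀ p ∈ U, (⟨p, V p⟩ : TangentBundle (𝓡 n) M) ∈ A) (S : Tensor A 0 s) {e : Chart n M}
    {p : M} (hpU : p ∈ U) (hp : p ∈ e.1.source) {Y : Fin s → ∀ p : M, TangentSpace (𝓡 n) p}
    (hY : ∀ i, SmoothVFOn (Y i) U) :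
    compose ((HA.lieData hA hZ).op hA 0 s S) V p (fun i => Y i p) =
      lieDerivForm (composeVec Z V) (compose S V) Y p -
        vertDeriv S.1 ⟨⟨p, V p⟩, hVA p hpU⟩ (HA.D e V p (hVA p hpU) (composeVec Z V p)) ![]
          (fun i => Y i p) -
        ∑ i, compose S V p (Function.update (fun i => Y i p) i
          (vertDerivVec Z ⟨⟨p, V p⟩, hVA p hpU⟩ (HA.D e V p (hVA p hpU) (Y i p)))) := by
  have hV' := hV.mdifferentiableAt (hU.mem_nhds hpU)
  have hY' := fun b i => mdifferentiableAt_coframe hp ((hY b).mdifferentiableAt (hU.mem_nhds hpU)) i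
  have hc : ∀ (T : Tensor A 0 s) x, compose T V p x = T.1 ⟨⟨p, V p⟩, hVA p hpU⟩ ![] x :=
    fun T x => dif_pos (hVA p hpU)
  set v : A := ⟨⟨p, V p⟩, hVA p hpU⟩
  have hv : v.1.proj ∈ e.1.source := hp
  have h1 := DerivationData.opAt_fields (D := HA.lieData hA hZ) hA S hv (θ := fun _ => ![])
    (X := fun u b => Y b u.1.proj) (fun a => a.elim0) (fun b i => DAt.base hA (g := fun q => coframe e i q (Y b q)) (hY' b i))
  have h2 : ((HA.lieData hA hZ).op hA 0 s S).1 v ![] (fun i => Y i p) = _ :=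
    (congrFun (congrFun (DerivationData.apply_eq hA S hv) ![]) (fun i => Y i v.1.proj)).trans h1
  have hg : DAt (fun u : A => S.1 u ![] (fun i => Y i u.1.proj)) v :=
    DAt.apply_fields hA S.2.1 hv (fun I J => dAt_comp hA S hv I J) (θ := fun _ => ![])
      (X := fun u b => Y b u.1.proj) (fun a => a.elim0) (fun b i => DAt.base hA (g := fun q => coframe e i q (Y b q)) (hY' b i))
  have h3 := dirDeriv_along hA HA hp hV' (hVA p hpU) hg (composeVec Z V p)
  have h4 := vertDeriv_fields hA S hv hY' (HA.D e V p (hVA p hpU) (composeVec Z V p))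
  have h5 : (HA.lieData hA hZ).W v = HA.lift v (composeVec Z V p) :=
    congrArg (HA.lift v) (composeVec_of_mem Z V (hVA p hpU)).symm
  rw [hc, h2, lieDerivForm]
  simp only [compose_eq_ext0 S V Y, hc,
    mlieBracket_composeVec hA (HA := HA) hZ hU hV hVA hpU hp (hY _), h5,
    (S.2.1 v).map_update_vector_sub, Finset.sum_sub_distrib, Finset.univ_eq_empty,
    Finset.sum_empty]
  rw [h3]
  have h6 : der (fun u : A => S.1 u ![] (fun i => Y i u.1.proj)) v
      (vlift ⟨p, V p⟩ (HA.D e V p (hVA p hpU) (composeVec Z V p))) = _ := h4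
  rw [h6]
  ring

end AlongField

end

end Aniso

namespace Aniso

noncomputable section

/-! ### Recovering the Lie derivative along isotropic fields. -/

section LieDerivative

variable {n : ℕ} {M : Type*} [TopologicalSpace M] [ChartedSpace (EuclideanSpace ℝ (Fin n)) M]
  [IsManifold (𝓡 n) ∞ M] {A : Set (TangentBundle (𝓡 n) M)}

theorem IsTensorDerivation.eq_of_forall [T2Space M] {D D' : TensorOp A}
    (h : IsTensorDerivation D) (h' : IsTensorDerivation D') (h0 : ∀ f, D 0 0 f = D' 0 0 f)
    (h1 : ∀ (X : ∀ p : M, TangentSpace (𝓡 n) p) (hX : SmoothVFOn X Set.univ),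
      D 1 0 (vecTensor (fun v : A => X v.1.proj) hX.smoothAVF) =
        D' 1 0 (vecTensor (fun v : A => X v.1.proj) hX.smoothAVF)) : D = D' := by
  funext r s
  refine LinearMap.ext fun T => sub_eq_zero.1 ?_
  exact (h.sub h').eq_zero (fun f => sub_eq_zero.2 (h0 f)) (fun X hX => sub_eq_zero.2 (h1 X hX))
    r s T

theorem IsLieDerivative.unique [T2Space M] {Z : ∀ p : M, TangentSpace (𝓡 n) p}
    {L L' : TensorOp A} (h : IsLieDerivative Z L) (h' : IsLieDerivative Z L') : L = L' := by
  refine h.derivation.eq_of_forall h'.derivation (fun f => ?_) fun X hX => ?_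
  · refine Subtype.ext (funext fun v => funext fun θ => funext fun x => ?_)
    rw [Subsingleton.elim θ ![], Subsingleton.elim x ![],
      h.function f (prefChart v.1.proj) v (mem_chart_source _ v.1.proj),
      h'.function f (prefChart v.1.proj) v (mem_chart_source _ v.1.proj)]
  · refine Subtype.ext (funext fun v => funext fun θ => funext fun x => ?_)
    rw [h.vector X hX, h'.vector X hX]

theorem vertDeriv_isotropic (hA : IsOpen A) {X : ∀ p : M, TangentSpace (𝓡 n) p}
    (hX : SmoothVFOn X Set.univ) (v : A) (y : TangentSpace (𝓡 n) v.1.proj)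
    (θ : Fin 1 → Module.Dual ℝ (TangentSpace (𝓡 n) v.1.proj))
    (x : Fin 0 → TangentSpace (𝓡 n) v.1.proj) :
    vertDeriv (vecTensor (fun v : A => X v.1.proj) hX.smoothAVF).1 v y θ x = 0 := by
  have hv : v.1.proj ∈ (prefChart (n := n) v.1.proj).1.source := mem_chart_source _ v.1.proj
  have h1 := fun i => mdifferentiableAt_coframe hv (hX.mdifferentiableAt Filter.univ_mem) i
  refine (vertDeriv_eq (vecTensor _ hX.smoothAVF).2.1 hv
    (fun I J => dAt_comp hA (vecTensor _ hX.smoothAVF) hv I J) y θ x).trans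
      ((derTensor_vec _ hv _ _ θ x).trans ?_)
  have h2 : derVec (prefChart v.1.proj) (fun u : A => X u.1.proj) v (vlift v.1 y) = 0 := by
    refine Finset.sum_eq_zero fun i _ => ?_
    rw [der_base hA (h1 i), dproj_vlift, dirDeriv_zero]
    exact zero_smul _ _
  rw [h2, map_zero]

/-- Components of isotropic fields are functions on the base, where a horizontal lift acts as the
vector itself; the nonlinear connection drops out. -/
theorem lieIn_isotropic (hA : IsOpen A) (HA : NonlinearConnection A)
    {Z X : ∀ p : M, TangentSpace (𝓡 n) p} (hZ : SmoothVFOn Z Set.univ)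
    (hX : SmoothVFOn X Set.univ) {e : Chart n M} {v : A} (hv : v.1.proj ∈ e.1.source) :
    HA.lieIn e (fun v : A => Z v.1.proj) (fun v : A => X v.1.proj) v =
      VectorField.mlieBracket (𝓡 n) Z X v.1.proj := by
  have hZ' := hZ.mdifferentiableAt (p := v.1.proj) Filter.univ_mem
  have hX' := hX.mdifferentiableAt (p := v.1.proj) Filter.univ_mem
  have h1 := mdifferentiableAt_coframe hv hZ'
  have h2 := mdifferentiableAt_coframe hv hX'
  refine ext_coframe e hv fun i => ?_
  rw [HA.lieIn_eq hv (fun i => DAt.base hA (h1 i)) (fun i => DAt.base hA (h2 i)),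
    coframe_mlieBracket e hv hZ' hX', map_sub, derVec, derVec, coframe_sum_frame e hv,
    coframe_sum_frame e hv, der_base hA (h1 i), der_base hA (h2 i), HA.dproj_lift, HA.dproj_lift]

theorem vertDeriv_function (hA : IsOpen A) (f : Tensor A 0 0) {e : Chart n M} {v : A}
    (hv : v.1.proj ∈ e.1.source) (y : TangentSpace (𝓡 n) v.1.proj) :
    vertDeriv f.1 v y ![] ![] =
      ∑ i, coframe e i v.1.proj y * pdy e i (fun u => f.1 u ![] ![]) v := by
  have hf : DAt (fun u : A => f.1 u ![] ![]) v :=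
    (dAt_comp hA f hv ![] ![]).congr hA (Filter.Eventually.of_forall fun u =>
      congrArg₂ (f.1 u) (Subsingleton.elim _ _) (Subsingleton.elim _ _))
  rw [← der_vlift hA hf hv]
  have h1 := vertDeriv_fields hA f hv (Y := fun b => b.elim0) (fun b => b.elim0) y
  have h2 : (fun b : Fin 0 => (b.elim0 : ∀ p : M, TangentSpace (𝓡 n) p) v.1.proj) = ![] :=
    Subsingleton.elim _ _
  rw [h2] at h1
  rw [← h1]
  congr 2
  funext u
  exact congrArg (f.1 u ![]) (Subsingleton.elim _ _)

/-- The components of `ℂ` are the fibre coordinates, and `δⱼ yⁱ = -Nⁱⱼ`. These `N`-terms compensate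
for the connection in `Z^H`. -/
theorem coframe_lie_liouville (hA : IsOpen A) (HA : NonlinearConnection A)
    {Z : ∀ p : M, TangentSpace (𝓡 n) p} (hZ : SmoothVFOn Z Set.univ) {e : Chart n M} {v : A}
    (hv : v.1.proj ∈ e.1.source) (i : Fin n) :
    coframe e i v.1.proj (HA.lie (fun v : A => Z v.1.proj) liouville v) =
      -∑ j, (coframe e j v.1.proj (Z v.1.proj) * HA.N e i j v +
        coframe e j v.1.proj v.1.2 *
          fderiv ℝ (fun x => coframe e i (e.1.symm x) (Z (e.1.symm x))) (e.1 v.1.proj)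
            (EuclideanSpace.single j 1)) := by
  have h1 := mdifferentiableAt_coframe hv (hZ.mdifferentiableAt Filter.univ_mem) i
  have h2 : ∀ j, HA.delta e j (fun u : A => coframe e i u.1.proj (liouville u)) v =
      -HA.N e i j v := fun j => by
    refine (HA.der_lift_frame (dAt_fiberCoord hA e hv i) hv j).symm.trans ?_
    exact (der_fiberCoord hA e hv i _).trans (HA.dcoord_lift_frame e v i j)
  have h3 : ∀ j, HA.delta e j (fun u : A => coframe e i u.1.proj (Z u.1.proj)) v =
      fderiv ℝ (fun x => coframe e i (e.1.symm x) (Z (e.1.symm x))) (e.1 v.1.proj)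
        (EuclideanSpace.single j 1) := fun j => by
    rw [← HA.der_lift_frame (DAt.base hA h1) hv, der_base hA h1, HA.dproj_lift,
      dirDeriv_frame h1 e hv]
  rw [NonlinearConnection.lie_eq_lieIn hA hZ.smoothAVF smoothAVF_liouville hv,
    NonlinearConnection.lieIn, coframe_sum_frame e hv, ← Finset.sum_neg_distrib]
  simp only [h2, h3]
  simp only [liouville]
  exact Finset.sum_congr rfl fun j _ => by ring

/-- The derivation `𝔩^H_Z - ∂̇_{𝔩^H_Z ℂ}`. -/
def lieOp (hA : IsOpen A) (HA : NonlinearConnection A)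
    {Z : ∀ v : A, TangentSpace (𝓡 n) v.1.proj} (hZ : SmoothAVF Z) : TensorOp A := fun r s =>
  (HA.lieData hA hZ).op hA r s -
    (vertData hA (NonlinearConnection.smoothAVF_lie (HA := HA) hA hZ smoothAVF_liouville)).op hA r s

variable {r s : ℕ}

theorem lieOp_apply (hA : IsOpen A) (HA : NonlinearConnection A)
    {Z : ∀ v : A, TangentSpace (𝓡 n) v.1.proj} (hZ : SmoothAVF Z) (T : Tensor A r s) (v : A)
    (θ : Fin r → Module.Dual ℝ (TangentSpace (𝓡 n) v.1.proj))
    (x : Fin s → TangentSpace (𝓡 n) v.1.proj) :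
    (lieOp hA HA hZ r s T).1 v θ x = ((HA.lieData hA hZ).op hA r s T).1 v θ x -
      vertDeriv T.1 v (HA.lie Z liouville v) θ x := by
  rw [← vertData_apply hA (NonlinearConnection.smoothAVF_lie hA hZ smoothAVF_liouville)]
  rfl

theorem isTensorDerivation_lieOp (hA : IsOpen A) (HA : NonlinearConnection A)
    {Z : ∀ v : A, TangentSpace (𝓡 n) v.1.proj} (hZ : SmoothAVF Z) :
    IsTensorDerivation (lieOp hA HA hZ) :=
  (DerivationData.isTensorDerivation_op hA).sub (DerivationData.isTensorDerivation_op hA)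

theorem isLieDerivative_lieOp (hA : IsOpen A) (HA : NonlinearConnection A)
    {Z : ∀ p : M, TangentSpace (𝓡 n) p} (hZ : SmoothVFOn Z Set.univ) :
    IsLieDerivative Z (lieOp hA HA (Z := fun v : A => Z v.1.proj) hZ.smoothAVF) where
  derivation := isTensorDerivation_lieOp hA HA _
  vector X hX hX' v θ x := by
    have hv : v.1.proj ∈ (prefChart (n := n) v.1.proj).1.source := mem_chart_source _ v.1.proj
    rw [lieOp_apply, vertDeriv_isotropic hA hX, sub_zero,
      NonlinearConnection.op_vecTensor hA hZ.smoothAVF hX' hv, lieIn_isotropic hA HA hZ hX hv]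
  function f e v hv := by
    have h1 := NonlinearConnection.comp_op hA (HA := HA) hZ.smoothAVF f hv ![] ![]
    have h2 : comp f.1 e ![] ![] = fun u => f.1 u ![] ![] := funext fun u =>
      congrArg₂ (f.1 u) (Subsingleton.elim _ _) (Subsingleton.elim _ _)
    have h3 : comp ((HA.lieData hA hZ.smoothAVF).op hA 0 0 f).1 e ![] ![] v =
        ((HA.lieData hA hZ.smoothAVF).op hA 0 0 f).1 v ![] ![] :=
      congrArg₂ (((HA.lieData hA hZ.smoothAVF).op hA 0 0 f).1 v) (Subsingleton.elim _ _)
        (Subsingleton.elim _ _)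
    rw [h2, h3] at h1
    rw [lieOp_apply, h1, vertDeriv_function hA f hv]
    simp only [coframe_lie_liouville hA HA hZ hv, completeLift, Finset.univ_eq_empty,
      Finset.sum_empty, sub_zero, add_zero, NonlinearConnection.delta, mul_sub,
      Finset.sum_sub_distrib, neg_mul, Finset.sum_neg_distrib, Finset.sum_mul, add_mul,
      Finset.sum_add_distrib, Finset.mul_sum, mul_assoc]
    -- After the sums are put in the same order, the terms `Zᵏ Nⁱₖ ∂̇ᵢf` from `Z^H f` and from
    -- `∂̇_{𝔩^H_Z ℂ} f` cancel.
    rw [Finset.sum_comm (f := fun k i => coframe e k v.1.proj (Z v.1.proj) *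
        (HA.N e i k v * _)),
      Finset.sum_comm (f := fun k i => coframe e k v.1.proj v.1.2 * (_ * _))]
    ring

end LieDerivative

end

end Aniso

/-! ### The main theorem, assembled. -/

theorem mainTheorem2 {n : ℕ} (hn : 2 ≤ n) {M : Type*} [TopologicalSpace M]
    [ChartedSpace (EuclideanSpace ℝ (Fin n)) M] [IsManifold (𝓡 n) ∞ M] [T2Space M]
    [SecondCountableTopology M] [ConnectedSpace M]
    (A : Set (TangentBundle (𝓡 n) M)) (hA : IsOpen A) (hπ : ∀ p : M, ∃ v ∈ A, v.proj = p)
    (HA : Aniso.NonlinearConnection A)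
    (Z : ∀ v : A, TangentSpace (𝓡 n) v.1.proj) (hZ : Aniso.SmoothAVF Z) :
    -- the bracket is a well-defined smooth anisotropic field, given by the formula in every chart
    (∀ X : ∀ v : A, TangentSpace (𝓡 n) v.1.proj, Aniso.SmoothAVF X →
      Aniso.SmoothAVF (HA.lie Z X) ∧
      ∀ (e : Aniso.Chart n M) (v : A), v.1.proj ∈ e.1.source →
        HA.lie Z X v = HA.lieIn e Z X v) ∧
    -- (A)
    (∀ C : Aniso.AnisoConnection A, C.IsUnderlying HA →
      (∃! Tor : Aniso.Tensor A 1 2, C.IsTorsion Tor) ∧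
      ∀ Tor : Aniso.Tensor A 1 2, C.IsTorsion Tor →
        ∀ X : ∀ v : A, TangentSpace (𝓡 n) v.1.proj, Aniso.SmoothAVF X →
        ∀ (e : Aniso.Chart n M) (v : A), v.1.proj ∈ e.1.source →
        ∀ θ : Fin 1 → Module.Dual ℝ (TangentSpace (𝓡 n) v.1.proj),
          Tor.1 v θ ![Z v, X v] =
            θ 0 (C.cov HA e Z X v - C.cov HA e X Z v - HA.lie Z X v)) ∧
    -- (B) existence of the extension `l` of the bracket to a tensor derivation
    ∃ l : Aniso.TensorOp A,
      Aniso.IsTensorDerivation l ∧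
      (∀ (X : ∀ v : A, TangentSpace (𝓡 n) v.1.proj) (hX : Aniso.SmoothAVF X)
        (hY : Aniso.SmoothAVF (HA.lie Z X)),
        l 1 0 (Aniso.vecTensor X hX) = Aniso.vecTensor (HA.lie Z X) hY) ∧
      -- (B) uniqueness
      (∀ l' : Aniso.TensorOp A, Aniso.IsTensorDerivation l' →
        (∀ (X : ∀ v : A, TangentSpace (𝓡 n) v.1.proj) (hX : Aniso.SmoothAVF X)
          (hY : Aniso.SmoothAVF (HA.lie Z X)),
          l' 1 0 (Aniso.vecTensor X hX) = Aniso.vecTensor (HA.lie Z X) hY) →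
        l' = l) ∧
      -- (B) invariant formula
      (∀ (r s : ℕ) (T : Aniso.Tensor A r s) (θ : Fin r → Aniso.Tensor A 0 1)
        (X : Fin s → ∀ v : A, TangentSpace (𝓡 n) v.1.proj), (∀ ν, Aniso.SmoothAVF (X ν)) →
        ∀ (e : Aniso.Chart n M) (v : A), v.1.proj ∈ e.1.source →
        (l r s T).1 v (fun μ => Aniso.covec (θ μ) v) (fun ν => X ν v) =
          HA.horDeriv e Z
            (fun u => T.1 u (fun μ => Aniso.covec (θ μ) u) (fun ν => X ν u)) v
          - ∑ μ, T.1 v (Function.update (fun μ' => Aniso.covec (θ μ') v) μ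
              (Aniso.covec (l 0 1 (θ μ)) v)) (fun ν => X ν v)
          - ∑ ν, T.1 v (fun μ => Aniso.covec (θ μ) v)
              (Function.update (fun ν' => X ν' v) ν (HA.lie Z (X ν) v))) ∧
      -- (B) coordinate formula
      (∀ (r s : ℕ) (T : Aniso.Tensor A r s) (e : Aniso.Chart n M) (v : A),
        v.1.proj ∈ e.1.source → ∀ (I : Fin r → Fin n) (J : Fin s → Fin n),
        Aniso.comp (l r s T).1 e I J v =
          ∑ k, Aniso.coframe e k v.1.proj (Z v) * HA.delta e k (Aniso.comp T.1 e I J) v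
          - ∑ μ, ∑ k, HA.delta e k (fun u => Aniso.coframe e (I μ) u.1.proj (Z u)) v *
              Aniso.comp T.1 e (Function.update I μ k) J v
          + ∑ ν, ∑ k, HA.delta e (J ν) (fun u => Aniso.coframe e k u.1.proj (Z u)) v *
              Aniso.comp T.1 e I (Function.update J ν k) v) ∧
      -- (C)
      (∃ L : Aniso.TensorOp A,
        (∀ (r s : ℕ) (T : Aniso.Tensor A r s) (v : A)
          (θ : Fin r → Module.Dual ℝ (TangentSpace (𝓡 n) v.1.proj))
          (x : Fin s → TangentSpace (𝓡 n) v.1.proj),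
          (L r s T).1 v θ x =
            (l r s T).1 v θ x - Aniso.vertDeriv T.1 v (HA.lie Z Aniso.liouville v) θ x) ∧
        Aniso.IsTensorDerivation L ∧
        ∀ Z₀ : ∀ p : M, TangentSpace (𝓡 n) p, Aniso.SmoothVFOn Z₀ Set.univ →
          (∀ v : A, Z v = Z₀ v.1.proj) →
          Aniso.IsLieDerivative Z₀ L ∧
          ∀ L' : Aniso.TensorOp A, Aniso.IsLieDerivative Z₀ L' → L = L') ∧
      -- (D)
      (∀ (U : Set M) (V : ∀ p : M, TangentSpace (𝓡 n) p), IsOpen U → Aniso.SmoothVFOn V U →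
        ∀ hV : ∀ p ∈ U, (⟨p, V p⟩ : TangentBundle (𝓡 n) M) ∈ A,
        ∀ S : Aniso.Tensor A 0 n, Aniso.IsForm S →
        ∀ (e : Aniso.Chart n M) (p : M) (hp : p ∈ U), p ∈ e.1.source →
        ∃ F : TangentSpace (𝓡 n) p →ₗ[ℝ] TangentSpace (𝓡 n) p,
          (∀ w, F w = Aniso.vertDerivVec Z ⟨⟨p, V p⟩, hV p hp⟩
            (HA.D e V p (hV p hp) w)) ∧
          ∀ Y : Fin n → ∀ q : M, TangentSpace (𝓡 n) q, (∀ i, Aniso.SmoothVFOn (Y i) U) →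
            Aniso.compose (l 0 n S) V p (fun i => Y i p) =
              Aniso.lieDerivForm (Aniso.composeVec Z V) (Aniso.compose S V) Y p
              - Aniso.vertDeriv S.1 ⟨⟨p, V p⟩, hV p hp⟩
                  (HA.D e V p (hV p hp) (Aniso.composeVec Z V p)) ![] (fun i => Y i p)
              - LinearMap.trace ℝ (TangentSpace (𝓡 n) p) F *
                  Aniso.compose S V p (fun i => Y i p)) := by

  have h1 : ∀ X : ∀ v : A, TangentSpace (𝓡 n) v.1.proj, Aniso.SmoothAVF X →
      ∀ (e : Aniso.Chart n M) (v : A), v.1.proj ∈ e.1.source →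
        HA.lie Z X v = HA.lieIn e Z X v :=
    fun X hX e v hv => Aniso.NonlinearConnection.lie_eq_lieIn hA hZ hX hv
  have hvec : ∀ (X : ∀ v : A, TangentSpace (𝓡 n) v.1.proj) (hX : Aniso.SmoothAVF X)
      (hY : Aniso.SmoothAVF (HA.lie Z X)),
      (HA.lieData hA hZ).op hA 1 0 (Aniso.vecTensor X hX) = Aniso.vecTensor (HA.lie Z X) hY :=
    fun X hX hY => Subtype.ext (funext fun v => funext fun θ => funext fun x =>
      Aniso.NonlinearConnection.op_vecTensor hA hZ hX (mem_chart_source _ v.1.proj) θ x)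
  have hder := Aniso.DerivationData.isTensorDerivation_op (D := HA.lieData hA hZ) hA
  refine ⟨fun X hX => ⟨Aniso.NonlinearConnection.smoothAVF_lie hA hZ hX, h1 X hX⟩,
    fun C _ => ⟨⟨C.torsion hA, C.isTorsion_torsion hA, fun T hT =>
      hT.unique (C.isTorsion_torsion hA)⟩, fun T hT X hX e v hv θ => ?_⟩,
    (HA.lieData hA hZ).op hA, hder, hvec, fun l' hl' h => ?_,
    fun r s T θ X hX e v hv => Aniso.NonlinearConnection.op_fields hA hZ T θ X hX hv,
    fun r s T e v hv I J => Aniso.NonlinearConnection.comp_op hA hZ T hv I J,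
    ⟨Aniso.lieOp hA HA hZ, fun r s T v θ x => Aniso.lieOp_apply hA HA hZ T v θ x,
      Aniso.isTensorDerivation_lieOp hA HA hZ, fun Z₀ hZ₀ h => ?_⟩,
    fun U V hU hV hVA S hS e p hp hpe => ?_⟩
  · rw [h1 X hX e v hv]
    exact hT.apply_eq hA HA Z X hv θ
  · have hX : ∀ (X : ∀ v : A, TangentSpace (𝓡 n) v.1.proj) (hX : Aniso.SmoothAVF X),
        l' 1 0 (Aniso.vecTensor X hX) = (HA.lieData hA hZ).op hA 1 0 (Aniso.vecTensor X hX) :=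
      fun X hX => (h X hX (Aniso.NonlinearConnection.smoothAVF_lie hA hZ hX)).trans
        (hvec X hX _).symm
    -- Agreement on functions is not assumed: it follows from agreement on all anisotropic vector
    -- fields, among which are the multiples `fX`.
    exact hl'.eq_of_forall hder (fun f => sub_eq_zero.1 ((hl'.sub hder).eq_zero_on_functions
      (by omega) (fun X hX' => sub_eq_zero.2 (hX X hX')) f)) fun X hX' => hX _ hX'.smoothAVF
  · obtain rfl : Z = fun v => Z₀ v.1.proj := funext h
    exact ⟨Aniso.isLieDerivative_lieOp hA HA hZ₀,
      fun L' hL' => (Aniso.isLieDerivative_lieOp hA HA hZ₀).unique hL'⟩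
  · set v : A := ⟨⟨p, V p⟩, hVA p hp⟩
    have hv : v.1.proj ∈ e.1.source := hpe
    have hF : ∀ w, ((Aniso.vertLin e Z v).comp (HA.DLin e V p (hVA p hp))) w =
        Aniso.vertDerivVec Z v (HA.D e V p (hVA p hp) w) := fun w => by
      rw [LinearMap.comp_apply, HA.DLin_apply]
      exact Aniso.vertLin_apply hA hZ hv _
    -- The endomorphism whose trace is taken is the composite of the linear maps `w ↦ D_w V` and `y
    -- ↦ ∂̇_y Z`.
    refine ⟨(Aniso.vertLin e Z v).comp (HA.DLin e V p (hVA p hp)), hF, fun Y hY => ?_⟩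
    rw [Aniso.compose_op hA hZ hU hV hVA S hp hpe hY]
    congr 1
    have hc : ∀ x, Aniso.compose S V p x = S.1 v ![] x := fun x => dif_pos (hVA p hp)
    simp only [hc]
    -- The trace times the top form is the sum of the slot corrections supplied by `compose_op`.
    rw [← hS.sum_map_update v]
    exact Finset.sum_congr rfl fun i _ =>
      congrArg (fun w => S.1 v ![] (Function.update (fun i => Y i p) i w)) (hF (Y i p)).symm
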